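/- Let $n\ge 1$, $0<s<1$, $a:=1-s$, $R>0$. For measurable $A,B\subset\mathbb R^n$ let $L(A,B)=\int_A\int_B |x-y|^{-(n+s)}\,dy\,dx\in[0,\infty]$, and for a ball $\Omega=B_R=\{|x|<R\}\subset\mathbb R^n$ and measurable $E$ let $\mathcal J_\Omega(E)=L(E\cap\Omega,\mathcal CE)+L(E\setminus\Omega,\mathcal CE\cap\Omega)$, where $\mathcal CE=\mathbb R^n\setminus E$. Let $E\subset\mathbb R^n$ be a measurable set that is a minimizer for $\mathcal J$ in $B_R$, i.e. $\mathcal J_{B_R}(E)\le\mathcal J_{B_R}(F)$ for every measurable $F$ with $F\cap\mathcal CB_R=E\cap\mathcal CB_R$. Put $u=\chi_E-\chi_{\mathcal CE}$ and let $\tilde u$ be its Caffarelli–Silvestre extension to $\{(x,z):x\in\mathbb R^n,\ z>0\}$, i.e. the solution of $\operatorname{div}(z^a\nabla\tilde u)=0$ with trace $u$ on $\{z=0\}$ given by $$\tilde u(x,z)=\int_{\mathbb R^n}P(x-y,z)\,u(y)\,dy,\qquad P(x,z)=c_{n,a}\frac{z^{1-a}}{(|x|^2+z^2)^{(n+1-a)/2}},$$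 where $c_{n,a}$ is the constant for which $\int_{\mathbb R^n}P(x,z)\,dx=1$. With $B_r^+=\{(x,z): |x|^2+z^2<r^2,\ z>0\}$ define $$\Phi_E(r)=\frac{1}{r^{n+a-1}}\int_{B_r^+}z^a|\nabla\tilde u|^2\,dx\,dz,\qquad 0<r<R.$$ Then these integrals are finite, and $\Phi_E$ is nondecreasing on $(0,R)$. Moreover, $\Phi_E$ is constant on $(0,R)$ if and only if $\tilde u$ is homogeneous of degree $0$, i.e. $\tilde u(tx,tz)=\tilde u(x,z)$ for all $x\in\mathbb R^n$, $z>0$, $t>0$. -/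

import Mathlib

open MeasureTheory Set

namespace NonlocalMinimal

noncomputable section

/-- The interaction `L(A, B) = ∫_A ∫_B |x - y|^{-(n+s)} dy dx`, with values in `[0, ∞]`. -/
def interaction {n : ℕ} (s : ℝ) (A B : Set (EuclideanSpace ℝ (Fin n))) : ENNReal :=
  ∫⁻ x in A, ∫⁻ y in B, ENNReal.ofReal (1 / ‖x - y‖ ^ ((n : ℝ) + s))

/-- The local energy `J_Ω(E) = L(E ∩ Ω, Eᶜ) + L(E \ Ω, Eᶜ ∩ Ω)`. -/
def localEnergy {n : ℕ} (s : ℝ) (Ω E : Set (EuclideanSpace ℝ (Fin n))) : ENNReal :=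
  interaction s (E ∩ Ω) Eᶜ + interaction s (E \ Ω) (Eᶜ ∩ Ω)

/-- The (Lebesgue measurable) set `E` minimizes `J_Ω` among all Lebesgue measurable sets that
coincide with `E` outside `Ω`. -/
def IsMinimizer {n : ℕ} (s : ℝ) (Ω E : Set (EuclideanSpace ℝ (Fin n))) : Prop :=
  NullMeasurableSet E ∧
    ∀ F : Set (EuclideanSpace ℝ (Fin n)), NullMeasurableSet F → F ∩ Ωᶜ = E ∩ Ωᶜ →
      localEnergy s Ω E ≤ localEnergy s Ω F

/-- The function `χ_E - χ_{Eᶜ}`. -/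
def signChar {n : ℕ} (E : Set (EuclideanSpace ℝ (Fin n))) (x : EuclideanSpace ℝ (Fin n)) : ℝ :=
  E.indicator 1 x - Eᶜ.indicator 1 x

/-- The space `ℝⁿ × ℝ` with its Euclidean norm; its points `X` have the components
`x = X.fst` and `z = X.snd`. -/
abbrev ExtSpace (n : ℕ) : Type := WithLp 2 (EuclideanSpace ℝ (Fin n) × ℝ)

/-- The open upper half-space `{z > 0}`. -/
def upperHalf (n : ℕ) : Set (ExtSpace n) := {X | 0 < X.snd}

/-- The upper half-ball `B_r⁺ = {(x, z) : |x|² + z² < r², z > 0}`. -/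
def halfBall (n : ℕ) (r : ℝ) : Set (ExtSpace n) := Metric.ball 0 r ∩ upperHalf n

/-- The constant for which the kernel `P(·, z)` below has total mass `1`. -/
def poissonConst (n : ℕ) (s : ℝ) : ℝ :=
  (∫ y : EuclideanSpace ℝ (Fin n), 1 / (‖y‖ ^ 2 + 1) ^ (((n : ℝ) + s) / 2))⁻¹

/-- The Poisson kernel `P(x, z) = c z^{1-a} / (|x|² + z²)^{(n+1-a)/2}`, `a = 1 - s`, `z > 0`,
of the equation `div (z^a ∇ũ) = 0` in the upper half-space. -/
def poissonKernel {n : ℕ} (s : ℝ) (x : EuclideanSpace ℝ (Fin n)) (z : ℝ) : ℝ :=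
  poissonConst n s * (z ^ s / (‖x‖ ^ 2 + z ^ 2) ^ (((n : ℝ) + s) / 2))

/-- The Caffarelli–Silvestre extension `ũ(·, z) = P(·, z) * u` to the upper half-space `z > 0`. -/
def csExtension {n : ℕ} (s : ℝ) (u : EuclideanSpace ℝ (Fin n) → ℝ) (X : ExtSpace n) : ℝ :=
  ∫ y, poissonKernel s (X.fst - y) X.snd * u y

/-- The weighted energy density `z^a |∇U|²` with `a = 1 - s`. -/
def energyDensity {n : ℕ} (s : ℝ) (U : ExtSpace n → ℝ) (X : ExtSpace n) : ℝ :=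
  X.snd ^ (1 - s) * ‖gradient U X‖ ^ 2

/-- `Φ_E(r) = r^{-(n+a-1)} ∫_{B_r⁺} z^a |∇ũ|²` with `a = 1 - s` and `u = χ_E - χ_{Eᶜ}`. -/
def scaledEnergy {n : ℕ} (s : ℝ) (E : Set (EuclideanSpace ℝ (Fin n))) (r : ℝ) : ℝ :=
  (∫ X in halfBall n r, energyDensity s (csExtension s (signChar E)) X) /
    r ^ ((n : ℝ) + (1 - s) - 1)

/-- `U` is homogeneous of degree `0` in the open upper half-space. -/
def IsHomogeneousZero {n : ℕ} (U : ExtSpace n → ℝ) : Prop :=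
  ∀ X ∈ upperHalf n, ∀ t : ℝ, 0 < t → U (t • X) = U X

end

end NonlocalMinimal

open MeasureTheory Set Filter Topology

namespace NonlocalMinimal

noncomputable section

/-! ### Coordinates on the extended half-space. -/

variable {n : ℕ} {s : ℝ}

/-! Write `U` for the extension of `u = signChar E`, `a = 1 - s`, `d = n - s`, and `c` for the
Poisson constant.

The nonlocal perimeter is a weighted Dirichlet energy in disguise. If `W` vanishes for large `|X|`
and has trace `w`, then `∫ z^a ∇W · ∇U = (c s / 2) gForm w u` (`weak_equation`), and the energy of
`W` is at least `(c s / 2) gForm w w` (`trace_inequality`). The Gagliardo form of a sign function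
over the pairs that meet `B_R` is eight times the local energy (`lintegral_crossRegion`). Expanding
the energy of `V = U + W` therefore turns minimality of `E` into minimality of `U`: its energy in
the half-ball is at most that of any admissible `V` which agrees with `U` beyond a radius `ρ < R`
and whose trace is again a sign function (`energy_le_competitor`).

Since the trace has to keep the values `±1`, `U` is varied by moving points. The map `X ↦ (1 + t
η(|X|²)) X` preserves both the half-space and its boundary, so transporting `U` by it gives a
function whose trace is the sign function of a transported set (`energy_le_deformed`). The
transported energy is minimal at `t = 0`, and its vanishing derivative is the Pohozaev identity
(`pohozaev`).

Taking for `η` the function `|X|^{-d} - r₂^{-d}`, frozen for `|X| < r₁` and cut to zero for `|X| ≥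
r₂`, makes that identity read `Φ(r₂) - Φ(r₁) = 2 ∫ z^a |X|^{-d-2} (X · ∇U)²` over the half-annulus
(`scaledEnergy_sub`). Monotonicity is immediate, and `Φ` is constant exactly when `X · ∇U = 0` in
the half-ball of radius `R`. Because `t ↦ U(tX)` is real analytic on `t > 0`
(`analyticAt_csExtension_ray`), the latter forces homogeneity on the whole half-space.

Finiteness comes from comparing `E` with `E \ B_R`, whose local energy is finite because `s < 1`,
and from bounding the energy over a cylinder by the Gagliardo energy of the trace
(`exists_energy_le`). -/

/-- The embedding `y ↦ (y, 0)` of the boundary. -/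
def bdry (y : EuclideanSpace ℝ (Fin n)) : ExtSpace n := WithLp.toLp 2 (y, 0)

/-- The point `(x, z)`. -/
def pt (x : EuclideanSpace ℝ (Fin n)) (z : ℝ) : ExtSpace n := WithLp.toLp 2 (x, z)

/-- The vertical unit vector. -/
def vert (n : ℕ) : ExtSpace n := WithLp.toLp 2 (0, 1)

@[simp] lemma pt_fst (x : EuclideanSpace ℝ (Fin n)) (z : ℝ) : (pt x z).fst = x := rfl
@[simp] lemma pt_snd (x : EuclideanSpace ℝ (Fin n)) (z : ℝ) : (pt x z).snd = z := rfl
@[simp] lemma bdry_fst (x : EuclideanSpace ℝ (Fin n)) : (bdry x).fst = x := rfl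
@[simp] lemma bdry_snd (x : EuclideanSpace ℝ (Fin n)) : (bdry x).snd = 0 := rfl
@[simp] lemma vert_fst : (vert n).fst = 0 := rfl
@[simp] lemma vert_snd : (vert n).snd = 1 := rfl

lemma norm_sq_ext (X : ExtSpace n) : ‖X‖ ^ 2 = ‖X.fst‖ ^ 2 + X.snd ^ 2 := by
  rw [WithLp.prod_norm_sq_eq_of_L2]; simp [sq_abs]

lemma inner_ext (X Y : ExtSpace n) :
    inner ℝ X Y = inner ℝ X.fst Y.fst + X.snd * Y.snd := by
  rw [WithLp.prod_inner_apply]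
  simp [mul_comm]

lemma norm_sq_sub_bdry (X : ExtSpace n) (y : EuclideanSpace ℝ (Fin n)) :
    ‖X - bdry y‖ ^ 2 = ‖X.fst - y‖ ^ 2 + X.snd ^ 2 := by
  rw [norm_sq_ext]; simp

lemma inner_vert (X : ExtSpace n) : inner ℝ (vert n) X = X.snd := by
  rw [inner_ext]; simp

lemma norm_vert : ‖vert n‖ = 1 := by
  have := norm_sq_ext (vert n)
  simp only [vert_fst, norm_zero, vert_snd] at this
  have h0 := norm_nonneg (vert n)
  nlinarith

lemma abs_snd_le (X : ExtSpace n) : |X.snd| ≤ ‖X‖ := by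
  have := norm_sq_ext X
  apply abs_le_of_sq_le_sq _ (norm_nonneg _)
  nlinarith [sq_nonneg ‖X.fst‖]

lemma norm_fst_le (X : ExtSpace n) : ‖X.fst‖ ≤ ‖X‖ := by
  have := norm_sq_ext X
  apply le_of_sq_le_sq _ (norm_nonneg _)
  nlinarith [sq_nonneg X.snd]

@[fun_prop] lemma continuous_fst_ext : Continuous (fun X : ExtSpace n => X.fst) :=
  WithLp.continuous_fst ..

@[fun_prop] lemma continuous_snd_ext : Continuous (fun X : ExtSpace n => X.snd) :=
  WithLp.continuous_snd ..

@[fun_prop] lemma measurable_fst_ext : Measurable (fun X : ExtSpace n => X.fst) :=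
  continuous_fst_ext.measurable

@[fun_prop] lemma measurable_snd_ext : Measurable (fun X : ExtSpace n => X.snd) :=
  continuous_snd_ext.measurable

lemma continuous_pt : Continuous (fun q : EuclideanSpace ℝ (Fin n) × ℝ => pt q.1 q.2) :=
  WithLp.prod_continuous_toLp ..

@[fun_prop] lemma continuous_pt_comp {α : Type*} [TopologicalSpace α]
    {f : α → EuclideanSpace ℝ (Fin n)} {g : α → ℝ} (hf : Continuous f) (hg : Continuous g) :
    Continuous (fun a => pt (f a) (g a)) :=
  continuous_pt.comp (hf.prodMk hg)

@[fun_prop] lemma continuous_bdry : Continuous (bdry : EuclideanSpace ℝ (Fin n) → ExtSpace n) :=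
  continuous_pt_comp continuous_id continuous_const

@[fun_prop] lemma measurable_bdry : Measurable (bdry : EuclideanSpace ℝ (Fin n) → ExtSpace n) :=
  continuous_bdry.measurable

lemma isOpen_upperHalf : IsOpen (upperHalf n) :=
  isOpen_lt continuous_const continuous_snd_ext

lemma measurableSet_upperHalf : MeasurableSet (upperHalf n) := isOpen_upperHalf.measurableSet

/-! ### The radial integrals -/

/-- The profile at height `z` is a dilate of the profile at height one, which reduces integrability
and total mass at every height to a single integral. -/
lemma rad_scale {z : ℝ} (hz : 0 < z) (δ : ℝ) (y : EuclideanSpace ℝ (Fin n)) :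
    (‖y‖ ^ 2 + z ^ 2) ^ (-((n : ℝ) + δ) / 2) =
      z ^ (-((n : ℝ) + δ)) * (1 + ‖z⁻¹ • y‖ ^ 2) ^ (-((n : ℝ) + δ) / 2) := by
  have h1 : ‖y‖ ^ 2 + z ^ 2 = z ^ 2 * (1 + ‖z⁻¹ • y‖ ^ 2) := by
    rw [norm_smul, norm_inv, Real.norm_of_nonneg hz.le]; field_simp; ring
  rw [h1, Real.mul_rpow (by positivity) (by positivity)]
  congr 1
  rw [← Real.rpow_natCast, ← Real.rpow_mul hz.le]
  congr 1; push_cast; ring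

lemma integrable_rad {z δ : ℝ} (hz : 0 < z) (hδ : 0 < δ) :
    Integrable (fun y : EuclideanSpace ℝ (Fin n) =>
      (‖y‖ ^ 2 + z ^ 2) ^ (-((n : ℝ) + δ) / 2)) := by
  simp_rw [rad_scale hz]
  apply Integrable.const_mul
  have h := integrable_rpow_neg_one_add_norm_sq (E := EuclideanSpace ℝ (Fin n))
    (μ := volume) (r := n + δ) (by simpa using hδ)
  exact h.comp_smul (inv_ne_zero hz.ne')

/-- The mass at height one of the radial profile of order `n + δ`. -/
def radMass (n : ℕ) (δ : ℝ) : ℝ :=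
  ∫ y : EuclideanSpace ℝ (Fin n), (1 + ‖y‖ ^ 2) ^ (-((n : ℝ) + δ) / 2)

lemma integral_rad {z : ℝ} (hz : 0 < z) (δ : ℝ) :
    ∫ y : EuclideanSpace ℝ (Fin n), (‖y‖ ^ 2 + z ^ 2) ^ (-((n : ℝ) + δ) / 2) =
      z ^ (-δ) * radMass n δ := by
  simp_rw [rad_scale hz]
  rw [integral_const_mul,
    Measure.integral_comp_smul volume
      (fun y : EuclideanSpace ℝ (Fin n) => (1 + ‖y‖ ^ 2) ^ (-((n : ℝ) + δ) / 2)) z⁻¹]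
  rw [radMass, smul_eq_mul, ← mul_assoc]
  congr 1
  rw [finrank_euclideanSpace, Fintype.card_fin, inv_pow, inv_inv, abs_of_pos (by positivity),
    ← Real.rpow_natCast, ← Real.rpow_add hz]
  congr 1; ring

lemma radMass_pos {δ : ℝ} (hδ : 0 < δ) : 0 < radMass n δ := by
  have h := integrable_rpow_neg_one_add_norm_sq (E := EuclideanSpace ℝ (Fin n))
    (μ := volume) (r := n + δ) (by simpa using hδ)
  rw [radMass, integral_pos_iff_support_of_nonneg (fun y => by positivity) h]
  have : Function.support (fun y : EuclideanSpace ℝ (Fin n) =>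
      (1 + ‖y‖ ^ 2) ^ (-((n : ℝ) + δ) / 2)) = univ := by
    ext y; simp only [Function.mem_support, mem_univ, iff_true]; positivity
  rw [this]
  exact isOpen_univ.measure_pos _ univ_nonempty

lemma poissonConst_eq : poissonConst n s = (radMass n s)⁻¹ := by
  unfold poissonConst radMass
  congr 1; refine integral_congr_ae (Eventually.of_forall fun y => ?_)
  dsimp only
  rw [neg_div, Real.rpow_neg (by positivity), one_div, add_comm]

lemma poissonConst_pos (hs : 0 < s) : 0 < poissonConst n s := by
  rw [poissonConst_eq]; exact inv_pos.mpr (radMass_pos hs)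

/-! ### The kernel on the extended space -/

/-- The Poisson kernel as a function of the point `(x, z)`. -/
def baseKernel (s : ℝ) (X : ExtSpace n) : ℝ :=
  poissonConst n s * (X.snd ^ s * (‖X‖ ^ 2) ^ (-((n : ℝ) + s) / 2))

lemma poissonKernel_eq (x : EuclideanSpace ℝ (Fin n)) (z : ℝ) :
    poissonKernel s x z = baseKernel s (pt x z) := by
  unfold poissonKernel baseKernel
  rw [norm_sq_ext, neg_div, Real.rpow_neg (by positivity), pt_fst, pt_snd, div_eq_mul_inv]

lemma csExtension_eq (g : EuclideanSpace ℝ (Fin n) → ℝ) (X : ExtSpace n) :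
    csExtension s g X = ∫ y, baseKernel s (X - bdry y) * g y := by
  unfold csExtension
  refine integral_congr_ae (Eventually.of_forall fun y => ?_)
  dsimp only
  rw [poissonKernel_eq]; congr 2
  apply (WithLp.ofLp_injective 2); ext1 <;> simp [pt, bdry]

lemma baseKernel_sub_bdry (X : ExtSpace n) (y : EuclideanSpace ℝ (Fin n)) :
    baseKernel s (X - bdry y) =
      poissonConst n s * X.snd ^ s * (‖y - X.fst‖ ^ 2 + X.snd ^ 2) ^ (-((n : ℝ) + s) / 2) := by
  rw [baseKernel, norm_sq_sub_bdry, norm_sub_rev]; simp [mul_assoc]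

lemma integrable_baseKernel (hs : 0 < s) {X : ExtSpace n} (hX : 0 < X.snd) :
    Integrable (fun y => baseKernel s (X - bdry y)) := by
  simp_rw [baseKernel_sub_bdry]
  exact ((integrable_rad hX hs).comp_sub_right X.fst).const_mul _

lemma integral_baseKernel (hs : 0 < s) {X : ExtSpace n} (hX : 0 < X.snd) :
    ∫ y, baseKernel s (X - bdry y) = 1 := by
  simp_rw [baseKernel_sub_bdry]
  rw [integral_const_mul, integral_sub_right_eq_self
    (fun y => (‖y‖ ^ 2 + X.snd ^ 2) ^ (-((n : ℝ) + s) / 2)) X.fst, integral_rad hX,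
    poissonConst_eq]
  have := (radMass_pos (n := n) hs).ne'
  rw [Real.rpow_neg hX.le]
  have : X.snd ^ s ≠ 0 := by positivity
  field_simp

lemma baseKernel_nonneg (hs : 0 < s) {X : ExtSpace n} (hX : 0 < X.snd) : 0 ≤ baseKernel s X := by
  have := poissonConst_pos (n := n) hs
  unfold baseKernel; positivity

/-- The gradient of the Poisson kernel. -/
def kernelGrad (s : ℝ) (X : ExtSpace n) : ExtSpace n :=
  poissonConst n s • ((s * X.snd ^ (s - 1) * (‖X‖ ^ 2) ^ (-((n : ℝ) + s) / 2)) • vert n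
    - (((n : ℝ) + s) * X.snd ^ s * (‖X‖ ^ 2) ^ (-((n : ℝ) + s) / 2 - 1)) • X)

lemma norm_sq_pos {X : ExtSpace n} (hX : 0 < X.snd) : 0 < ‖X‖ ^ 2 := by
  rw [norm_sq_ext]; positivity

lemma hasFDerivAt_snd (X : ExtSpace n) :
    HasFDerivAt (fun X : ExtSpace n => X.snd) (innerSL ℝ (vert n)) X := by
  have h : (fun X : ExtSpace n => X.snd) = innerSL ℝ (vert n) := by
    ext X; simp
  rw [h]; exact (innerSL ℝ (vert n)).hasFDerivAt

lemma hasGradientAt_baseKernel {X : ExtSpace n} (hX : 0 < X.snd) :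
    HasGradientAt (baseKernel s) (kernelGrad s X) X := by
  have h1 := (hasFDerivAt_snd X).rpow_const (p := s) (Or.inl hX.ne')
  have h2 := ((hasStrictFDerivAt_norm_sq X).hasFDerivAt).rpow_const
    (p := -((n : ℝ) + s) / 2) (Or.inl (norm_sq_pos hX).ne')
  have h3 := (h1.mul h2).const_mul (poissonConst n s)
  rw [hasGradientAt_iff_hasFDerivAt]
  refine h3.congr_fderiv ?_
  ext Y
  simp [kernelGrad]
  ring

/-- Since `z ≤ |X|`, the radial term is no worse than the vertical one: a derivative costs a factor
`1/z` and keeps the horizontal decay of the kernel, hence its integrability in `y`. -/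
lemma norm_kernelGrad_le (hs : 0 < s) {X : ExtSpace n} (hX : 0 < X.snd) :
    ‖kernelGrad s X‖ ≤ poissonConst n s * (n + 2 * s) *
      (X.snd ^ (s - 1) * (‖X‖ ^ 2) ^ (-((n : ℝ) + s) / 2)) := by
  have hc := poissonConst_pos (n := n) hs
  have hq := norm_sq_pos hX
  rw [kernelGrad, norm_smul, Real.norm_of_nonneg hc.le, mul_assoc (poissonConst n s)]
  gcongr
  refine (norm_sub_le (_ : ExtSpace n) _).trans ?_
  rw [norm_smul, norm_smul, norm_vert, mul_one, Real.norm_of_nonneg (by positivity),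
    Real.norm_of_nonneg (by positivity)]
  have h1 : X.snd ^ s = X.snd ^ (s - 1) * X.snd := by
    rw [← Real.rpow_add_one hX.ne']; congr 1; ring
  have h2 : (‖X‖ ^ 2) ^ (-((n : ℝ) + s) / 2) = (‖X‖ ^ 2) ^ (-((n : ℝ) + s) / 2 - 1) * ‖X‖ ^ 2 := by
    rw [← Real.rpow_add_one hq.ne']; congr 1; ring
  have h3 : X.snd * ‖X‖ ≤ ‖X‖ ^ 2 := by
    have := abs_snd_le X
    rw [abs_of_pos hX] at this
    nlinarith [norm_nonneg X]
  have h4 : X.snd ^ s * (‖X‖ ^ 2) ^ (-((n : ℝ) + s) / 2 - 1) * ‖X‖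
      ≤ X.snd ^ (s - 1) * (‖X‖ ^ 2) ^ (-((n : ℝ) + s) / 2) := by
    rw [h1, h2]
    calc _ = (X.snd ^ (s - 1) * (‖X‖ ^ 2) ^ (-((n : ℝ) + s) / 2 - 1)) * (X.snd * ‖X‖) := by ring
      _ ≤ (X.snd ^ (s - 1) * (‖X‖ ^ 2) ^ (-((n : ℝ) + s) / 2 - 1)) * ‖X‖ ^ 2 := by gcongr
      _ = _ := by ring
  have h5 : 0 ≤ (n : ℝ) + s := by positivity
  nlinarith [mul_le_mul_of_nonneg_left h4 h5]

/-! ### The extension is continuously differentiable -/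

lemma hasGradientAt_integral_of_dominated {α H : Type*} [MeasurableSpace α] {μ : Measure α}
    [NormedAddCommGroup H] [InnerProductSpace ℝ H] [CompleteSpace H]
    {F : H → α → ℝ} {F' : H → α → H} {x₀ : H} {bound : α → ℝ} {S : Set H} (hS : S ∈ 𝓝 x₀)
    (hF : ∀ᶠ x in 𝓝 x₀, AEStronglyMeasurable (F x) μ) (hF0 : Integrable (F x₀) μ)
    (hF' : AEStronglyMeasurable (F' x₀) μ) (hb : ∀ a, ∀ x ∈ S, ‖F' x a‖ ≤ bound a)
    (hbi : Integrable bound μ) (hd : ∀ a, ∀ x ∈ S, HasGradientAt (F · a) (F' x a) x) :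
    HasGradientAt (fun x => ∫ a, F x a ∂μ) (∫ a, F' x₀ a ∂μ) x₀ := by
  have hint : Integrable (F' x₀) μ := hbi.mono' hF'
    (Eventually.of_forall fun a => hb a x₀ (mem_of_mem_nhds hS))
  have hmeas : AEStronglyMeasurable (fun a => InnerProductSpace.toDual ℝ H (F' x₀ a)) μ :=
    (InnerProductSpace.toDual ℝ H).continuous.comp_aestronglyMeasurable hF'
  have key := hasFDerivAt_integral_of_dominated_of_fderiv_le (μ := μ) (𝕜 := ℝ)
    (F := F) (x₀ := x₀) (F' := fun x a => InnerProductSpace.toDual ℝ H (F' x a))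
    (bound := bound) hS hF hF0 hmeas
    (Eventually.of_forall fun a x hx => by
      rw [LinearIsometryEquiv.norm_map]; exact hb a x hx) hbi
    (Eventually.of_forall fun a x hx => (hd a x hx).hasFDerivAt)
  rw [hasGradientAt_iff_hasFDerivAt]
  refine key.congr_fderiv ?_
  exact ((InnerProductSpace.toDual ℝ H).toContinuousLinearEquiv :
    H ≃L[ℝ] StrongDual ℝ H).integral_comp_comm (F' x₀)

lemma contDiffOn_one_of_hasGradientAt {H : Type*} [NormedAddCommGroup H] [InnerProductSpace ℝ H]
    [CompleteSpace H] {S : Set H} (hS : IsOpen S) {f : H → ℝ} {f' : H → H}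
    (hf : ∀ x ∈ S, HasGradientAt f (f' x) x) (hc : ContinuousOn f' S) : ContDiffOn ℝ 1 f S := by
  rw [show (1 : WithTop ℕ∞) = 0 + 1 from rfl, contDiffOn_succ_iff_fderiv_of_isOpen hS]
  refine ⟨fun x hx => (hf x hx).hasFDerivAt.differentiableAt.differentiableWithinAt, by simp, ?_⟩
  rw [contDiffOn_zero]
  refine ((InnerProductSpace.toDual ℝ H).continuous.comp_continuousOn hc).congr fun x hx => ?_
  exact (hf x hx).hasFDerivAt.fderiv

lemma sub_bdry_mem {X : ExtSpace n} (hX : X ∈ upperHalf n) (y : EuclideanSpace ℝ (Fin n)) :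
    X - bdry y ∈ upperHalf n := by
  simpa [upperHalf] using hX

lemma continuousOn_kernelGrad : ContinuousOn (kernelGrad (n := n) s) (upperHalf n) := by
  intro X hX
  have hX' : 0 < X.snd := hX
  have hq := norm_sq_pos hX'
  apply ContinuousAt.continuousWithinAt
  have h1 : ∀ r : ℝ, ContinuousAt (fun X : ExtSpace n => X.snd ^ r) X := fun r =>
    continuous_snd_ext.continuousAt.rpow_const (Or.inl hX'.ne')
  have h2 : ∀ r : ℝ, ContinuousAt (fun X : ExtSpace n => (‖X‖ ^ 2) ^ r) X := fun r =>
    (continuous_norm.pow 2).continuousAt.rpow_const (Or.inl hq.ne')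
  unfold kernelGrad
  exact ((((continuousAt_const.mul (h1 _)).mul (h2 _)).smul continuousAt_const).sub
    (((continuousAt_const.mul (h1 _)).mul (h2 _)).smul continuousAt_id)).const_smul (poissonConst n s)

@[fun_prop] lemma measurable_kernelGrad : Measurable (kernelGrad (n := n) s) := by
  unfold kernelGrad
  fun_prop

@[fun_prop] lemma measurable_baseKernel : Measurable (baseKernel (n := n) s) := by
  unfold baseKernel
  fun_prop

lemma measurable_kernelGrad_sub (X : ExtSpace n) :
    Measurable (fun y => kernelGrad s (X - bdry y)) :=
  measurable_kernelGrad.comp (by fun_prop)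

/-- On this ball the distance to every boundary point is comparable, uniformly in `y`, to its value
at the centre. One integrable majorant then serves the whole ball when differentiating under the
integral. -/
lemma kernel_nhds {X₀ X : ExtSpace n} (hX₀ : 0 < X₀.snd) (hX : X ∈ Metric.ball X₀ (X₀.snd / 2)) :
    X₀.snd / 2 < X.snd ∧ ∀ y, ‖X₀ - bdry y‖ ^ 2 / 4 ≤ ‖X - bdry y‖ ^ 2 := by
  rw [mem_ball_iff_norm] at hX
  have h1 : X₀.snd / 2 < X.snd := by
    have := (abs_snd_le (X - X₀)).trans_lt hX
    simp only [WithLp.sub_snd] at this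
    rw [abs_lt] at this; linarith
  refine ⟨h1, fun y => ?_⟩
  have h2 : X.snd ≤ ‖X - bdry y‖ := by
    have := abs_snd_le (X - bdry y)
    simp only [WithLp.sub_snd, bdry_snd, sub_zero] at this
    exact (le_abs_self _).trans this
  have h3 : ‖X₀ - bdry y‖ ≤ ‖X - bdry y‖ + ‖X - X₀‖ := by
    have := norm_sub_le (X - bdry y) (X - X₀)
    simpa using this
  have h4 : ‖X₀ - bdry y‖ ≤ 2 * ‖X - bdry y‖ := by linarith
  nlinarith [norm_nonneg (X₀ - bdry y), norm_nonneg (X - bdry y)]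

lemma norm_kernelGrad_nhds_le (hs : 0 < s) {X₀ : ExtSpace n} (hX₀ : 0 < X₀.snd) :
    ∃ C, 0 ≤ C ∧ ∀ X ∈ Metric.ball X₀ (X₀.snd / 2), ∀ y, ‖kernelGrad s (X - bdry y)‖ ≤
      C * (‖y - X₀.fst‖ ^ 2 + X₀.snd ^ 2) ^ (-((n : ℝ) + s) / 2) := by
  have hc := poissonConst_pos (n := n) hs
  obtain ⟨M, hM⟩ : ∃ M : ℝ, 0 ≤ M ∧ ∀ z ∈ Icc (X₀.snd / 2) (2 * X₀.snd), z ^ (s - 1) ≤ M := by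
    have hcont : ContinuousOn (fun z : ℝ => z ^ (s - 1)) (Icc (X₀.snd / 2) (2 * X₀.snd)) := by
      intro z hz
      exact (Real.continuousAt_rpow_const _ _ (Or.inl (by linarith [hz.1]))).continuousWithinAt
    obtain ⟨M, hM⟩ := isCompact_Icc.exists_bound_of_continuousOn hcont
    refine ⟨|M|, abs_nonneg _, fun z hz => ?_⟩
    exact (le_abs_self _).trans ((hM z hz).trans (le_abs_self _))
  refine ⟨poissonConst n s * (n + 2 * s) * (M * (1 / 4) ^ (-((n : ℝ) + s) / 2)), ?_, ?_⟩
  · have := hM.1; positivity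
  intro X hX y
  obtain ⟨h1, h2⟩ := kernel_nhds hX₀ hX
  have hX' : 0 < X.snd := by linarith
  have h1' : X.snd ≤ 2 * X₀.snd := by
    rw [mem_ball_iff_norm] at hX
    have := (abs_snd_le (X - X₀)).trans_lt hX
    simp only [WithLp.sub_snd] at this
    rw [abs_lt] at this; linarith
  refine (norm_kernelGrad_le hs (sub_bdry_mem hX' y)).trans ?_
  have e1 : (X - bdry y).snd = X.snd := by simp
  rw [e1]
  have e2 := norm_sq_sub_bdry X₀ y
  rw [norm_sub_rev X₀.fst] at e2
  rw [← e2, mul_assoc (_ * _), mul_assoc M, ← Real.mul_rpow (by norm_num) (by positivity)]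
  have hp : (‖X - bdry y‖ ^ 2) ^ (-((n : ℝ) + s) / 2) ≤
      (1 / 4 * ‖X₀ - bdry y‖ ^ 2) ^ (-((n : ℝ) + s) / 2) := by
    apply Real.rpow_le_rpow_of_nonpos
    · have := norm_sq_pos (sub_bdry_mem hX₀ y); positivity
    · have := h2 y; linarith
    · have : 0 ≤ (n : ℝ) + s := by positivity
      linarith
  exact mul_le_mul_of_nonneg_left (mul_le_mul (hM.2 _ ⟨h1.le, h1'⟩) hp (by positivity) hM.1)
    (by positivity)

lemma integrable_kernelGrad (hs : 0 < s) {X : ExtSpace n} (hX : 0 < X.snd) :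
    Integrable (fun y => kernelGrad s (X - bdry y)) := by
  obtain ⟨C, -, hC⟩ := norm_kernelGrad_nhds_le hs hX
  refine Integrable.mono' (((integrable_rad hX hs).comp_sub_right X.fst).const_mul C)
    (measurable_kernelGrad_sub X).aestronglyMeasurable (Eventually.of_forall fun y => hC X (Metric.mem_ball_self (by positivity)) y)

/-- The gradient of the extension of `g`. -/
def extGrad (s : ℝ) (g : EuclideanSpace ℝ (Fin n) → ℝ) (X : ExtSpace n) : ExtSpace n :=
  ∫ y, g y • kernelGrad s (X - bdry y)

lemma integrable_smul_kernelGrad (hs : 0 < s) {g : EuclideanSpace ℝ (Fin n) → ℝ}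
    (hg : Measurable g) {b : ℝ} (hb : ∀ y, |g y| ≤ b) {X : ExtSpace n} (hX : 0 < X.snd) :
    Integrable (fun y => g y • kernelGrad s (X - bdry y)) :=
  (integrable_kernelGrad hs hX).bdd_smul b hg.aestronglyMeasurable
    (Eventually.of_forall hb)

lemma integrable_baseKernel_mul (hs : 0 < s) {g : EuclideanSpace ℝ (Fin n) → ℝ}
    (hg : Measurable g) {b : ℝ} (hb : ∀ y, |g y| ≤ b) {X : ExtSpace n} (hX : 0 < X.snd) :
    Integrable (fun y => baseKernel s (X - bdry y) * g y) :=
  (integrable_baseKernel hs hX).mul_bdd hg.aestronglyMeasurable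
    (Eventually.of_forall hb)

lemma hasGradientAt_csExtension (hs : 0 < s) {g : EuclideanSpace ℝ (Fin n) → ℝ}
    (hg : Measurable g) {b : ℝ} (hb : ∀ y, |g y| ≤ b) {X : ExtSpace n} (hX : 0 < X.snd) :
    HasGradientAt (csExtension s g) (extGrad s g X) X := by
  obtain ⟨C, hC0, hC⟩ := norm_kernelGrad_nhds_le hs hX
  have hb0 : 0 ≤ b := (abs_nonneg _).trans (hb 0)
  have hU : Metric.ball X (X.snd / 2) ∈ 𝓝 X := Metric.ball_mem_nhds _ (by positivity)
  have e : csExtension s g = fun X => ∫ y, baseKernel s (X - bdry y) * g y := by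
    ext X; rw [csExtension_eq]
  rw [e]
  refine hasGradientAt_integral_of_dominated
    (bound := fun y => b * (C * (‖y - X.fst‖ ^ 2 + X.snd ^ 2) ^ (-((n : ℝ) + s) / 2)))
    (F' := fun X y => g y • kernelGrad s (X - bdry y)) hU ?_ ?_ ?_ ?_ ?_ ?_
  · refine Eventually.of_forall fun Y => ?_
    exact ((measurable_baseKernel.comp (by fun_prop)).mul hg).aestronglyMeasurable
  · exact integrable_baseKernel_mul hs hg hb hX
  · exact (hg.smul (measurable_kernelGrad_sub X)).aestronglyMeasurable
  · intro y Y hY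
    rw [norm_smul]
    exact mul_le_mul (hb y) (hC Y hY y) (norm_nonneg _) hb0
  · exact (((integrable_rad hX hs).comp_sub_right X.fst).const_mul C).const_mul b
  · intro y Y hY
    have hY' : 0 < Y.snd := by linarith [(kernel_nhds hX hY).1]
    have h := (hasGradientAt_baseKernel (s := s) (sub_bdry_mem hY' y)).hasFDerivAt
    have h2 := (h.comp Y ((hasFDerivAt_id Y).sub_const (bdry y))).mul_const (g y)
    rw [hasGradientAt_iff_hasFDerivAt]
    refine h2.congr_fderiv ?_
    rw [map_smul, ContinuousLinearMap.comp_id]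

lemma gradient_csExtension (hs : 0 < s) {g : EuclideanSpace ℝ (Fin n) → ℝ}
    (hg : Measurable g) {b : ℝ} (hb : ∀ y, |g y| ≤ b) {X : ExtSpace n} (hX : 0 < X.snd) :
    gradient (csExtension s g) X = extGrad s g X :=
  (hasGradientAt_csExtension hs hg hb hX).gradient

lemma continuousOn_extGrad (hs : 0 < s) {g : EuclideanSpace ℝ (Fin n) → ℝ}
    (hg : Measurable g) {b : ℝ} (hb : ∀ y, |g y| ≤ b) :
    ContinuousOn (extGrad s g) (upperHalf n) := by
  intro X hX
  have hb0 : 0 ≤ b := (abs_nonneg _).trans (hb 0)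
  obtain ⟨C, hC0, hC⟩ := norm_kernelGrad_nhds_le hs hX
  apply ContinuousAt.continuousWithinAt
  have hU : Metric.ball X (X.snd / 2) ∈ 𝓝 X :=
    Metric.ball_mem_nhds _ (half_pos (show 0 < X.snd from hX))
  refine continuousAt_of_dominated
    (bound := fun y => b * (C * (‖y - X.fst‖ ^ 2 + X.snd ^ 2) ^ (-((n : ℝ) + s) / 2))) ?_ ?_ ?_ ?_
  · exact Eventually.of_forall fun Y => (hg.smul (measurable_kernelGrad_sub Y)).aestronglyMeasurable
  · filter_upwards [hU] with Y hY
    refine Eventually.of_forall fun y => ?_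
    rw [norm_smul]
    exact mul_le_mul (hb y) (hC Y hY y) (norm_nonneg _) hb0
  · exact (((integrable_rad hX hs).comp_sub_right X.fst).const_mul C).const_mul b
  · refine Eventually.of_forall fun y => ?_
    have h1 : ContinuousAt (kernelGrad s) (X - bdry y) :=
      continuousOn_kernelGrad.continuousAt (isOpen_upperHalf.mem_nhds (sub_bdry_mem hX y))
    have h2 : ContinuousAt (fun Y => kernelGrad s (Y - bdry y)) X :=
      ContinuousAt.comp (f := fun Y : ExtSpace n => Y - bdry y) h1 (by fun_prop)
    exact h2.const_smul (g y)

lemma contDiffOn_csExtension (hs : 0 < s) {g : EuclideanSpace ℝ (Fin n) → ℝ}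
    (hg : Measurable g) {b : ℝ} (hb : ∀ y, |g y| ≤ b) :
    ContDiffOn ℝ 1 (csExtension s g) (upperHalf n) :=
  contDiffOn_one_of_hasGradientAt isOpen_upperHalf
    (fun _ hX => hasGradientAt_csExtension hs hg hb hX) (continuousOn_extGrad hs hg hb)

/-- The extension of the constant `1` is `1`, so its gradient vanishes. This cancellation allows `g
y` to be replaced by `g y - g x` in gradient estimates. -/
lemma integral_kernelGrad (hs : 0 < s) {X : ExtSpace n} (hX : 0 < X.snd) :
    ∫ y, kernelGrad s (X - bdry y) = 0 := by
  have h1 := hasGradientAt_csExtension (n := n) hs (g := fun _ => 1) measurable_const (b := 1)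
    (by simp) hX
  have h2 : csExtension (n := n) s (fun _ => 1) =ᶠ[𝓝 X] fun _ => 1 := by
    filter_upwards [isOpen_upperHalf.mem_nhds hX] with Y hY
    rw [csExtension_eq]; simp [integral_baseKernel hs hY]
  have h3 : HasGradientAt (csExtension (n := n) s (fun _ => 1)) 0 X :=
    (hasGradientAt_const X (1 : ℝ)).congr_of_eventuallyEq h2
  have := h1.unique h3
  simpa [extGrad] using this

lemma extGrad_eq (hs : 0 < s) {g : EuclideanSpace ℝ (Fin n) → ℝ}
    (hg : Measurable g) {b : ℝ} (hb : ∀ y, |g y| ≤ b) {X : ExtSpace n} (hX : 0 < X.snd) (c : ℝ) :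
    extGrad s g X = ∫ y, (g y - c) • kernelGrad s (X - bdry y) := by
  simp_rw [sub_smul]
  rw [integral_sub (integrable_smul_kernelGrad hs hg hb hX)
    (by exact (integrable_kernelGrad hs hX).smul c), integral_smul, integral_kernelGrad hs hX]
  simp [extGrad]

lemma csExtension_sub_eq (hs : 0 < s) {g : EuclideanSpace ℝ (Fin n) → ℝ}
    (hg : Measurable g) {b : ℝ} (hb : ∀ y, |g y| ≤ b) {X : ExtSpace n} (hX : 0 < X.snd) (c : ℝ) :
    csExtension s g X - c = ∫ y, baseKernel s (X - bdry y) * (g y - c) := by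
  simp_rw [mul_sub]
  rw [integral_sub (integrable_baseKernel_mul hs hg hb hX)
    ((integrable_baseKernel hs hX).mul_const c), integral_mul_const, integral_baseKernel hs hX,
    csExtension_eq]
  simp

/-! ### Fubini on the extended space -/

lemma measurePreserving_pt :
    MeasurePreserving (fun q : EuclideanSpace ℝ (Fin n) × ℝ => pt q.1 q.2)
      (volume.prod volume) volume :=
  WithLp.volume_preserving_toLp (EuclideanSpace ℝ (Fin n)) ℝ

lemma measurableEmbedding_pt :
    MeasurableEmbedding (fun q : EuclideanSpace ℝ (Fin n) × ℝ => pt q.1 q.2) :=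
  (MeasurableEquiv.toLp 2 (EuclideanSpace ℝ (Fin n) × ℝ)).measurableEmbedding

lemma lintegral_ext {f : ExtSpace n → ENNReal} (hf : Measurable f) :
    ∫⁻ X, f X = ∫⁻ x, ∫⁻ z, f (pt x z) := by
  rw [← measurePreserving_pt.lintegral_comp hf, lintegral_prod _ (by
    exact (hf.comp continuous_pt.measurable).aemeasurable)]

lemma integrable_ext_iff {F : Type*} [NormedAddCommGroup F] {f : ExtSpace n → F} :
    Integrable f ↔ Integrable (fun q : EuclideanSpace ℝ (Fin n) × ℝ => f (pt q.1 q.2))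
      (volume.prod volume) :=
  (measurePreserving_pt.integrable_comp_emb measurableEmbedding_pt (g := f)).symm

lemma integral_ext {f : ExtSpace n → ℝ} (hf : Integrable f) :
    ∫ X, f X = ∫ x, ∫ z, f (pt x z) := by
  rw [← measurePreserving_pt.integral_comp measurableEmbedding_pt f,
    integral_prod _ (integrable_ext_iff.mp hf)]

lemma integral_ext_symm {f : ExtSpace n → ℝ} (hf : Integrable f) :
    ∫ X, f X = ∫ z, ∫ x, f (pt x z) := by
  rw [← measurePreserving_pt.integral_comp measurableEmbedding_pt f,
    integral_prod_symm _ (integrable_ext_iff.mp hf)]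

/-- The cylinder `D × (0, ∞)`. -/
def cyl (D : Set (EuclideanSpace ℝ (Fin n))) : Set (ExtSpace n) := {X | X.fst ∈ D ∧ 0 < X.snd}

lemma measurableSet_cyl {D : Set (EuclideanSpace ℝ (Fin n))} (hD : MeasurableSet D) :
    MeasurableSet (cyl D) :=
  (measurable_fst_ext hD).inter measurableSet_upperHalf

lemma setLIntegral_cyl {D : Set (EuclideanSpace ℝ (Fin n))} (hD : MeasurableSet D)
    {f : ExtSpace n → ENNReal} (hf : Measurable f) :
    ∫⁻ X in cyl D, f X = ∫⁻ x in D, ∫⁻ z in Ioi 0, f (pt x z) := by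
  rw [← lintegral_indicator (measurableSet_cyl hD),
    lintegral_ext (hf.indicator (measurableSet_cyl hD)), ← lintegral_indicator hD]
  refine lintegral_congr fun x => ?_
  by_cases hx : x ∈ D
  · rw [indicator_of_mem hx, ← lintegral_indicator measurableSet_Ioi]
    refine lintegral_congr fun z => ?_
    by_cases hz : z ∈ Ioi (0 : ℝ)
    · rw [indicator_of_mem hz, indicator_of_mem]; exact ⟨hx, hz⟩
    · rw [indicator_of_notMem hz, indicator_of_notMem]; exact fun h => hz h.2
  · rw [indicator_of_notMem hx]
    simp [indicator, cyl, hx]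

/-! ### Energy and trace bounds -/

lemma measurable_extGrad {g : EuclideanSpace ℝ (Fin n) → ℝ} (hg : Measurable g) :
    Measurable (extGrad s g) := by
  have h : Measurable (fun q : ExtSpace n × EuclideanSpace ℝ (Fin n) =>
      g q.2 • kernelGrad s (q.1 - bdry q.2)) :=
    (hg.comp measurable_snd).smul (measurable_kernelGrad.comp (by fun_prop))
  exact (h.stronglyMeasurable.integral_prod_right' (ν := volume)).measurable

lemma measurable_csExtension {g : EuclideanSpace ℝ (Fin n) → ℝ} (hg : Measurable g) :
    Measurable (csExtension s g) := by
  have h : Measurable (fun q : ExtSpace n × EuclideanSpace ℝ (Fin n) =>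
      baseKernel s (q.1 - bdry q.2) * g q.2) :=
    (measurable_baseKernel.comp (by fun_prop)).mul (hg.comp measurable_snd)
  have h2 := (h.stronglyMeasurable.integral_prod_right' (ν := volume)).measurable
  rwa [show csExtension s g = _ from funext fun X => csExtension_eq g X]

lemma measurable_energy {g : EuclideanSpace ℝ (Fin n) → ℝ} (hg : Measurable g) :
    Measurable (fun X : ExtSpace n => X.snd ^ (1 - s) * ‖extGrad s g X‖ ^ 2) :=
  (measurable_snd_ext.pow_const _).mul ((measurable_extGrad hg).norm.pow_const 2)

lemma sq_lintegral_mul_le {α : Type*} [MeasurableSpace α] {μ : Measure α} {f g : α → ENNReal}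
    (hf : AEMeasurable f μ) (hg : AEMeasurable g μ) :
    (∫⁻ a, f a * g a ∂μ) ^ 2 ≤ (∫⁻ a, f a ^ 2 ∂μ) * ∫⁻ a, g a ^ 2 ∂μ := by
  have h := ENNReal.lintegral_mul_le_Lp_mul_Lq μ Real.HolderConjugate.two_two hf hg
  have h2 := pow_le_pow_left' h 2
  rw [mul_pow, ← ENNReal.rpow_mul_natCast, ← ENNReal.rpow_mul_natCast] at h2
  simpa using h2

/-- The Gagliardo energy of `g` of order `s / 2` on `D × ℝⁿ`. -/
def gagliardo (s : ℝ) (D : Set (EuclideanSpace ℝ (Fin n))) (g : EuclideanSpace ℝ (Fin n) → ℝ) :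
    ENNReal :=
  ∫⁻ x in D, ∫⁻ y, ENNReal.ofReal ((g x - g y) ^ 2 / ‖x - y‖ ^ ((n : ℝ) + s))

/-- The integral is split at `z = δ`. Below, `δ² + z²` is replaced by `δ²` and `z^{σ-1}` is
integrable at `0`; above, it is replaced by `z²`, which leaves a convergent power tail. The two
pieces give the two constants. -/
lemma lintegral_vertical_le {σ δ N : ℝ} (hσ : 0 < σ) (hδ : 0 < δ) (hN : 0 ≤ N) :
    ∫⁻ z in Ioi 0, ENNReal.ofReal (z ^ (σ - 1) * (δ ^ 2 + z ^ 2) ^ (-(N + 3 * σ) / 2)) ≤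
      ENNReal.ofReal ((1 / σ + 1 / (N + 2 * σ)) * δ ^ (-(N + 2 * σ))) := by
  have hsq : ∀ {w : ℝ}, 0 < w → (w ^ 2) ^ (-(N + 3 * σ) / 2) = w ^ (-(N + 3 * σ)) := by
    intro w hw
    rw [← Real.rpow_natCast, ← Real.rpow_mul hw.le]; congr 1; push_cast; ring
  have hneg : -(N + 3 * σ) / 2 ≤ 0 := by linarith
  rw [← Ioc_union_Ioi_eq_Ioi hδ.le, lintegral_union measurableSet_Ioi
    (by rw [Set.disjoint_left]; intro a h1 h2; exact absurd h1.2 (not_le.mpr h2)), add_mul,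
    ENNReal.ofReal_add (by positivity) (by positivity)]
  gcongr
  · have hi : IntegrableOn (fun z : ℝ => δ ^ (-(N + 3 * σ)) * z ^ (σ - 1)) (Ioc 0 δ) := by
      have := (intervalIntegral.intervalIntegrable_rpow' (a := 0) (b := δ) (r := σ - 1)
        (by linarith)).1
      exact this.const_mul _
    calc _ ≤ ∫⁻ z in Ioc 0 δ, ENNReal.ofReal (δ ^ (-(N + 3 * σ)) * z ^ (σ - 1)) := by
          refine setLIntegral_mono' measurableSet_Ioc fun z hz => ENNReal.ofReal_le_ofReal ?_
          rw [mul_comm]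
          have := hz.1
          gcongr
          rw [← hsq hδ]
          exact Real.rpow_le_rpow_of_nonpos (by positivity) (by nlinarith) hneg
      _ = ENNReal.ofReal (∫ z in Ioc 0 δ, δ ^ (-(N + 3 * σ)) * z ^ (σ - 1)) := by
          rw [ofReal_integral_eq_lintegral_ofReal hi]
          exact (ae_restrict_iff' measurableSet_Ioc).mpr (Eventually.of_forall fun z hz => by
            have := hz.1; dsimp only [Pi.zero_apply]; positivity)
      _ ≤ _ := by
          apply ENNReal.ofReal_le_ofReal
          rw [integral_const_mul, ← intervalIntegral.integral_of_le hδ.le,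
            integral_rpow (Or.inl (by linarith)), sub_add_cancel, Real.zero_rpow hσ.ne', sub_zero]
          apply le_of_eq
          rw [mul_div_assoc', ← Real.rpow_add hδ, div_eq_mul_inv, one_div, mul_comm]
          congr 2; ring
  · have hp : 0 < N + 2 * σ := by positivity
    have hi : IntegrableOn (fun z : ℝ => z ^ (-(N + 2 * σ) - 1)) (Ioi δ) :=
      integrableOn_Ioi_rpow_of_lt (by linarith) hδ
    calc _ ≤ ∫⁻ z in Ioi δ, ENNReal.ofReal (z ^ (-(N + 2 * σ) - 1)) := by
          refine setLIntegral_mono' measurableSet_Ioi fun z hz => ENNReal.ofReal_le_ofReal ?_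
          have hz0 : 0 < z := hδ.trans hz
          have : (-(N + 2 * σ) - 1) = (σ - 1) + -(N + 3 * σ) := by ring
          rw [this, Real.rpow_add hz0, ← hsq hz0]
          gcongr ?_ * ?_
          exact Real.rpow_le_rpow_of_nonpos (by positivity) (by nlinarith) hneg
      _ = ENNReal.ofReal (∫ z in Ioi δ, z ^ (-(N + 2 * σ) - 1)) := by
          rw [ofReal_integral_eq_lintegral_ofReal hi]
          exact (ae_restrict_iff' measurableSet_Ioi).mpr (Eventually.of_forall fun z hz => by
            have : 0 < z := hδ.trans hz
            dsimp only [Pi.zero_apply]; positivity)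
      _ ≤ _ := by
          apply ENNReal.ofReal_le_ofReal
          rw [integral_Ioi_rpow_of_lt (by linarith) hδ]
          apply le_of_eq
          rw [sub_add_cancel, neg_div_neg_eq, div_eq_mul_inv, one_div, mul_comm]

/-- After subtracting `g x`, Cauchy–Schwarz is applied with the kernel exponent `n + s` split into
halves of `n + s/2` and `n + 3s/2`. The first square is an integrable profile of mass proportional
to `z^{-s/2}`; the second decays enough to be integrated in `z` afterwards. -/
lemma ofReal_energy_le (hs : 0 < s) {g : EuclideanSpace ℝ (Fin n) → ℝ}
    (hg : Measurable g) {b : ℝ} (hb : ∀ y, |g y| ≤ b) {x : EuclideanSpace ℝ (Fin n)} {z : ℝ}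
    (hz : 0 < z) :
    ENNReal.ofReal (z ^ (1 - s) * ‖extGrad s g (pt x z)‖ ^ 2) ≤
      ENNReal.ofReal ((poissonConst n s * (n + 2 * s)) ^ 2 * radMass n (s / 2)) *
        ∫⁻ y, ENNReal.ofReal ((g x - g y) ^ 2) *
          ENNReal.ofReal (z ^ (s / 2 - 1) * (‖x - y‖ ^ 2 + z ^ 2) ^ (-((n : ℝ) + 3 * (s / 2)) / 2)) := by
  have hc := poissonConst_pos (n := n) hs
  have hX : 0 < (pt x z).snd := hz
  set A := poissonConst n s * (n + 2 * s) with hA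
  have hA0 : 0 < A := by positivity
  have hr : ∀ y : EuclideanSpace ℝ (Fin n), 0 < ‖y - x‖ ^ 2 + z ^ 2 := fun y => by positivity
  have h1 : ‖extGrad s g (pt x z)‖ₑ ≤ ENNReal.ofReal (A * z ^ (s - 1)) *
      ∫⁻ y, ENNReal.ofReal ((‖y - x‖ ^ 2 + z ^ 2) ^ (-((n : ℝ) + s / 2) / 4)) *
        ENNReal.ofReal (|g x - g y| * (‖y - x‖ ^ 2 + z ^ 2) ^ (-((n : ℝ) + 3 * (s / 2)) / 4)) := by
    rw [extGrad_eq hs hg hb hX (g x)]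
    refine (enorm_integral_le_lintegral_enorm _).trans ?_
    rw [← lintegral_const_mul' _ _ ENNReal.ofReal_ne_top]
    refine lintegral_mono fun y => ?_
    dsimp only
    rw [← ofReal_norm, norm_smul, ← ENNReal.ofReal_mul (by have := hr y; positivity),
      ← ENNReal.ofReal_mul (by positivity)]
    apply ENNReal.ofReal_le_ofReal
    have h2 := norm_kernelGrad_le hs (sub_bdry_mem hX y)
    have e1 : (pt x z - bdry y).snd = z := by simp
    rw [norm_sq_sub_bdry, e1, norm_sub_rev] at h2
    have e2 : (‖y - x‖ ^ 2 + z ^ 2) ^ (-((n : ℝ) + s) / 2) =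
        (‖y - x‖ ^ 2 + z ^ 2) ^ (-((n : ℝ) + s / 2) / 4) *
          (‖y - x‖ ^ 2 + z ^ 2) ^ (-((n : ℝ) + 3 * (s / 2)) / 4) := by
      rw [← Real.rpow_add (hr y)]; congr 1; ring
    simp only [pt_fst, pt_snd] at h2
    rw [Real.norm_eq_abs, abs_sub_comm]
    calc _ ≤ |g x - g y| * _ := mul_le_mul_of_nonneg_left h2 (abs_nonneg _)
      _ = _ := by rw [e2]; ring
  have h2 := pow_le_pow_left' h1 2
  rw [mul_pow] at h2
  have h3 := h2.trans (mul_le_mul_right (sq_lintegral_mul_le (by fun_prop)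
    ((((measurable_const.sub hg).abs).mul (by fun_prop)).ennreal_ofReal.aemeasurable)) _)
  have e3 : ∫⁻ y : EuclideanSpace ℝ (Fin n),
      ENNReal.ofReal ((‖y - x‖ ^ 2 + z ^ 2) ^ (-((n : ℝ) + s / 2) / 4)) ^ 2
      = ENNReal.ofReal (z ^ (-(s / 2)) * radMass n (s / 2)) := by
    rw [← integral_rad hz (s / 2), ← integral_sub_right_eq_self _ x,
      ofReal_integral_eq_lintegral_ofReal
        ((integrable_rad hz (half_pos hs)).comp_sub_right x)
        (Eventually.of_forall fun y => by dsimp only [Pi.zero_apply]; have := hr y; positivity)]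
    refine lintegral_congr fun y => ?_
    rw [← ENNReal.ofReal_pow (by have := hr y; positivity), ← Real.rpow_mul_natCast (hr y).le]
    congr 2; push_cast; ring
  rw [e3] at h3
  rw [ENNReal.ofReal_mul (by positivity), ENNReal.ofReal_pow (norm_nonneg _), ofReal_norm]
  refine (mul_le_mul_right h3 _).trans ?_
  rw [← ENNReal.ofReal_pow (by positivity), ← mul_assoc, ← mul_assoc,
    ← ENNReal.ofReal_mul (by positivity), ← ENNReal.ofReal_mul (by positivity)]
  have e4 : z ^ (1 - s) * (A * z ^ (s - 1)) ^ 2 * (z ^ (-(s / 2)) * radMass n (s / 2)) =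
      (A ^ 2 * radMass n (s / 2)) * z ^ (s / 2 - 1) := by
    have : z ^ (s / 2 - 1) = z ^ (1 - s) * (z ^ (s - 1)) ^ 2 * z ^ (-(s / 2)) := by
      rw [← Real.rpow_mul_natCast hz.le, ← Real.rpow_add hz, ← Real.rpow_add hz]
      congr 1; push_cast; ring
    rw [this]; ring
  have hM := radMass_pos (n := n) (half_pos hs)
  rw [e4, ENNReal.ofReal_mul (by positivity), mul_assoc, ← lintegral_const_mul' _ _ ENNReal.ofReal_ne_top]
  refine mul_le_mul_right (lintegral_mono fun y => ?_) _
  simp only [Pi.mul_apply, Pi.sub_apply]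
  rw [← ENNReal.ofReal_pow (by have := hr y; positivity), ← ENNReal.ofReal_mul (by positivity),
    ← ENNReal.ofReal_mul (by positivity)]
  apply ENNReal.ofReal_le_ofReal
  rw [mul_pow, sq_abs, ← Real.rpow_mul_natCast (hr y).le, norm_sub_rev y x]
  apply le_of_eq
  have : (-((n : ℝ) + 3 * (s / 2)) / 4) * (2 : ℕ) = -((n : ℝ) + 3 * (s / 2)) / 2 := by
    push_cast; ring
  rw [this]; ring

/-- By Tonelli the vertical integral is taken first, and `lintegral_vertical_le` with `σ = s/2`
returns exactly `|x - y|^{-(n+s)}`. The bound is local in `x`, which matters because the Gagliardo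
energy of `signChar E` is only controlled over bounded sets. -/
lemma exists_energy_le (n : ℕ) (hs : 0 < s) : ∃ C : ℝ, 0 ≤ C ∧
    ∀ (g : EuclideanSpace ℝ (Fin n) → ℝ) (b : ℝ) (D : Set (EuclideanSpace ℝ (Fin n))),
      Measurable g → (∀ y, |g y| ≤ b) → MeasurableSet D →
      ∫⁻ X in cyl D, ENNReal.ofReal (X.snd ^ (1 - s) * ‖extGrad s g X‖ ^ 2) ≤
        ENNReal.ofReal C * gagliardo s D g := by
  have hc := poissonConst_pos (n := n) hs
  have hM := radMass_pos (n := n) (half_pos hs)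
  set C₁ := (poissonConst n s * (n + 2 * s)) ^ 2 * radMass n (s / 2) with hC₁
  set C₂ := 1 / (s / 2) + 1 / ((n : ℝ) + 2 * (s / 2)) with hC₂
  have hC₁0 : 0 ≤ C₁ := by positivity
  have hC₂0 : 0 ≤ C₂ := by positivity
  refine ⟨C₁ * C₂, by positivity, fun g b D hg hb hD => ?_⟩
  rw [setLIntegral_cyl hD (measurable_energy hg).ennreal_ofReal, gagliardo,
    ← lintegral_const_mul' _ _ ENNReal.ofReal_ne_top]
  refine lintegral_mono fun x => ?_
  calc ∫⁻ z in Ioi 0, ENNReal.ofReal ((pt x z).snd ^ (1 - s) * ‖extGrad s g (pt x z)‖ ^ 2)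
      ≤ ∫⁻ z in Ioi 0, ENNReal.ofReal C₁ * ∫⁻ y, ENNReal.ofReal ((g x - g y) ^ 2) *
          ENNReal.ofReal (z ^ (s / 2 - 1) *
            (‖x - y‖ ^ 2 + z ^ 2) ^ (-((n : ℝ) + 3 * (s / 2)) / 2)) :=
        setLIntegral_mono' measurableSet_Ioi fun z hz => ofReal_energy_le hs hg hb hz
    _ = ENNReal.ofReal C₁ * ∫⁻ y, ENNReal.ofReal ((g x - g y) ^ 2) *
          ∫⁻ z in Ioi 0, ENNReal.ofReal (z ^ (s / 2 - 1) *
            (‖x - y‖ ^ 2 + z ^ 2) ^ (-((n : ℝ) + 3 * (s / 2)) / 2)) := by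
        rw [lintegral_const_mul' _ _ ENNReal.ofReal_ne_top]
        congr 1
        rw [lintegral_lintegral_swap]
        · refine lintegral_congr fun y => ?_
          rw [lintegral_const_mul' _ _ ENNReal.ofReal_ne_top]
        · apply Measurable.aemeasurable
          unfold Function.uncurry
          fun_prop
    _ ≤ _ := by
        rw [ENNReal.ofReal_mul hC₁0, mul_assoc]
        refine mul_le_mul_right ?_ _
        rw [← lintegral_const_mul' _ _ ENNReal.ofReal_ne_top]
        refine lintegral_mono fun y => ?_
        dsimp only
        by_cases hxy : x = y
        · subst hxy; simp
        have hd : 0 < ‖x - y‖ := norm_pos_iff.mpr (sub_ne_zero.mpr hxy)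
        refine (mul_le_mul_right (lintegral_vertical_le (half_pos hs) hd n.cast_nonneg) _).trans ?_
        rw [← ENNReal.ofReal_mul (by positivity), ← ENNReal.ofReal_mul (by positivity)]
        apply ENNReal.ofReal_le_ofReal
        rw [Real.rpow_neg hd.le, mul_div_cancel₀ s two_ne_zero]
        apply le_of_eq; ring

/-- The kernel is a probability density, so the squared mean of `g - g ξ` is at most the mean of its
square, and the kernel itself is bounded by a multiple of `ε^s |ξ - y|^{-(n+s)}`. The point `X` need
not lie above `ξ`, nor at height exactly `ε`: the deformed extension requires this slack. -/
lemma trace_le (hs : 0 < s) {g : EuclideanSpace ℝ (Fin n) → ℝ}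
    (hg : Measurable g) {b : ℝ} (hb : ∀ y, |g y| ≤ b) {X : ExtSpace n} {ε : ℝ}
    (hε : 0 < ε) (hX1 : ε ≤ 2 * X.snd) (hX2 : X.snd ≤ 2 * ε) {ξ : EuclideanSpace ℝ (Fin n)}
    (hξ : ‖X.fst - ξ‖ ≤ 2 * ε) :
    ENNReal.ofReal ((csExtension s g X - g ξ) ^ 2) ≤
      ENNReal.ofReal (poissonConst n s * 2 ^ s * 5 ^ ((n : ℝ) + s) * ε ^ s) *
        ∫⁻ y, ENNReal.ofReal ((g ξ - g y) ^ 2 / ‖ξ - y‖ ^ ((n : ℝ) + s)) := by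
  have hc := poissonConst_pos (n := n) hs
  have hX : 0 < X.snd := by linarith
  have hK : ∀ y, 0 ≤ baseKernel s (X - bdry y) := fun y =>
    baseKernel_nonneg hs (sub_bdry_mem hX y)
  have hKm : Measurable (fun y => baseKernel s (X - bdry y)) :=
    measurable_baseKernel.comp (by fun_prop)
  have h1 : ‖csExtension s g X - g ξ‖ₑ ≤
      ∫⁻ y, ENNReal.ofReal (√(baseKernel s (X - bdry y))) *
        ENNReal.ofReal (√(baseKernel s (X - bdry y)) * |g ξ - g y|) := by
    rw [csExtension_sub_eq hs hg hb hX (g ξ)]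
    refine (enorm_integral_le_lintegral_enorm _).trans (lintegral_mono fun y => ?_)
    dsimp only
    rw [← ofReal_norm, ← ENNReal.ofReal_mul (by positivity), ← mul_assoc,
      Real.mul_self_sqrt (hK y), norm_mul, Real.norm_of_nonneg (hK y), Real.norm_eq_abs,
      abs_sub_comm]
  have h2 := (pow_le_pow_left' h1 2).trans (sq_lintegral_mul_le
    hKm.sqrt.ennreal_ofReal.aemeasurable
    (hKm.sqrt.mul ((measurable_const.sub hg).abs)).ennreal_ofReal.aemeasurable)
  have h3 : ∫⁻ y, ENNReal.ofReal (√(baseKernel s (X - bdry y))) ^ 2 = 1 := by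
    have h := ofReal_integral_eq_lintegral_ofReal (integrable_baseKernel hs hX)
      (Eventually.of_forall hK)
    rw [integral_baseKernel hs hX, ENNReal.ofReal_one] at h
    rw [h]
    refine lintegral_congr fun y => ?_
    rw [← ENNReal.ofReal_pow (by positivity), Real.sq_sqrt (hK y)]
  rw [h3, one_mul] at h2
  rw [← sq_abs, ENNReal.ofReal_pow (abs_nonneg _), ← Real.norm_eq_abs, ofReal_norm]
  refine h2.trans ?_
  rw [← lintegral_const_mul' _ _ ENNReal.ofReal_ne_top]
  refine lintegral_mono fun y => ?_
  dsimp only [Pi.mul_apply, Pi.sub_apply]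
  rw [← ENNReal.ofReal_pow (by positivity), ← ENNReal.ofReal_mul (by positivity), mul_pow,
    Real.sq_sqrt (hK y), sq_abs]
  apply ENNReal.ofReal_le_ofReal
  by_cases hxy : ξ = y
  · subst hxy; simp
  have hd : 0 < ‖ξ - y‖ := norm_pos_iff.mpr (sub_ne_zero.mpr hxy)
  -- The shift from `X.fst` to `ξ` is at most `2ε ≤ 4z ≤ 4 |X - (y,0)|`, which gives `5 = 1 + 4`.
  have h5 : ‖ξ - y‖ ≤ 5 * ‖X - bdry y‖ := by
    have i1 := norm_fst_le (X - bdry y)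
    have i2 := abs_snd_le (X - bdry y)
    simp only [WithLp.sub_fst, bdry_fst, WithLp.sub_snd, bdry_snd, sub_zero] at i1 i2
    have i3 : ‖ξ - y‖ ≤ ‖X.fst - y‖ + ‖X.fst - ξ‖ := by
      have := norm_sub_le (X.fst - y) (X.fst - ξ); simpa using this
    rw [abs_of_pos hX] at i2
    linarith
  have hp : 0 ≤ (n : ℝ) + s := by positivity
  have h6 : (‖X - bdry y‖ ^ 2) ^ (-((n : ℝ) + s) / 2) ≤
      5 ^ ((n : ℝ) + s) * (‖ξ - y‖ ^ ((n : ℝ) + s))⁻¹ := by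
    have e1 : (‖X - bdry y‖ ^ 2) ^ (-((n : ℝ) + s) / 2) = ‖X - bdry y‖ ^ (-((n : ℝ) + s)) := by
      rw [← Real.rpow_natCast, ← Real.rpow_mul (norm_nonneg _)]; congr 1; push_cast; ring
    have e2 : (5 : ℝ) ^ ((n : ℝ) + s) * (‖ξ - y‖ ^ ((n : ℝ) + s))⁻¹ =
        (‖ξ - y‖ / 5) ^ (-((n : ℝ) + s)) := by
      rw [Real.rpow_neg (by positivity), Real.div_rpow hd.le (by norm_num), inv_div,
        div_eq_mul_inv]
    rw [e1, e2]
    exact Real.rpow_le_rpow_of_nonpos (by positivity) (by linarith) (by linarith)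
  have h7 : X.snd ^ s ≤ 2 ^ s * ε ^ s := by
    rw [← Real.mul_rpow (by norm_num) hε.le]
    exact Real.rpow_le_rpow hX.le hX2 hs.le
  have e1 : (X - bdry y).snd = X.snd := by simp
  rw [baseKernel, e1]
  calc poissonConst n s * (X.snd ^ s * (‖X - bdry y‖ ^ 2) ^ (-((n : ℝ) + s) / 2)) * (g ξ - g y) ^ 2
      ≤ poissonConst n s * ((2 ^ s * ε ^ s) * (5 ^ ((n : ℝ) + s) * (‖ξ - y‖ ^ ((n : ℝ) + s))⁻¹)) *
          (g ξ - g y) ^ 2 := by gcongr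
    _ = _ := by ring

/-! ### Integration by parts against the kernel -/

lemma hasGradientAt_slice {W : ExtSpace n → ℝ} {x : EuclideanSpace ℝ (Fin n)} {z : ℝ}
    {G : ExtSpace n} (h : HasGradientAt W G (pt x z)) :
    HasGradientAt (fun x => W (pt x z)) G.fst x := by
  let L : EuclideanSpace ℝ (Fin n) →L[ℝ] ExtSpace n :=
    ((WithLp.prodContinuousLinearEquiv 2 ℝ (EuclideanSpace ℝ (Fin n)) ℝ).symm :
      (EuclideanSpace ℝ (Fin n)) × ℝ →L[ℝ] ExtSpace n).comp
      (ContinuousLinearMap.inl ℝ (EuclideanSpace ℝ (Fin n)) ℝ)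
  have hL : ∀ x, L x = pt x 0 := fun x => rfl
  have e : (fun x : EuclideanSpace ℝ (Fin n) => pt x z) = fun x => L x + pt 0 z := by
    ext x : 1
    rw [hL]; apply WithLp.ofLp_injective 2; ext1 <;> simp [pt]
  have h1 : HasFDerivAt (fun x : EuclideanSpace ℝ (Fin n) => pt x z) L x := by
    rw [e]; exact L.hasFDerivAt.add_const _
  rw [hasGradientAt_iff_hasFDerivAt] at h ⊢
  refine (h.comp x h1).congr_fderiv ?_
  ext v
  simp [hL]

lemma hasDerivAt_slice {W : ExtSpace n → ℝ} {x : EuclideanSpace ℝ (Fin n)} {z : ℝ}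
    {G : ExtSpace n} (h : HasGradientAt W G (pt x z)) :
    HasDerivAt (fun z => W (pt x z)) G.snd z := by
  let L : ℝ →L[ℝ] ExtSpace n :=
    ((WithLp.prodContinuousLinearEquiv 2 ℝ (EuclideanSpace ℝ (Fin n)) ℝ).symm :
      (EuclideanSpace ℝ (Fin n)) × ℝ →L[ℝ] ExtSpace n).comp
      (ContinuousLinearMap.inr ℝ (EuclideanSpace ℝ (Fin n)) ℝ)
  have hL : ∀ z, L z = pt 0 z := fun z => rfl
  have e : (fun z : ℝ => pt x z) = fun z => L z + pt x 0 := by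
    ext z : 1
    rw [hL]; apply WithLp.ofLp_injective 2; ext1 <;> simp [pt]
  have h1 : HasFDerivAt (fun z : ℝ => pt x z) L z := by
    rw [e]; exact L.hasFDerivAt.add_const _
  have h2 := (h.hasFDerivAt.comp z h1).hasDerivAt
  simpa [hL, Function.comp_def] using h2

/-- The bracket on the right is the divergence in `x` of the field `(x - y)(|x - y|² + z²)^κ`;
compact support of `w` removes boundary terms. The integration by parts is done coordinate by
coordinate and summed. -/
lemma slice_integral_by_parts {w : EuclideanSpace ℝ (Fin n) → ℝ}
    {w' : EuclideanSpace ℝ (Fin n) → EuclideanSpace ℝ (Fin n)}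
    (hw : ∀ x, HasGradientAt w (w' x) x) (hw' : Continuous w') {ρ : ℝ}
    (h0 : ∀ x, ρ < ‖x‖ → w x = 0) (y : EuclideanSpace ℝ (Fin n)) {z : ℝ} (hz : 0 < z) (κ : ℝ) :
    ∫ x, inner ℝ (w' x) (x - y) * (‖x - y‖ ^ 2 + z ^ 2) ^ κ =
      - ∫ x, w x * (n * (‖x - y‖ ^ 2 + z ^ 2) ^ κ +
        2 * κ * ‖x - y‖ ^ 2 * (‖x - y‖ ^ 2 + z ^ 2) ^ (κ - 1)) := by
  have hq : ∀ x : EuclideanSpace ℝ (Fin n), ‖x - y‖ ^ 2 + z ^ 2 ≠ 0 := fun x => by positivity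
  have hwc : Continuous w := continuous_iff_continuousAt.mpr fun x => (hw x).continuousAt
  have hs : HasCompactSupport w :=
    HasCompactSupport.intro (isCompact_closedBall 0 ρ) fun x hx => h0 x (by simpa using hx)
  have hs' : HasCompactSupport w' := by
    refine HasCompactSupport.intro (isCompact_closedBall 0 ρ) fun x hx => ?_
    have hx : ρ < ‖x‖ := by simpa using hx
    have : w =ᶠ[𝓝 x] fun _ => 0 := by
      filter_upwards [(isOpen_lt continuous_const continuous_norm).mem_nhds hx] with v hv
      exact h0 v hv
    exact (hw x).unique ((hasGradientAt_const x (0 : ℝ)).congr_of_eventuallyEq this)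
  have hcq : ∀ κ : ℝ, Continuous fun x : EuclideanSpace ℝ (Fin n) =>
      (‖x - y‖ ^ 2 + z ^ 2) ^ κ := fun κ =>
    Continuous.rpow_const (by fun_prop) fun x => Or.inl (hq x)
  set Φ : Fin n → EuclideanSpace ℝ (Fin n) → ℝ := fun i x =>
    (x i - y i) * (‖x - y‖ ^ 2 + z ^ 2) ^ κ with hΦ
  set Ψ : Fin n → EuclideanSpace ℝ (Fin n) → ℝ := fun i x =>
    (‖x - y‖ ^ 2 + z ^ 2) ^ κ +
      (x i - y i) ^ 2 * (2 * κ * (‖x - y‖ ^ 2 + z ^ 2) ^ (κ - 1)) with hΨ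
  have hd : ∀ i x, DifferentiableAt ℝ (Φ i) x ∧
      fderiv ℝ (Φ i) x (EuclideanSpace.single i 1) = Ψ i x := by
    intro i x
    have h1 : HasFDerivAt (fun x : EuclideanSpace ℝ (Fin n) => x i - y i)
        (EuclideanSpace.proj i : EuclideanSpace ℝ (Fin n) →L[ℝ] ℝ) x :=
      (EuclideanSpace.proj i : EuclideanSpace ℝ (Fin n) →L[ℝ] ℝ).hasFDerivAt.sub_const _
    have h2 := (((hasStrictFDerivAt_norm_sq (x - y)).hasFDerivAt.comp x
      ((hasFDerivAt_id x).sub_const y)).add_const (z ^ 2)).rpow_const (p := κ) (Or.inl (hq x))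
    have h3 := h1.mul h2
    refine ⟨h3.differentiableAt, ?_⟩
    have := h3.fderiv
    rw [hΦ]; dsimp only
    erw [this]
    simp [hΨ, EuclideanSpace.inner_single_right]
    ring
  have hΦc : ∀ i, Continuous (Φ i) := fun i => by
    have := hcq κ; simp only [hΦ]; fun_prop
  have hΨc : ∀ i, Continuous (Ψ i) := fun i => by
    have := hcq κ; have := hcq (κ - 1); simp only [hΨ]; fun_prop
  have hfw : ∀ i x, fderiv ℝ w x (EuclideanSpace.single i 1) = w' x i := by
    intro i x
    rw [(hw x).hasFDerivAt.fderiv]; simp [EuclideanSpace.inner_single_right]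
  have hci : ∀ i, Continuous fun x => w' x i := fun i =>
    (EuclideanSpace.proj i : EuclideanSpace ℝ (Fin n) →L[ℝ] ℝ).continuous.comp hw'
  have hsi : ∀ i, HasCompactSupport fun x => w' x i := fun i =>
    hs'.comp_left (g := fun v : EuclideanSpace ℝ (Fin n) => v i) rfl
  have hi1 : ∀ i, Integrable fun x => w' x i * Φ i x := fun i =>
    ((hci i).mul (hΦc i)).integrable_of_hasCompactSupport (hsi i).mul_right
  have hi2 : ∀ i, Integrable fun x => w x * Ψ i x := fun i =>
    (hwc.mul (hΨc i)).integrable_of_hasCompactSupport hs.mul_right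
  have key : ∀ i, ∫ x, w' x i * Φ i x = - ∫ x, w x * Ψ i x := by
    intro i
    have := integral_mul_fderiv_eq_neg_fderiv_mul_of_integrable (μ := volume) (f := w) (g := Φ i)
      (v := EuclideanSpace.single i 1) (by simpa only [hfw] using hi1 i)
      (by simpa only [(hd i _).2] using hi2 i)
      ((hwc.mul (hΦc i)).integrable_of_hasCompactSupport hs.mul_right)
      (fun x _ => (hw x).differentiableAt) (fun x _ => (hd i x).1)
    simp only [hfw, (hd i _).2] at this
    rw [this, neg_neg]
  have e1 : ∀ x, inner ℝ (w' x) (x - y) * (‖x - y‖ ^ 2 + z ^ 2) ^ κ = ∑ i, w' x i * Φ i x := by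
    intro x
    rw [PiLp.inner_apply, Finset.sum_mul]
    refine Finset.sum_congr rfl fun i _ => ?_
    simp [hΦ]; ring
  have e2 : ∀ x, w x * (n * (‖x - y‖ ^ 2 + z ^ 2) ^ κ +
        2 * κ * ‖x - y‖ ^ 2 * (‖x - y‖ ^ 2 + z ^ 2) ^ (κ - 1)) = ∑ i, w x * Ψ i x := by
    intro x
    rw [← Finset.mul_sum]
    simp only [hΨ]
    rw [Finset.sum_add_distrib, ← Finset.sum_mul]
    have : ∑ i, (x i - y i) ^ 2 = ‖x - y‖ ^ 2 := by
      rw [EuclideanSpace.norm_sq_eq]; simp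
    rw [this]; simp; left; ring
  simp_rw [e1, e2]
  rw [integral_finsetSum _ fun i _ => hi1 i, integral_finsetSum _ fun i _ => hi2 i,
    Finset.sum_congr rfl fun i _ => key i, Finset.sum_neg_distrib]

/-! ### The flux through a horizontal hyperplane -/

/-- The open half-space above height `ε`. -/
def above (n : ℕ) (ε : ℝ) : Set (ExtSpace n) := {X | ε < X.snd}

lemma measurableSet_above (ε : ℝ) : MeasurableSet (above n ε) :=
  (isOpen_lt continuous_const continuous_snd_ext).measurableSet

lemma setIntegral_above {F : ExtSpace n → ℝ} {ε : ℝ} (hF : IntegrableOn F (above n ε)) :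
    ∫ X in above n ε, F X = ∫ x, ∫ z in Ioi ε, F (pt x z) := by
  rw [← integral_indicator (measurableSet_above ε),
    integral_ext ((integrable_indicator_iff (measurableSet_above ε)).mpr hF)]
  refine integral_congr_ae (Eventually.of_forall fun x => ?_)
  dsimp only
  rw [← integral_indicator measurableSet_Ioi]
  rfl

lemma setIntegral_above_symm {F : ExtSpace n → ℝ} {ε : ℝ} (hF : IntegrableOn F (above n ε)) :
    ∫ X in above n ε, F X = ∫ z in Ioi ε, ∫ x, F (pt x z) := by
  rw [← integral_indicator (measurableSet_above ε),
    integral_ext_symm ((integrable_indicator_iff (measurableSet_above ε)).mpr hF),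
    ← integral_indicator measurableSet_Ioi]
  refine integral_congr_ae (Eventually.of_forall fun z => ?_)
  by_cases hz : z ∈ Ioi ε
  · simp only [indicator_of_mem hz]
    refine integral_congr_ae (Eventually.of_forall fun x => ?_)
    exact indicator_of_mem (show pt x z ∈ above n ε from hz) _
  · simp only [indicator_of_notMem hz]
    have : ∀ x, indicator (above n ε) F (pt x z) = 0 := fun x =>
      indicator_of_notMem (show pt x z ∉ above n ε from hz) _
    simp [this]

section support

variable {F : ExtSpace n → ℝ} {ρ : ℝ}

lemma integrableOn_above (hF : ContinuousOn F (upperHalf n))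
    (h0 : ∀ X ∈ upperHalf n, ρ < ‖X‖ → F X = 0) {ε : ℝ} (hε : 0 < ε) :
    IntegrableOn F (above n ε) := by
  have hK : IsCompact ({X : ExtSpace n | ε ≤ X.snd} ∩ Metric.closedBall 0 ρ) :=
    (isCompact_closedBall 0 ρ).inter_left (isClosed_le continuous_const continuous_snd_ext)
  have hK' := (hF.mono fun X hX => lt_of_lt_of_le hε hX.1).integrableOn_compact hK
    (μ := volume)
  refine IntegrableOn.of_forall_sdiff_eq_zero hK' (measurableSet_above ε) fun X hX => ?_
  refine h0 X (hε.trans hX.1) ?_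
  by_contra h
  exact hX.2 ⟨(show ε < X.snd from hX.1).le, by simpa using h⟩

lemma continuous_slice (hF : ContinuousOn F (upperHalf n)) {z : ℝ} (hz : 0 < z) :
    Continuous (fun x => F (pt x z)) :=
  hF.comp_continuous (by fun_prop) fun _ => hz

lemma integrableOn_vertical (hF : ContinuousOn F (upperHalf n))
    (h0 : ∀ X ∈ upperHalf n, ρ < ‖X‖ → F X = 0) {ε : ℝ} (hε : 0 < ε)
    (x : EuclideanSpace ℝ (Fin n)) :
    IntegrableOn (fun z => F (pt x z)) (Ioi ε) := by
  have hc : ContinuousOn (fun z => F (pt x z)) (Icc ε ρ) :=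
    hF.comp (by fun_prop) fun z hz => lt_of_lt_of_le hε hz.1
  refine IntegrableOn.of_forall_sdiff_eq_zero (hc.integrableOn_compact isCompact_Icc)
    measurableSet_Ioi fun z hz => h0 _ (hε.trans hz.1) ?_
  have h1 : ρ < z := by
    by_contra h
    exact hz.2 ⟨le_of_lt hz.1, not_lt.mp h⟩
  exact h1.trans_le ((le_abs_self _).trans (abs_snd_le (pt x z)))

end support

/-- The kernel `z^a ∂_z P`. -/
def fluxKernel (s : ℝ) (X : ExtSpace n) : ℝ := X.snd ^ (1 - s) * (kernelGrad s X).snd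

/-- The weight `z^{1-s}` cancels the singular power `z^{s-1}`. What remains depends on `x - y` only
through its length and has a limit as `z → 0` off the diagonal. -/
lemma fluxKernel_eq {X : ExtSpace n} (hX : 0 < X.snd) :
    fluxKernel s X = poissonConst n s * (s * (‖X‖ ^ 2) ^ (-((n : ℝ) + s) / 2) -
      ((n : ℝ) + s) * X.snd ^ 2 * (‖X‖ ^ 2) ^ (-((n : ℝ) + s) / 2 - 1)) := by
  have h1 : X.snd ^ (1 - s) * X.snd ^ (s - 1) = 1 := by
    rw [← Real.rpow_add hX]; simp
  have h2 : X.snd ^ (1 - s) * X.snd ^ s = X.snd := by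
    rw [← Real.rpow_add hX]; simp
  simp only [fluxKernel, kernelGrad, WithLp.smul_snd, WithLp.sub_snd, vert_snd, smul_eq_mul]
  linear_combination poissonConst n s * s * (‖X‖ ^ 2) ^ (-((n : ℝ) + s) / 2) * h1 -
    poissonConst n s * ((n : ℝ) + s) * X.snd * (‖X‖ ^ 2) ^ (-((n : ℝ) + s) / 2 - 1) * h2

/-- The vertical derivative of the flux kernel. -/
def fluxKernelDeriv (s : ℝ) (X : ExtSpace n) : ℝ :=
  -(poissonConst n s * ((n : ℝ) + s) * X.snd * ((s + 2) * (‖X‖ ^ 2) ^ (-((n : ℝ) + s) / 2 - 1) -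
    ((n : ℝ) + s + 2) * X.snd ^ 2 * (‖X‖ ^ 2) ^ (-((n : ℝ) + s) / 2 - 1 - 1)))

lemma norm_sq_pt_sub (x y : EuclideanSpace ℝ (Fin n)) (z : ℝ) :
    ‖pt x z - bdry y‖ ^ 2 = ‖x - y‖ ^ 2 + z ^ 2 := by
  rw [norm_sq_sub_bdry]; simp

lemma hasDerivAt_fluxKernel (x y : EuclideanSpace ℝ (Fin n)) {z : ℝ} (hz : 0 < z) :
    HasDerivAt (fun z => fluxKernel s (pt x z - bdry y)) (fluxKernelDeriv s (pt x z - bdry y)) z := by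
  have hq : ‖x - y‖ ^ 2 + z ^ 2 ≠ 0 := by positivity
  have hr : ∀ κ : ℝ, HasDerivAt (fun z : ℝ => (‖x - y‖ ^ 2 + z ^ 2) ^ κ)
      (2 * z * κ * (‖x - y‖ ^ 2 + z ^ 2) ^ (κ - 1)) z := by
    intro κ
    have h := ((hasDerivAt_pow 2 z).const_add (‖x - y‖ ^ 2)).rpow_const (p := κ) (Or.inl hq)
    simpa using h
  have h := ((((hr (-((n : ℝ) + s) / 2)).const_mul s).sub
    ((((hasDerivAt_pow 2 z).const_mul ((n : ℝ) + s))).mul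
      (hr (-((n : ℝ) + s) / 2 - 1)))).const_mul (poissonConst n s))
  have e : (fun z => fluxKernel s (pt x z - bdry y)) =ᶠ[𝓝 z] fun z =>
      poissonConst n s * (s * (‖x - y‖ ^ 2 + z ^ 2) ^ (-((n : ℝ) + s) / 2) -
      ((n : ℝ) + s) * z ^ 2 * (‖x - y‖ ^ 2 + z ^ 2) ^ (-((n : ℝ) + s) / 2 - 1)) := by
    filter_upwards [lt_mem_nhds hz] with w hw
    rw [fluxKernel_eq (by simpa using hw), norm_sq_pt_sub]; simp
  refine (h.congr_of_eventuallyEq e).congr_deriv ?_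
  rw [fluxKernelDeriv, norm_sq_pt_sub]
  simp
  ring

lemma abs_fluxKernel_le (hs : 0 < s) {X : ExtSpace n} (hX : 0 < X.snd) :
    |fluxKernel s X| ≤ poissonConst n s * (n + 2 * s) * (‖X‖ ^ 2) ^ (-((n : ℝ) + s) / 2) := by
  have h1 := (abs_snd_le (kernelGrad s X)).trans (norm_kernelGrad_le hs hX)
  have h2 : X.snd ^ (1 - s) * X.snd ^ (s - 1) = 1 := by
    rw [← Real.rpow_add hX]; simp
  rw [fluxKernel, abs_mul, abs_of_nonneg (by positivity)]
  calc _ ≤ X.snd ^ (1 - s) * _ := mul_le_mul_of_nonneg_left h1 (by positivity)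
    _ = poissonConst n s * (n + 2 * s) * (‖X‖ ^ 2) ^ (-((n : ℝ) + s) / 2) *
        (X.snd ^ (1 - s) * X.snd ^ (s - 1)) := by ring
    _ = _ := by rw [h2, mul_one]

lemma continuousOn_rpow_snd (κ : ℝ) :
    ContinuousOn (fun X : ExtSpace n => X.snd ^ κ) (upperHalf n) := fun X hX =>
  (continuous_snd_ext.continuousAt.rpow_const
    (Or.inl (ne_of_gt (show 0 < X.snd from hX)))).continuousWithinAt

lemma continuousOn_kernelGrad_sub (y : EuclideanSpace ℝ (Fin n)) :
    ContinuousOn (fun X => kernelGrad s (X - bdry y)) (upperHalf n) :=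
  continuousOn_kernelGrad.comp (by fun_prop) fun _ hX => sub_bdry_mem hX y

lemma continuousOn_fluxKernel : ContinuousOn (fluxKernel (n := n) s) (upperHalf n) :=
  (continuousOn_rpow_snd _).mul (continuous_snd_ext.comp_continuousOn continuousOn_kernelGrad)

lemma continuousOn_fluxKernelDeriv (y : EuclideanSpace ℝ (Fin n)) :
    ContinuousOn (fun X => fluxKernelDeriv s (X - bdry y)) (upperHalf n) := by
  have h1 : ∀ r : ℝ, ContinuousOn (fun X : ExtSpace n => (‖X - bdry y‖ ^ 2) ^ r) (upperHalf n) :=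
    fun r X hX => (((continuous_id.sub continuous_const).norm.pow 2).continuousAt.rpow_const
      (Or.inl (norm_sq_pos (sub_bdry_mem hX y)).ne')).continuousWithinAt
  have h2 : Continuous (fun X : ExtSpace n => (X - bdry y).snd) :=
    continuous_snd_ext.comp (by fun_prop)
  unfold fluxKernelDeriv
  have := h1 (-((n : ℝ) + s) / 2 - 1)
  have := h1 (-((n : ℝ) + s) / 2 - 1 - 1)
  fun_prop

section regular

variable {W : ExtSpace n → ℝ} {ρ : ℝ}

lemma hasGradientAt_of_contDiffOn (hW : ContDiffOn ℝ 1 W (upperHalf n)) {X : ExtSpace n}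
    (hX : X ∈ upperHalf n) : HasGradientAt W (gradient W X) X :=
  ((hW.differentiableOn one_ne_zero).differentiableAt
    (isOpen_upperHalf.mem_nhds hX)).hasGradientAt

lemma continuousOn_gradient (hW : ContDiffOn ℝ 1 W (upperHalf n)) :
    ContinuousOn (gradient W) (upperHalf n) :=
  (InnerProductSpace.toDual ℝ (ExtSpace n)).symm.continuous.comp_continuousOn
    (hW.continuousOn_fderiv_of_isOpen isOpen_upperHalf le_rfl)

lemma measurable_gradient (W : ExtSpace n → ℝ) : Measurable (gradient W) :=
  (InnerProductSpace.toDual ℝ (ExtSpace n)).symm.continuous.measurable.comp (measurable_fderiv ℝ W)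

lemma gradient_eq_zero (h0 : ∀ X ∈ upperHalf n, ρ ≤ ‖X‖ → W X = 0) {X : ExtSpace n}
    (hX : X ∈ upperHalf n) (hX' : ρ < ‖X‖) : gradient W X = 0 := by
  have : W =ᶠ[𝓝 X] fun _ => 0 := by
    filter_upwards [(isOpen_lt continuous_const continuous_norm).mem_nhds hX',
      isOpen_upperHalf.mem_nhds hX] with v hv hv'
    exact h0 v hv' (le_of_lt hv)
  exact ((hasGradientAt_const X (0 : ℝ)).congr_of_eventuallyEq this).gradient

/-- This is the equation `div (z^a ∇P) = 0` in weak form above height `ε`. Integrating by parts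
horizontally moves the derivative onto the kernel, where the equation turns it into `∂_z (z^a ∂_z
P)`; together with the vertical part this is the `z`-derivative of `W z^a ∂_z P`, so only its value
at height `ε` survives. -/
lemma setIntegral_above_inner_kernelGrad (hW : ContDiffOn ℝ 1 W (upperHalf n))
    (h0 : ∀ X ∈ upperHalf n, ρ ≤ ‖X‖ → W X = 0) {ε : ℝ} (hε : 0 < ε)
    (y : EuclideanSpace ℝ (Fin n)) :
    ∫ X in above n ε, X.snd ^ (1 - s) * inner ℝ (gradient W X) (kernelGrad s (X - bdry y)) =
      - ∫ x, W (pt x ε) * fluxKernel s (pt x ε - bdry y) := by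
  have hgc := continuousOn_gradient hW
  have hg0 := fun X hX hX' => gradient_eq_zero h0 (X := X) hX hX'
  have hWc := hW.continuousOn
  have hkc := continuousOn_kernelGrad_sub (s := s) y
  set hor : ExtSpace n → ℝ := fun X =>
    X.snd ^ (1 - s) * inner ℝ (gradient W X).fst (kernelGrad s (X - bdry y)).fst with hhor
  set ver : ExtSpace n → ℝ := fun X =>
    (gradient W X).snd * fluxKernel s (X - bdry y) with hver
  set D : ExtSpace n → ℝ := fun X => W X * fluxKernelDeriv s (X - bdry y) with hD
  have hhorc : ContinuousOn hor (upperHalf n) :=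
    (continuousOn_rpow_snd _).mul ((continuous_fst_ext.comp_continuousOn hgc).inner
      (continuous_fst_ext.comp_continuousOn hkc))
  have hfK : ContinuousOn (fun X => fluxKernel s (X - bdry y)) (upperHalf n) :=
    continuousOn_fluxKernel.comp (by fun_prop) fun _ hX => sub_bdry_mem hX y
  have hverc : ContinuousOn ver (upperHalf n) :=
    (continuous_snd_ext.comp_continuousOn hgc).mul hfK
  have hDc : ContinuousOn D (upperHalf n) := hWc.mul (continuousOn_fluxKernelDeriv y)
  have hhor0 : ∀ X ∈ upperHalf n, ρ < ‖X‖ → hor X = 0 := fun X hX h => by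
    simp [hhor, hg0 X hX h]
  have hver0 : ∀ X ∈ upperHalf n, ρ < ‖X‖ → ver X = 0 := fun X hX h => by
    simp [hver, hg0 X hX h]
  have hD0 : ∀ X ∈ upperHalf n, ρ < ‖X‖ → D X = 0 := fun X hX h => by
    simp [hD, h0 X hX h.le]
  have i1 := integrableOn_above hhorc hhor0 hε
  have i2 := integrableOn_above hverc hver0 hε
  have i3 := integrableOn_above hDc hD0 hε
  have e1 : ∫ X in above n ε, X.snd ^ (1 - s) * inner ℝ (gradient W X) (kernelGrad s (X - bdry y))
      = (∫ X in above n ε, hor X) + ∫ X in above n ε, ver X := by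
    rw [← integral_add i1 i2]
    refine integral_congr_ae (Eventually.of_forall fun X => ?_)
    simp only [hhor, hver, inner_ext, fluxKernel, WithLp.sub_snd, bdry_snd, sub_zero]
    ring
  have e2 : ∫ X in above n ε, hor X = ∫ X in above n ε, D X := by
    rw [setIntegral_above_symm i1, setIntegral_above_symm i3]
    refine setIntegral_congr_fun measurableSet_Ioi fun z hz => ?_
    have hz0 : 0 < z := hε.trans hz
    have h := slice_integral_by_parts (w := fun x => W (pt x z))
      (fun x => hasGradientAt_slice (hasGradientAt_of_contDiffOn hW (X := pt x z) hz0))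
      (continuous_fst_ext.comp (hgc.comp_continuous (by fun_prop) fun x => hz0))
      (fun x hx => h0 (pt x z) hz0 (hx.le.trans (norm_fst_le (pt x z)))) y hz0
      (-((n : ℝ) + s) / 2 - 1)
    have h3 : z ^ (1 - s) * z ^ s = z := by
      rw [← Real.rpow_add hz0]; simp
    calc ∫ x, hor (pt x z) = ∫ x, (-(poissonConst n s * ((n : ℝ) + s) * z)) *
          (inner ℝ (gradient W (pt x z)).fst (x - y) *
            (‖x - y‖ ^ 2 + z ^ 2) ^ (-((n : ℝ) + s) / 2 - 1)) := by
          refine integral_congr_ae (Eventually.of_forall fun x => ?_)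
          simp only [hhor, kernelGrad, norm_sq_pt_sub, WithLp.smul_fst, WithLp.sub_fst, vert_fst,
            smul_zero, zero_sub, inner_smul_right, inner_neg_right, pt_snd, pt_fst, bdry_fst,
            WithLp.sub_snd, bdry_snd, sub_zero]
          linear_combination (-(poissonConst n s * ((n : ℝ) + s) *
            (‖x - y‖ ^ 2 + z ^ 2) ^ (-((n : ℝ) + s) / 2 - 1) *
            inner ℝ (gradient W (pt x z)).fst (x - y))) * h3
      _ = ∫ x, D (pt x z) := by
          rw [integral_const_mul, h, ← integral_neg, ← integral_const_mul]
          refine integral_congr_ae (Eventually.of_forall fun x => ?_)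
          simp only [hD, fluxKernelDeriv, norm_sq_pt_sub, WithLp.sub_snd, bdry_snd, sub_zero, pt_snd]
          -- Here the equation for the kernel enters: once both sides are written with the same
          -- power of `|x - y|² + z²`, it is a polynomial identity.
          have hq : 0 < ‖x - y‖ ^ 2 + z ^ 2 := by positivity
          have h4 : (‖x - y‖ ^ 2 + z ^ 2) ^ (-((n : ℝ) + s) / 2 - 1) =
              (‖x - y‖ ^ 2 + z ^ 2) ^ (-((n : ℝ) + s) / 2 - 1 - 1) * (‖x - y‖ ^ 2 + z ^ 2) := by
            rw [← Real.rpow_add_one hq.ne']; congr 1; ring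
          rw [h4]; ring
  rw [e1, e2, ← integral_add i3 i2, setIntegral_above (F := fun X => D X + ver X) (i3.add i2), ← integral_neg]
  refine integral_congr_ae (Eventually.of_forall fun x => ?_)
  dsimp only
  have hder : ∀ z ∈ Ici ε, HasDerivAt (fun z => W (pt x z) * fluxKernel s (pt x z - bdry y))
      (D (pt x z) + ver (pt x z)) z := by
    intro z hz
    have hz0 : 0 < z := lt_of_lt_of_le hε hz
    have := (hasDerivAt_slice (hasGradientAt_of_contDiffOn hW (X := pt x z) hz0)).mul
      (hasDerivAt_fluxKernel (s := s) x y hz0)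
    refine this.congr_deriv ?_
    simp only [hD, hver]; ring
  have hlim : Tendsto (fun z => W (pt x z) * fluxKernel s (pt x z - bdry y)) atTop (𝓝 0) := by
    refine tendsto_const_nhds.congr' ?_
    filter_upwards [eventually_ge_atTop ρ, eventually_gt_atTop 0] with z hz hz0
    rw [h0 (pt x z) hz0 (hz.trans ((le_abs_self _).trans (abs_snd_le (pt x z)))), zero_mul]
  have := integral_Ioi_of_hasDerivAt_of_tendsto' hder
    ((integrableOn_vertical hDc hD0 hε x).add (integrableOn_vertical hverc hver0 hε x)) hlim
  rw [zero_sub] at this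
  exact this

end regular

/-! ### The weak equation above height `ε` -/

/-- The weighted vertical derivative of the extension of `g`. -/
def extFlux (s : ℝ) (g : EuclideanSpace ℝ (Fin n) → ℝ) (X : ExtSpace n) : ℝ :=
  X.snd ^ (1 - s) * (extGrad s g X).snd

lemma snd_integral {f : EuclideanSpace ℝ (Fin n) → ExtSpace n} (hf : Integrable f) :
    (∫ y, f y).snd = ∫ y, (f y).snd := by
  rw [← inner_vert, ← integral_inner hf]
  simp_rw [inner_vert]

lemma extFlux_eq (hs : 0 < s) {g : EuclideanSpace ℝ (Fin n) → ℝ}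
    (hg : Measurable g) {b : ℝ} (hb : ∀ y, |g y| ≤ b) {X : ExtSpace n} (hX : 0 < X.snd) (c : ℝ) :
    extFlux s g X = ∫ y, (g y - c) * fluxKernel s (X - bdry y) := by
  have hi : Integrable (fun y => (g y - c) • kernelGrad s (X - bdry y)) := by
    simp_rw [sub_smul]
    exact (integrable_smul_kernelGrad hs hg hb hX).sub ((integrable_kernelGrad hs hX).smul c)
  rw [extFlux, extGrad_eq hs hg hb hX c, snd_integral hi, ← integral_const_mul]
  refine integral_congr_ae (Eventually.of_forall fun y => ?_)
  simp only [fluxKernel, WithLp.smul_snd, WithLp.sub_snd, bdry_snd, sub_zero, smul_eq_mul]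
  ring

lemma integral_norm_kernelGrad_le (hs : 0 < s) {X : ExtSpace n} (hX : 0 < X.snd) :
    ∫ y, ‖kernelGrad s (X - bdry y)‖ ≤
      poissonConst n s * (n + 2 * s) * (X.snd ^ (s - 1) * (X.snd ^ (-s) * radMass n s)) := by
  have h := integral_sub_right_eq_self
    (fun y : EuclideanSpace ℝ (Fin n) => (‖y‖ ^ 2 + X.snd ^ 2) ^ (-((n : ℝ) + s) / 2)) X.fst
    (μ := volume)
  rw [← integral_rad hX, ← h, ← integral_const_mul, ← integral_const_mul]
  refine integral_mono (integrable_kernelGrad hs hX).norm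
    ((((integrable_rad hX hs).comp_sub_right X.fst).const_mul _).const_mul _) fun y => ?_
  have := norm_kernelGrad_le hs (sub_bdry_mem hX y)
  rw [norm_sq_sub_bdry, norm_sub_rev] at this
  simpa using this

lemma measurable_kernelGrad_prod : Measurable
    (fun q : ExtSpace n × EuclideanSpace ℝ (Fin n) => kernelGrad s (q.1 - bdry q.2)) :=
  measurable_kernelGrad.comp (by fun_prop)

lemma integrable_inner_kernelGrad_prod (hs : 0 < s) {g : EuclideanSpace ℝ (Fin n) → ℝ}
    (hg : Measurable g) {b : ℝ} (hb : ∀ y, |g y| ≤ b) {W : ExtSpace n → ℝ} {ρ : ℝ}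
    (hW : ContDiffOn ℝ 1 W (upperHalf n))
    (h0 : ∀ X ∈ upperHalf n, ρ ≤ ‖X‖ → W X = 0) {ε : ℝ} (hε : 0 < ε) :
    Integrable (fun q : ExtSpace n × EuclideanSpace ℝ (Fin n) => g q.2 *
      (q.1.snd ^ (1 - s) * inner ℝ (gradient W q.1) (kernelGrad s (q.1 - bdry q.2))))
      ((volume.restrict (above n ε)).prod volume) := by
  have hb0 : 0 ≤ b := (abs_nonneg _).trans (hb 0)
  have hc := poissonConst_pos (n := n) hs
  have hm : Measurable (fun q : ExtSpace n × EuclideanSpace ℝ (Fin n) => g q.2 *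
      (q.1.snd ^ (1 - s) * inner ℝ (gradient W q.1) (kernelGrad s (q.1 - bdry q.2)))) :=
    (hg.comp measurable_snd).mul (((measurable_snd_ext.comp measurable_fst).pow_const _).mul
      (((measurable_gradient W).comp measurable_fst).inner measurable_kernelGrad_prod))
  rw [integrable_prod_iff hm.aestronglyMeasurable]
  have hi : ∀ X : ExtSpace n, 0 < X.snd → Integrable (fun y => g y *
      (X.snd ^ (1 - s) * inner ℝ (gradient W X) (kernelGrad s (X - bdry y)))) := fun X hX =>
    (((integrable_kernelGrad hs hX).const_inner (gradient W X)).const_mul _).bdd_mul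
      hg.aestronglyMeasurable (Eventually.of_forall hb)
  constructor
  · refine (ae_restrict_iff' (measurableSet_above ε)).mpr (Eventually.of_forall fun X hX => ?_)
    exact hi X (hε.trans hX)
  · have hbd : IntegrableOn (fun X : ExtSpace n => b * (X.snd ^ (1 - s) * ‖gradient W X‖ *
        (poissonConst n s * (n + 2 * s) * (X.snd ^ (s - 1) * (X.snd ^ (-s) * radMass n s)))))
        (above n ε) := by
      refine integrableOn_above (ρ := ρ) ?_ (fun X hX h => ?_) hε
      · have h1 := (continuousOn_gradient hW).norm
        have h2 := continuousOn_rpow_snd (n := n) (1 - s)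
        have h3 := continuousOn_rpow_snd (n := n) (s - 1)
        have h4 := continuousOn_rpow_snd (n := n) (-s)
        exact continuousOn_const.mul ((h2.mul h1).mul (continuousOn_const.mul
          (h3.mul (h4.mul continuousOn_const))))
      · simp [gradient_eq_zero h0 hX h]
    refine hbd.mono' hm.norm.stronglyMeasurable.integral_prod_right'.aestronglyMeasurable ?_
    refine (ae_restrict_iff' (measurableSet_above ε)).mpr (Eventually.of_forall fun X hX => ?_)
    have hX0 : 0 < X.snd := hε.trans hX
    rw [Real.norm_of_nonneg (integral_nonneg fun y => norm_nonneg _)]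
    refine le_trans ?_ (mul_le_mul_of_nonneg_left (mul_le_mul_of_nonneg_left
      (integral_norm_kernelGrad_le hs hX0) (by positivity)) hb0)
    rw [← integral_const_mul, ← integral_const_mul]
    refine integral_mono (hi X hX0).norm
      (((integrable_kernelGrad hs hX0).norm.const_mul _).const_mul _) fun y => ?_
    dsimp only
    rw [norm_mul, norm_mul, Real.norm_of_nonneg (r := X.snd ^ (1 - s)) (by positivity), mul_assoc]
    have := norm_inner_le_norm (𝕜 := ℝ) (gradient W X) (kernelGrad s (X - bdry y))
    exact mul_le_mul (hb y) (by gcongr) (by positivity) hb0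

lemma integrable_fluxKernel (hs : 0 < s) {X : ExtSpace n} (hX : 0 < X.snd) :
    Integrable (fun y => fluxKernel s (X - bdry y)) := by
  have h := ((integrable_kernelGrad hs hX).const_inner (vert n)).const_mul (X.snd ^ (1 - s))
  refine h.congr (Eventually.of_forall fun y => ?_)
  simp [fluxKernel]

lemma measurable_fluxKernel : Measurable (fluxKernel (n := n) s) :=
  (measurable_snd_ext.pow_const _).mul (measurable_snd_ext.comp measurable_kernelGrad)

lemma measurable_fluxKernel_prod (ε : ℝ) : Measurable
    (fun q : EuclideanSpace ℝ (Fin n) × EuclideanSpace ℝ (Fin n) =>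
      fluxKernel s (pt q.1 ε - bdry q.2)) :=
  measurable_fluxKernel.comp (by fun_prop)

lemma exists_integral_abs_fluxKernel_le (hs : 0 < s) {ε : ℝ} (hε : 0 < ε) : ∃ C, 0 ≤ C ∧
    ∀ x : EuclideanSpace ℝ (Fin n), ∫ y, |fluxKernel s (pt x ε - bdry y)| ≤ C := by
  have hc := poissonConst_pos (n := n) hs
  have hM := radMass_pos (n := n) hs
  refine ⟨ε ^ (1 - s) * (poissonConst n s * (n + 2 * s) * (ε ^ (s - 1) * (ε ^ (-s) * radMass n s))),
    by positivity, fun x => ?_⟩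
  have hX : 0 < (pt x ε).snd := hε
  refine le_trans ?_ (mul_le_mul_of_nonneg_left (integral_norm_kernelGrad_le hs hX)
    (by positivity))
  rw [← integral_const_mul]
  refine integral_mono (integrable_fluxKernel hs hX).abs
    ((integrable_kernelGrad hs hX).norm.const_mul _) fun y => ?_
  simp only [fluxKernel, abs_mul, WithLp.sub_snd, bdry_snd, sub_zero, pt_snd]
  rw [abs_of_nonneg (a := ε ^ (1 - s)) (by positivity)]
  exact mul_le_mul_of_nonneg_left (abs_snd_le _) (by positivity)

/-- A kernel with uniformly integrable slices stays integrable against bounded functions with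
bounded support in the first variable. -/
lemma integrable_mul_fluxKernel_prod (hs : 0 < s) {ε : ℝ} (hε : 0 < ε) {ρ B : ℝ}
    {T : EuclideanSpace ℝ (Fin n) × EuclideanSpace ℝ (Fin n) → ℝ} (hT : Measurable T)
    (hB : ∀ q, |T q| ≤ B) (h0 : ∀ q, ρ < ‖q.1‖ → T q = 0) :
    Integrable (fun q => T q * fluxKernel s (pt q.1 ε - bdry q.2)) (volume.prod volume) := by
  have hB0 : 0 ≤ B := (abs_nonneg _).trans (hB 0)
  obtain ⟨C, hC0, hC⟩ := exists_integral_abs_fluxKernel_le (n := n) hs hε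
  have hm := hT.mul (measurable_fluxKernel_prod (n := n) (s := s) ε)
  have hi : ∀ x : EuclideanSpace ℝ (Fin n), Integrable fun y =>
      T (x, y) * fluxKernel s (pt x ε - bdry y) := fun x =>
    (integrable_fluxKernel hs (X := pt x ε) hε).bdd_mul
      (hT.comp measurable_prodMk_left).aestronglyMeasurable (Eventually.of_forall fun y => hB (x, y))
  refine (integrable_prod_iff hm.aestronglyMeasurable).mpr
    ⟨Eventually.of_forall hi, ?_⟩
  have hbd : Integrable (indicator (Metric.closedBall (0 : EuclideanSpace ℝ (Fin n)) ρ)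
      fun _ => B * C) :=
    (integrable_indicator_iff measurableSet_closedBall).mpr
      (integrableOn_const (measure_closedBall_lt_top).ne)
  refine hbd.mono' hm.norm.stronglyMeasurable.integral_prod_right'.aestronglyMeasurable
    (Eventually.of_forall fun x => ?_)
  rw [Real.norm_of_nonneg (integral_nonneg fun y => norm_nonneg _)]
  by_cases hx : ‖x‖ ≤ ρ
  · rw [indicator_of_mem (by simpa using hx)]
    refine le_trans ?_ (mul_le_mul_of_nonneg_left (hC x) hB0)
    rw [← integral_const_mul]
    refine integral_mono (hi x).norm ((integrable_fluxKernel hs (X := pt x ε) hε).abs.const_mul _)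
      fun y => ?_
    simp only [Pi.mul_apply, norm_mul, Real.norm_eq_abs]
    exact mul_le_mul_of_nonneg_right (hB _) (abs_nonneg _)
  · rw [indicator_of_notMem (by simpa using hx)]
    simp [h0 (x, _) (not_le.mp hx)]

/-- The extension is a superposition of kernels, so the identity for a single kernel is integrated
against `g y`, with Fubini on both sides. -/
lemma setIntegral_above_inner_extGrad (hs : 0 < s) {g : EuclideanSpace ℝ (Fin n) → ℝ}
    (hg : Measurable g) {b : ℝ} (hb : ∀ y, |g y| ≤ b) {W : ExtSpace n → ℝ} {ρ : ℝ}
    (hW : ContDiffOn ℝ 1 W (upperHalf n))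
    (h0 : ∀ X ∈ upperHalf n, ρ ≤ ‖X‖ → W X = 0) {ε : ℝ} (hε : 0 < ε) :
    ∫ X in above n ε, X.snd ^ (1 - s) * inner ℝ (gradient W X) (extGrad s g X) =
      - ∫ x, W (pt x ε) * extFlux s g (pt x ε) := by
  have hint := integrable_inner_kernelGrad_prod hs hg hb hW h0 hε
  have e1 : ∫ X in above n ε, X.snd ^ (1 - s) * inner ℝ (gradient W X) (extGrad s g X) =
      ∫ X in above n ε, ∫ y, g y *
        (X.snd ^ (1 - s) * inner ℝ (gradient W X) (kernelGrad s (X - bdry y))) := by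
    refine setIntegral_congr_fun (measurableSet_above ε) fun X hX => ?_
    have hX0 : 0 < X.snd := hε.trans hX
    rw [extGrad, ← integral_inner (integrable_smul_kernelGrad hs hg hb hX0), ← integral_const_mul]
    refine integral_congr_ae (Eventually.of_forall fun y => ?_)
    simp only [inner_smul_right]; ring
  rw [e1, integral_integral_swap hint]
  have e2 : ∀ y, ∫ X in above n ε, g y *
      (X.snd ^ (1 - s) * inner ℝ (gradient W X) (kernelGrad s (X - bdry y))) =
      - ∫ x, (W (pt x ε) * g y) * fluxKernel s (pt x ε - bdry y) := by
    intro y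
    rw [integral_const_mul, setIntegral_above_inner_kernelGrad hW h0 hε y, mul_neg,
      ← integral_const_mul]
    congr 1
    refine integral_congr_ae (Eventually.of_forall fun x => ?_)
    dsimp only; ring
  simp_rw [e2]
  have hWc : Continuous fun x => W (pt x ε) := continuous_slice hW.continuousOn hε
  have hW0 : ∀ x : EuclideanSpace ℝ (Fin n), ρ < ‖x‖ → W (pt x ε) = 0 := fun x hx =>
    h0 _ hε (hx.le.trans (norm_fst_le (pt x ε)))
  obtain ⟨M, hM⟩ : ∃ M, ∀ x, ‖W (pt x ε)‖ ≤ M := by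
    exact (HasCompactSupport.intro (isCompact_closedBall 0 ρ)
      fun x hx => hW0 x (by simpa using hx)).exists_bound_of_continuous hWc
  have hT := integrable_mul_fluxKernel_prod (s := s) hs hε (ρ := ρ) (B := M * b)
    (T := fun q : EuclideanSpace ℝ (Fin n) × EuclideanSpace ℝ (Fin n) => W (pt q.1 ε) * g q.2)
    ((hWc.measurable.comp measurable_fst).mul (hg.comp measurable_snd))
    (fun q => by
      rw [abs_mul]
      exact mul_le_mul (hM _) (hb _) (abs_nonneg _) ((norm_nonneg _).trans (hM 0)))
    (fun q hq => by simp [hW0 _ hq])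
  rw [integral_neg, ← integral_integral_swap hT]
  congr 1
  refine integral_congr_ae (Eventually.of_forall fun x => ?_)
  dsimp only
  rw [extFlux_eq hs hg hb (X := pt x ε) hε 0, ← integral_const_mul]
  refine integral_congr_ae (Eventually.of_forall fun y => ?_)
  dsimp only; ring

lemma fluxKernel_symm (x y : EuclideanSpace ℝ (Fin n)) {ε : ℝ} (hε : 0 < ε) :
    fluxKernel s (pt x ε - bdry y) = fluxKernel s (pt y ε - bdry x) := by
  rw [fluxKernel_eq (sub_bdry_mem (X := pt x ε) hε y),
    fluxKernel_eq (sub_bdry_mem (X := pt y ε) hε x), norm_sq_pt_sub, norm_sq_pt_sub, norm_sub_rev]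
  simp

/-- The flux kernel has zero mass, so `g x` may be subtracted inside the flux, and it is symmetric
in `x` and `y`, so averaging with the swapped integral produces the product of differences. In this
form the limit `ε → 0` is harmless. -/
lemma integral_mul_extFlux (hs : 0 < s) {g : EuclideanSpace ℝ (Fin n) → ℝ}
    (hg : Measurable g) {b : ℝ} (hb : ∀ y, |g y| ≤ b) {w : EuclideanSpace ℝ (Fin n) → ℝ}
    (hw : Measurable w) {b' : ℝ} (hb' : ∀ y, |w y| ≤ b') {ρ : ℝ} (h0 : ∀ x, ρ < ‖x‖ → w x = 0)
    {ε : ℝ} (hε : 0 < ε) :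
    - ∫ x, w x * extFlux s g (pt x ε) =
      1 / 2 * ∫ q : EuclideanSpace ℝ (Fin n) × EuclideanSpace ℝ (Fin n),
        (w q.1 - w q.2) * (g q.1 - g q.2) * fluxKernel s (pt q.1 ε - bdry q.2)
          ∂(volume.prod volume) := by
  have hT := integrable_mul_fluxKernel_prod (s := s) hs hε (ρ := ρ) (B := b' * (b + b))
    (T := fun q : EuclideanSpace ℝ (Fin n) × EuclideanSpace ℝ (Fin n) => w q.1 * (g q.1 - g q.2))
    (by fun_prop)
    (fun q => by
      rw [abs_mul]
      exact mul_le_mul (hb' _) ((abs_sub _ _).trans (add_le_add (hb _) (hb _))) (abs_nonneg _)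
        ((abs_nonneg _).trans (hb' 0)))
    (fun q hq => by simp [h0 _ hq])
  have e1 : - ∫ x, w x * extFlux s g (pt x ε) =
      ∫ q : EuclideanSpace ℝ (Fin n) × EuclideanSpace ℝ (Fin n),
        w q.1 * (g q.1 - g q.2) * fluxKernel s (pt q.1 ε - bdry q.2) ∂(volume.prod volume) := by
    rw [integral_prod _ hT, ← integral_neg]
    refine integral_congr_ae (Eventually.of_forall fun x => ?_)
    dsimp only
    rw [extFlux_eq hs hg hb (X := pt x ε) hε (g x), ← integral_const_mul, ← integral_neg]
    refine integral_congr_ae (Eventually.of_forall fun y => ?_)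
    dsimp only; ring
  have e2 := integral_prod_swap (μ := (volume : Measure (EuclideanSpace ℝ (Fin n))))
    (ν := (volume : Measure (EuclideanSpace ℝ (Fin n))))
    (fun q => w q.1 * (g q.1 - g q.2) * fluxKernel s (pt q.1 ε - bdry q.2))
  have e3 : (∫ q : EuclideanSpace ℝ (Fin n) × EuclideanSpace ℝ (Fin n),
        (w q.1 - w q.2) * (g q.1 - g q.2) * fluxKernel s (pt q.1 ε - bdry q.2)
          ∂(volume.prod volume)) = (∫ q : EuclideanSpace ℝ (Fin n) × EuclideanSpace ℝ (Fin n),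
        w q.1 * (g q.1 - g q.2) * fluxKernel s (pt q.1 ε - bdry q.2) ∂(volume.prod volume)) +
      ∫ q : EuclideanSpace ℝ (Fin n) × EuclideanSpace ℝ (Fin n),
        w q.swap.1 * (g q.swap.1 - g q.swap.2) * fluxKernel s (pt q.swap.1 ε - bdry q.swap.2)
          ∂(volume.prod volume) := by
    rw [← integral_add hT (by exact hT.swap)]
    refine integral_congr_ae (Eventually.of_forall fun q => ?_)
    simp only [Prod.fst_swap, Prod.snd_swap]
    rw [fluxKernel_symm q.2 q.1 hε]; ring
  rw [e1, e3, e2]; ring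

/-! ### The weak equation up to the boundary -/

/-- The integrand of the Gagliardo form. -/
def formDensity (s : ℝ) (w g : EuclideanSpace ℝ (Fin n) → ℝ)
    (q : EuclideanSpace ℝ (Fin n) × EuclideanSpace ℝ (Fin n)) : ℝ :=
  (w q.1 - w q.2) * (g q.1 - g q.2) / ‖q.1 - q.2‖ ^ ((n : ℝ) + s)

lemma measurable_formDensity {w g : EuclideanSpace ℝ (Fin n) → ℝ} (hw : Measurable w)
    (hg : Measurable g) : Measurable (formDensity s w g) := by
  unfold formDensity; fun_prop

/-- The Gagliardo form of order `s / 2`. -/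
def gForm (s : ℝ) (w g : EuclideanSpace ℝ (Fin n) → ℝ) : ℝ :=
  ∫ q, formDensity s w g q ∂(volume.prod volume)

lemma rpow_norm_sq_add {x : EuclideanSpace ℝ (Fin n)} (κ : ℝ) :
    (‖x‖ ^ 2) ^ (-κ / 2) = (‖x‖ ^ κ)⁻¹ := by
  rw [← Real.rpow_natCast, ← Real.rpow_mul (norm_nonneg _), ← Real.rpow_neg (norm_nonneg _)]
  congr 1; push_cast; ring

lemma tendsto_fluxKernel {x y : EuclideanSpace ℝ (Fin n)} (hxy : x ≠ y) :
    Tendsto (fun ε => fluxKernel s (pt x ε - bdry y)) (𝓝[>] 0)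
      (𝓝 (poissonConst n s * s * (‖x - y‖ ^ ((n : ℝ) + s))⁻¹)) := by
  have hd : 0 < ‖x - y‖ := norm_pos_iff.mpr (sub_ne_zero.mpr hxy)
  have e : (fun ε => fluxKernel s (pt x ε - bdry y)) =ᶠ[𝓝[>] 0] fun z =>
      poissonConst n s * (s * (‖x - y‖ ^ 2 + z ^ 2) ^ (-((n : ℝ) + s) / 2) -
      ((n : ℝ) + s) * z ^ 2 * (‖x - y‖ ^ 2 + z ^ 2) ^ (-((n : ℝ) + s) / 2 - 1)) := by
    filter_upwards [self_mem_nhdsWithin] with w hw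
    rw [fluxKernel_eq (by simpa using hw), norm_sq_pt_sub]; simp
  have hr : ∀ κ : ℝ, ContinuousAt (fun z : ℝ => (‖x - y‖ ^ 2 + z ^ 2) ^ κ) 0 := fun κ =>
    ContinuousAt.rpow_const (by fun_prop) (Or.inl (by simpa using hd.ne'))
  have hc : ContinuousAt (fun z : ℝ =>
      poissonConst n s * (s * (‖x - y‖ ^ 2 + z ^ 2) ^ (-((n : ℝ) + s) / 2) -
      ((n : ℝ) + s) * z ^ 2 * (‖x - y‖ ^ 2 + z ^ 2) ^ (-((n : ℝ) + s) / 2 - 1))) 0 := by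
    have h1 := hr (-((n : ℝ) + s) / 2)
    have h2 := hr (-((n : ℝ) + s) / 2 - 1)
    fun_prop
  have h := (hc.tendsto.mono_left nhdsWithin_le_nhds).congr' e.symm
  convert h using 2
  rw [← rpow_norm_sq_add]; simp [mul_assoc]

/-- Dominated convergence: `|x - y|² + ε² ≥ |x - y|²` bounds the integrand by a multiple of
`formDensity`, and on the diagonal the differences vanish. -/
lemma tendsto_flux_form (hs : 0 < s) {w g : EuclideanSpace ℝ (Fin n) → ℝ} (hw : Measurable w)
    (hg : Measurable g) (hint : Integrable (formDensity s w g) (volume.prod volume)) :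
    Tendsto (fun ε => ∫ q : EuclideanSpace ℝ (Fin n) × EuclideanSpace ℝ (Fin n),
        (w q.1 - w q.2) * (g q.1 - g q.2) * fluxKernel s (pt q.1 ε - bdry q.2)
          ∂(volume.prod volume)) (𝓝[>] 0)
      (𝓝 (poissonConst n s * s * gForm s w g)) := by
  have hc := poissonConst_pos (n := n) hs
  rw [gForm, ← integral_const_mul]
  refine tendsto_integral_filter_of_dominated_convergence
    (fun q => poissonConst n s * (n + 2 * s) * ‖formDensity s w g q‖) ?_ ?_
    (hint.norm.const_mul _) ?_
  · refine Eventually.of_forall fun ε => ?_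
    exact ((by fun_prop : Measurable fun q : EuclideanSpace ℝ (Fin n) × EuclideanSpace ℝ (Fin n) =>
      (w q.1 - w q.2) * (g q.1 - g q.2)).mul (measurable_fluxKernel_prod ε)).aestronglyMeasurable
  · filter_upwards [self_mem_nhdsWithin] with ε hε
    refine Eventually.of_forall fun q => ?_
    by_cases hq : q.1 = q.2
    · simp [hq, formDensity]
    have hd : 0 < ‖q.1 - q.2‖ := norm_pos_iff.mpr (sub_ne_zero.mpr hq)
    have h1 := abs_fluxKernel_le hs (sub_bdry_mem (X := pt q.1 ε) hε q.2)
    have h2 : (‖pt q.1 ε - bdry q.2‖ ^ 2) ^ (-((n : ℝ) + s) / 2) ≤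
        (‖q.1 - q.2‖ ^ ((n : ℝ) + s))⁻¹ := by
      rw [← rpow_norm_sq_add, norm_sq_pt_sub]
      refine Real.rpow_le_rpow_of_nonpos (by positivity) (by nlinarith [sq_nonneg ε]) ?_
      have : 0 ≤ (n : ℝ) + s := by positivity
      linarith
    rw [norm_mul, formDensity, norm_div, Real.norm_of_nonneg (r := ‖q.1 - q.2‖ ^ ((n : ℝ) + s))
      (by positivity), Real.norm_eq_abs (fluxKernel s _)]
    calc _ ≤ ‖(w q.1 - w q.2) * (g q.1 - g q.2)‖ * (poissonConst n s * (n + 2 * s) *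
          (‖q.1 - q.2‖ ^ ((n : ℝ) + s))⁻¹) := by
          refine mul_le_mul_of_nonneg_left (h1.trans ?_) (norm_nonneg _)
          exact mul_le_mul_of_nonneg_left h2 (by positivity)
      _ = _ := by ring
  · refine Eventually.of_forall fun q => ?_
    by_cases hq : q.1 = q.2
    · simp [hq, formDensity]
    have h := (tendsto_fluxKernel (s := s) hq).const_mul ((w q.1 - w q.2) * (g q.1 - g q.2))
    convert h using 2
    rw [formDensity]; ring

/-- If the limit were nonzero, `h` would dominate a positive multiple of `1/ε` near `0`, which is
not integrable. This kills the boundary term without a bound on the energy of individual slices. -/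
lemma eq_zero_of_sq_le_mul_integrable {h : ℝ → ENNReal} (hh : ∫⁻ ε in Ioi 0, h ε ≠ ⊤)
    {d : ℝ → ℝ} {L C : ℝ} (hd : Tendsto d (𝓝[>] 0) (𝓝 L))
    (hle : ∀ᶠ ε in 𝓝[>] 0, ENNReal.ofReal (d ε ^ 2) ≤ ENNReal.ofReal (C * ε) * h ε) : L = 0 := by
  by_contra hL
  have hL2 : 0 < L ^ 2 := by positivity
  have h1 : ∀ᶠ ε in 𝓝[>] (0 : ℝ), L ^ 2 / 2 < d ε ^ 2 :=
    (hd.pow 2).eventually (lt_mem_nhds (by linarith))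
  obtain ⟨ε₁, hε₁, hsub⟩ := (mem_nhdsGT_iff_exists_Ioo_subset).mp (h1.and hle)
  have hε₁ : 0 < ε₁ := hε₁
  have hCpos : 0 < C := by
    by_contra hC
    obtain ⟨h2, h3⟩ := hsub (show ε₁ / 2 ∈ Ioo 0 ε₁ from ⟨by linarith, by linarith⟩)
    have h4 : C * (ε₁ / 2) ≤ 0 := mul_nonpos_of_nonpos_of_nonneg (not_lt.mp hC) (by linarith)
    rw [ENNReal.ofReal_of_nonpos h4, zero_mul, nonpos_iff_eq_zero, ENNReal.ofReal_eq_zero] at h3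
    linarith
  have key : ∀ ε ∈ Ioo 0 ε₁, ENNReal.ofReal (L ^ 2 / 2 / C * ε⁻¹) ≤ h ε := by
    intro ε hε
    obtain ⟨h2, h3⟩ := hsub hε
    have hε0 := hε.1
    have h5 : ENNReal.ofReal (L ^ 2 / 2) ≤ ENNReal.ofReal (C * ε) * h ε :=
      (ENNReal.ofReal_le_ofReal h2.le).trans h3
    rw [show L ^ 2 / 2 / C * ε⁻¹ = (L ^ 2 / 2) / (C * ε) by field_simp,
      ENNReal.ofReal_div_of_pos (by positivity)]
    exact ENNReal.div_le_of_le_mul' h5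
  have hfin : ∫⁻ ε in Ioo 0 ε₁, ENNReal.ofReal (L ^ 2 / 2 / C * ε⁻¹) ≠ ⊤ := by
    refine ne_top_of_le_ne_top hh ?_
    exact (setLIntegral_mono' measurableSet_Ioo key).trans
      (lintegral_mono_set Ioo_subset_Ioi_self)
  have hi : IntegrableOn (fun ε : ℝ => L ^ 2 / 2 / C * ε⁻¹) (Ioo 0 ε₁) := by
    refine ⟨(measurable_inv.const_mul _).aestronglyMeasurable, ?_⟩
    rw [hasFiniteIntegral_iff_ofReal]
    · exact hfin.lt_top
    · refine (ae_restrict_iff' measurableSet_Ioo).mpr (Eventually.of_forall fun ε hε => ?_)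
      have := hε.1
      dsimp only [Pi.zero_apply]; positivity
  have hi2 : IntegrableOn (fun ε : ℝ => ε⁻¹) (Ioo 0 ε₁) := by
    have := hi.const_mul (L ^ 2 / 2 / C)⁻¹
    refine this.congr (Eventually.of_forall fun ε => ?_)
    field_simp
  have hi3 : IntervalIntegrable (fun ε : ℝ => ε⁻¹) volume 0 ε₁ :=
    (intervalIntegrable_iff_integrableOn_Ioo_of_le hε₁.le).mpr hi2
  rw [intervalIntegrable_inv_iff] at hi3
  rcases hi3 with h | h
  · exact hε₁.ne h
  · exact h left_mem_uIcc

lemma tendsto_setIntegral_above {F : ExtSpace n → ℝ} (hF : IntegrableOn F (upperHalf n)) :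
    Tendsto (fun ε => ∫ X in above n ε, F X) (𝓝[>] 0) (𝓝 (∫ X in upperHalf n, F X)) := by
  have e : (fun ε => ∫ X in above n ε, F X) =ᶠ[𝓝[>] 0] fun ε =>
      ∫ X in upperHalf n, (above n ε).indicator F X := by
    filter_upwards [self_mem_nhdsWithin] with ε hε
    rw [setIntegral_indicator (measurableSet_above ε)]
    congr 2
    ext X
    exact ⟨fun h => ⟨lt_trans (show 0 < ε from hε) h, h⟩, fun h => h.2⟩
  refine Tendsto.congr' e.symm ?_
  refine tendsto_integral_filter_of_dominated_convergence (fun X => ‖F X‖) ?_ ?_ hF.norm ?_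
  · exact Eventually.of_forall fun ε => hF.aestronglyMeasurable.indicator (measurableSet_above ε)
  · exact Eventually.of_forall fun ε => Eventually.of_forall fun X => norm_indicator_le_norm_self _ _
  · refine (ae_restrict_iff' measurableSet_upperHalf).mpr (Eventually.of_forall fun X hX => ?_)
    refine tendsto_const_nhds.congr' ?_
    have : ∀ᶠ ε in 𝓝[>] (0 : ℝ), ε < X.snd :=
      nhdsWithin_le_nhds (gt_mem_nhds (show 0 < X.snd from hX))
    filter_upwards [this] with ε hε
    exact (indicator_of_mem (show X ∈ above n ε from hε) F).symm

lemma abs_extFlux_le (hs : 0 < s) {g : EuclideanSpace ℝ (Fin n) → ℝ}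
    (hg : Measurable g) {b : ℝ} (hb : ∀ y, |g y| ≤ b) {ε : ℝ} (hε : 0 < ε) :
    ∃ M, ∀ x, |extFlux s g (pt x ε)| ≤ M := by
  obtain ⟨C, hC0, hC⟩ := exists_integral_abs_fluxKernel_le (n := n) hs hε
  refine ⟨b * C, fun x => ?_⟩
  rw [extFlux_eq hs hg hb (X := pt x ε) hε 0]
  refine (abs_integral_le_integral_abs).trans ?_
  refine le_trans ?_ (mul_le_mul_of_nonneg_left (hC x) ((abs_nonneg _).trans (hb 0)))
  rw [← integral_const_mul]
  have hi := integrable_fluxKernel (n := n) hs (X := pt x ε) hε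
  refine integral_mono ?_ (hi.abs.const_mul _) fun y => ?_
  · simp only [sub_zero]
    exact (hi.bdd_mul hg.aestronglyMeasurable (Eventually.of_forall hb)).abs
  · dsimp only
    rw [sub_zero, abs_mul]
    exact mul_le_mul_of_nonneg_right (hb y) (abs_nonneg _)

lemma measurable_extFlux {g : EuclideanSpace ℝ (Fin n) → ℝ} (hg : Measurable g) :
    Measurable (extFlux s g) :=
  (measurable_snd_ext.pow_const _).mul (measurable_snd_ext.comp (measurable_extGrad hg))

/-- Above height `ε` the left side is minus the pairing of `W(·, ε)` with the flux, while minus the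
pairing of `w` with the same flux tends to the right side. The discrepancy is estimated by
Cauchy–Schwarz: the trace error contributes `C ε^s` and the flux contributes `ε^{1-s}` times the
energy of the slice. The product is `C ε` times an integrable function of `ε`, so
`eq_zero_of_sq_le_mul_integrable` applies. -/
theorem weak_equation (hs : 0 < s) {g : EuclideanSpace ℝ (Fin n) → ℝ}
    (hg : Measurable g) {b : ℝ} (hb : ∀ y, |g y| ≤ b) {w : EuclideanSpace ℝ (Fin n) → ℝ}
    (hw : Measurable w) {b' : ℝ} (hb' : ∀ y, |w y| ≤ b') {W : ExtSpace n → ℝ} {ρ : ℝ}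
    (hW : ContDiffOn ℝ 1 W (upperHalf n)) (hW0 : ∀ X ∈ upperHalf n, ρ ≤ ‖X‖ → W X = 0)
    (hw0 : ∀ x, ρ ≤ ‖x‖ → w x = 0)
    (hint : Integrable (formDensity s w g) (volume.prod volume))
    (hgag : gagliardo s (Metric.ball 0 ρ) g ≠ ⊤)
    (hWint : IntegrableOn (fun X => X.snd ^ (1 - s) * inner ℝ (gradient W X) (extGrad s g X))
      (upperHalf n))
    {C ε₀ : ℝ} (hε₀ : 0 < ε₀) (htr : ∀ ε ∈ Ioo 0 ε₀,
      ∫⁻ x, ENNReal.ofReal ((W (pt x ε) - w x) ^ 2) ≤ ENNReal.ofReal (C * ε ^ s)) :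
    ∫ X in upperHalf n, X.snd ^ (1 - s) * inner ℝ (gradient W X) (extGrad s g X) =
      poissonConst n s * s / 2 * gForm s w g := by
  set h : ℝ → ENNReal := fun ε => ∫⁻ x in Metric.ball 0 ρ,
    ENNReal.ofReal (ε ^ (1 - s) * ‖extGrad s g (pt x ε)‖ ^ 2) with hh
  have hhfin : ∫⁻ ε in Ioi 0, h ε ≠ ⊤ := by
    obtain ⟨K, hK0, hK⟩ := exists_energy_le n hs
    have h1 := hK g b (Metric.ball 0 ρ) hg hb measurableSet_ball
    rw [setLIntegral_cyl measurableSet_ball (measurable_energy hg).ennreal_ofReal,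
      lintegral_lintegral_swap] at h1
    · exact ne_top_of_le_ne_top (ENNReal.mul_ne_top ENNReal.ofReal_ne_top hgag) h1
    · exact ((measurable_energy hg).ennreal_ofReal.comp continuous_pt.measurable).aemeasurable
  have hA := tendsto_setIntegral_above hWint
  have hB := (tendsto_flux_form hs hw hg hint).const_mul (1 / 2)
  have hAB := hA.sub hB
  have h0 := eq_zero_of_sq_le_mul_integrable (C := C) hhfin hAB ?_
  · linear_combination h0
  filter_upwards [Ioo_mem_nhdsGT hε₀] with ε hε
  have hε0 : 0 < ε := hε.1
  have hWx : ∀ x : EuclideanSpace ℝ (Fin n), ρ ≤ ‖x‖ → W (pt x ε) = 0 := fun x hx =>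
    hW0 _ hε0 (hx.trans (norm_fst_le (pt x ε)))
  have hWc : Continuous fun x => W (pt x ε) := continuous_slice hW.continuousOn hε0
  have hWs : HasCompactSupport fun x => W (pt x ε) :=
    HasCompactSupport.intro (isCompact_closedBall 0 ρ)
      fun x hx => hWx x (le_of_lt (by simpa using hx))
  obtain ⟨M, hM⟩ := abs_extFlux_le hs hg hb hε0
  have hfm : Measurable fun x => extFlux s g (pt x ε) :=
    (measurable_extFlux hg).comp (by fun_prop : Continuous fun x => pt x ε).measurable
  have hwi : Integrable w := by
    have hi : IntegrableOn w (Metric.ball 0 ρ) :=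
      Measure.integrableOn_of_bounded (M := b') measure_ball_lt_top.ne hw.aestronglyMeasurable
        (Eventually.of_forall hb')
    refine (integrableOn_iff_integrable_of_support_subset fun x hx => ?_).mp hi
    by_contra hx'
    exact hx (hw0 x (by simpa using hx'))
  have i1 : Integrable fun x => W (pt x ε) * extFlux s g (pt x ε) :=
    (hWc.integrable_of_hasCompactSupport hWs).mul_bdd hfm.aestronglyMeasurable
      (Eventually.of_forall hM)
  have i2 : Integrable fun x => w x * extFlux s g (pt x ε) :=
    hwi.mul_bdd hfm.aestronglyMeasurable (Eventually.of_forall hM)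
  rw [setIntegral_above_inner_extGrad hs hg hb hW hW0 hε0,
    ← integral_mul_extFlux hs hg hb hw hb' (fun x hx => hw0 x hx.le) hε0,
    neg_sub_neg, ← integral_sub i2 i1]
  have e1 : ‖∫ x, (w x * extFlux s g (pt x ε) - W (pt x ε) * extFlux s g (pt x ε))‖ₑ ≤
      ∫⁻ x, ‖W (pt x ε) - w x‖ₑ * (Metric.ball 0 ρ).indicator
        (fun x => ‖extFlux s g (pt x ε)‖ₑ) x := by
    refine (enorm_integral_le_lintegral_enorm _).trans (lintegral_mono fun x => ?_)
    dsimp only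
    rw [← sub_mul, enorm_mul, enorm_sub_rev]
    by_cases hx : x ∈ Metric.ball (0 : EuclideanSpace ℝ (Fin n)) ρ
    · rw [indicator_of_mem hx]
    · have hx' : ρ ≤ ‖x‖ := by simpa using hx
      simp [hWx x hx', hw0 x hx']
  have e2 := (pow_le_pow_left' e1 2).trans (sq_lintegral_mul_le
    (hWc.measurable.sub hw).enorm.aemeasurable
    (hfm.enorm.indicator measurableSet_ball).aemeasurable)
  rw [← sq_abs, ENNReal.ofReal_pow (abs_nonneg _), ← Real.norm_eq_abs, ofReal_norm]
  refine e2.trans ?_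
  have e3 : ∫⁻ x, ‖W (pt x ε) - w x‖ₑ ^ 2 ≤ ENNReal.ofReal (C * ε ^ s) := by
    refine le_trans (le_of_eq (lintegral_congr fun x => ?_)) (htr ε hε)
    rw [← ofReal_norm, ← ENNReal.ofReal_pow (norm_nonneg _), Real.norm_eq_abs, sq_abs]
  -- The flux carries the weight squared and the energy carries it once, whence the extra factor
  -- `ε^{1-s}`.
  have e4 : ∫⁻ x, (Metric.ball 0 ρ).indicator (fun x => ‖extFlux s g (pt x ε)‖ₑ) x ^ 2 ≤
      ENNReal.ofReal (ε ^ (1 - s)) * h ε := by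
    rw [hh, ← lintegral_const_mul' _ _ ENNReal.ofReal_ne_top, ← lintegral_indicator measurableSet_ball]
    refine lintegral_mono fun x => ?_
    dsimp only
    by_cases hx : x ∈ Metric.ball (0 : EuclideanSpace ℝ (Fin n)) ρ
    · rw [indicator_of_mem hx, indicator_of_mem hx, ← ofReal_norm,
        ← ENNReal.ofReal_pow (norm_nonneg _), ← ENNReal.ofReal_mul (by positivity)]
      apply ENNReal.ofReal_le_ofReal
      rw [extFlux, norm_mul, Real.norm_of_nonneg (r := (pt x ε).snd ^ (1 - s))
        (by rw [pt_snd]; positivity), mul_pow, pt_snd, sq (ε ^ (1 - s)), mul_assoc]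
      have := abs_snd_le (extGrad s g (pt x ε))
      rw [Real.norm_eq_abs]
      gcongr
    · rw [indicator_of_notMem hx, indicator_of_notMem hx]; simp
  refine (mul_le_mul' e3 e4).trans (le_of_eq ?_)
  rw [← mul_assoc, ← ENNReal.ofReal_mul' (by positivity), mul_assoc C, ← Real.rpow_add hε0]
  simp

/-! ### The sharp trace inequality -/

lemma formDensity_self (w : EuclideanSpace ℝ (Fin n) → ℝ)
    (q : EuclideanSpace ℝ (Fin n) × EuclideanSpace ℝ (Fin n)) :
    formDensity s w w q = (w q.1 - w q.2) ^ 2 / ‖q.1 - q.2‖ ^ ((n : ℝ) + s) := by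
  rw [formDensity, sq]

lemma lintegral_formDensity_self {w : EuclideanSpace ℝ (Fin n) → ℝ} (hw : Measurable w) :
    ∫⁻ q, ENNReal.ofReal (formDensity s w w q) ∂(volume.prod volume) = gagliardo s univ w := by
  rw [lintegral_prod _ (measurable_formDensity hw hw).ennreal_ofReal.aemeasurable, gagliardo,
    setLIntegral_univ]
  simp_rw [formDensity_self]

lemma integrable_formDensity_self {w : EuclideanSpace ℝ (Fin n) → ℝ} (hw : Measurable w)
    (h : gagliardo s univ w ≠ ⊤) : Integrable (formDensity s w w) (volume.prod volume) := by
  refine ⟨(measurable_formDensity hw hw).aestronglyMeasurable, ?_⟩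
  rw [hasFiniteIntegral_iff_ofReal, lintegral_formDensity_self hw]
  · exact h.lt_top
  · refine Eventually.of_forall fun q => ?_
    rw [formDensity_self]
    dsimp only [Pi.zero_apply]; positivity

lemma gagliardo_mono {D D' : Set (EuclideanSpace ℝ (Fin n))} (h : D ⊆ D')
    (g : EuclideanSpace ℝ (Fin n) → ℝ) : gagliardo s D g ≤ gagliardo s D' g :=
  lintegral_mono_set h

lemma integrableOn_energy (hs : 0 < s) {g : EuclideanSpace ℝ (Fin n) → ℝ} (hg : Measurable g)
    {b : ℝ} (hb : ∀ y, |g y| ≤ b) {D : Set (EuclideanSpace ℝ (Fin n))} (hD : MeasurableSet D)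
    (h : gagliardo s D g ≠ ⊤) :
    IntegrableOn (fun X : ExtSpace n => X.snd ^ (1 - s) * ‖extGrad s g X‖ ^ 2) (cyl D) := by
  obtain ⟨K, -, hK⟩ := exists_energy_le n hs
  refine ⟨(measurable_energy hg).aestronglyMeasurable, ?_⟩
  rw [hasFiniteIntegral_iff_ofReal]
  · exact (hK g b D hg hb hD).trans_lt (ENNReal.mul_lt_top ENNReal.ofReal_lt_top h.lt_top)
  · refine (ae_restrict_iff' (measurableSet_cyl hD)).mpr (Eventually.of_forall fun X hX => ?_)
    have : 0 < X.snd := hX.2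
    dsimp only [Pi.zero_apply]; positivity

lemma cyl_univ : cyl (univ : Set (EuclideanSpace ℝ (Fin n))) = upperHalf n := by
  ext X; simp [cyl, upperHalf]

lemma integrableOn_inner {S : Set (ExtSpace n)} (hS : MeasurableSet S) (hS' : S ⊆ upperHalf n)
    {F G : ExtSpace n → ExtSpace n} (hF : Measurable F) (hG : Measurable G)
    (hFi : IntegrableOn (fun X => X.snd ^ (1 - s) * ‖F X‖ ^ 2) S)
    (hGi : IntegrableOn (fun X => X.snd ^ (1 - s) * ‖G X‖ ^ 2) S) :
    IntegrableOn (fun X => X.snd ^ (1 - s) * inner ℝ (F X) (G X)) S := by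
  refine Integrable.mono' (hFi.add hGi)
    ((measurable_snd_ext.pow_const _).mul (hF.inner hG)).aestronglyMeasurable ?_
  refine (ae_restrict_iff' hS).mpr (Eventually.of_forall fun X hX => ?_)
  have hX0 : 0 < X.snd := hS' hX
  have h1 := norm_inner_le_norm (𝕜 := ℝ) (F X) (G X)
  have h2 : 0 < X.snd ^ (1 - s) := by positivity
  rw [norm_mul, Real.norm_of_nonneg h2.le, Pi.add_apply, ← mul_add]
  refine mul_le_mul_of_nonneg_left ?_ h2.le
  nlinarith [sq_nonneg (‖F X‖ - ‖G X‖), sq_nonneg ‖F X‖, sq_nonneg ‖G X‖]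

/-! ### Cutoff functions and decay at infinity. -/

lemma exists_cutoff (n : ℕ) : ∃ (χ : ExtSpace n → ℝ) (χ' : ExtSpace n → ExtSpace n) (C : ℝ),
    ContDiff ℝ 1 χ ∧ (∀ X, HasGradientAt χ (χ' X) X) ∧ Continuous χ' ∧ (∀ X, ‖χ' X‖ ≤ C) ∧
    (∀ X, |χ X| ≤ 1) ∧
    (∀ X, ‖X‖ ≤ 1 → χ X = 1) ∧ (∀ X, 2 ≤ ‖X‖ → χ X = 0) ∧ (∀ X, ‖X‖ < 1 → χ' X = 0) ∧
    (∀ X, 2 < ‖X‖ → χ' X = 0) := by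
  let f : ContDiffBump (0 : ExtSpace n) := ⟨1, 2, one_pos, one_lt_two⟩
  have hf : ContDiff ℝ 1 f := f.contDiff
  have hg : ∀ X, HasGradientAt f (gradient f X) X := fun X =>
    (hf.differentiable one_ne_zero X).hasGradientAt
  have hc : Continuous (gradient f) :=
    (InnerProductSpace.toDual ℝ (ExtSpace n)).symm.continuous.comp
      (hf.continuous_fderiv one_ne_zero)
  have h1 : ∀ X, ‖X‖ < 1 → gradient f X = 0 := by
    intro X hX
    have : f =ᶠ[𝓝 X] fun _ => (1 : ℝ) := by
      filter_upwards [(isOpen_lt continuous_norm continuous_const).mem_nhds hX] with Y hY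
      exact f.one_of_mem_closedBall (by simpa [f] using le_of_lt hY)
    exact ((hasGradientAt_const X (1 : ℝ)).congr_of_eventuallyEq this).gradient
  have h2 : ∀ X, 2 < ‖X‖ → gradient f X = 0 := by
    intro X hX
    have : f =ᶠ[𝓝 X] fun _ => (0 : ℝ) := by
      filter_upwards [(isOpen_lt continuous_const continuous_norm).mem_nhds hX] with Y hY
      exact f.zero_of_le_dist (by simpa [f] using le_of_lt hY)
    exact ((hasGradientAt_const X (0 : ℝ)).congr_of_eventuallyEq this).gradient
  obtain ⟨C, hC⟩ := (HasCompactSupport.intro (isCompact_closedBall (0 : ExtSpace n) 2)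
    fun X hX => h2 X (by simpa using hX)).exists_bound_of_continuous hc
  refine ⟨f, gradient f, C, hf, hg, hc, hC, fun X => ?_, fun X hX => ?_, fun X hX => ?_, h1, h2⟩
  · rw [abs_of_nonneg f.nonneg]; exact f.le_one
  · exact f.one_of_mem_closedBall (by simpa [f] using hX)
  · exact f.zero_of_le_dist (by simpa [f] using hX)

/-- For `y` in the support, `|X - (y,0)| ≥ |X|/2`, and `z^s ≤ |X|^s`; the powers combine to
`|X|^{s-(n+s)} = |X|^{-n}`. -/
lemma exists_decay (hs : 0 < s) {w : EuclideanSpace ℝ (Fin n) → ℝ} {b : ℝ}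
    (hb : ∀ y, |w y| ≤ b) {ρ : ℝ} (hρ : 0 < ρ) (hw0 : ∀ x, ρ ≤ ‖x‖ → w x = 0) :
    ∃ C, 0 ≤ C ∧ ∀ X ∈ upperHalf n, 2 * ρ ≤ ‖X‖ → |csExtension s w X| ≤ C * ‖X‖ ^ (-(n : ℝ)) := by
  have hc := poissonConst_pos (n := n) hs
  have hb0 : 0 ≤ b := (abs_nonneg _).trans (hb 0)
  set V := volume.real (Metric.ball (0 : EuclideanSpace ℝ (Fin n)) ρ) with hV
  refine ⟨poissonConst n s * 2 ^ ((n : ℝ) + s) * b * V, by positivity, fun X hX hXρ => ?_⟩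
  have hX0 : 0 < X.snd := hX
  have hXn : 0 < ‖X‖ := by linarith
  set K := poissonConst n s * 2 ^ ((n : ℝ) + s) * b * ‖X‖ ^ (-(n : ℝ)) with hK
  have hbd : ∀ y, ‖baseKernel s (X - bdry y) * w y‖ ≤ (Metric.ball 0 ρ).indicator (fun _ => K) y := by
    intro y
    by_cases hy : ‖y‖ < ρ
    · rw [indicator_of_mem (by simpa using hy), norm_mul,
        Real.norm_of_nonneg (baseKernel_nonneg hs (sub_bdry_mem hX y))]
      have h1 : ‖X‖ / 2 ≤ ‖X - bdry y‖ := by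
        have h2 : ‖bdry y‖ = ‖y‖ := by
          have := norm_sq_ext (bdry y)
          simp only [bdry_fst, bdry_snd] at this
          have h3 := norm_nonneg (bdry y)
          have h4 := norm_nonneg y
          nlinarith
        have := norm_sub_norm_le X (bdry y)
        rw [h2] at this; linarith
      have h2 : (‖X - bdry y‖ ^ 2) ^ (-((n : ℝ) + s) / 2) ≤ (‖X‖ / 2) ^ (-((n : ℝ) + s)) := by
        have e : (‖X - bdry y‖ ^ 2) ^ (-((n : ℝ) + s) / 2) = ‖X - bdry y‖ ^ (-((n : ℝ) + s)) := by
          rw [← Real.rpow_natCast, ← Real.rpow_mul (norm_nonneg _)]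
          congr 1; push_cast; ring
        rw [e]
        refine Real.rpow_le_rpow_of_nonpos (by positivity) h1 ?_
        have : 0 ≤ (n : ℝ) + s := by positivity
        linarith
      have h3 : X.snd ^ s ≤ ‖X‖ ^ s :=
        Real.rpow_le_rpow hX0.le ((le_abs_self _).trans (abs_snd_le X)) hs.le
      have e1 : (X - bdry y).snd = X.snd := by simp
      have e2 : ‖X‖ ^ s * (‖X‖ / 2) ^ (-((n : ℝ) + s)) = 2 ^ ((n : ℝ) + s) * ‖X‖ ^ (-(n : ℝ)) := by
        rw [Real.div_rpow hXn.le (by norm_num), Real.rpow_neg (by norm_num : (0 : ℝ) ≤ 2),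
          div_inv_eq_mul, ← mul_assoc, ← Real.rpow_add hXn, mul_comm]
        congr 2; ring
      rw [baseKernel, e1]
      calc _ ≤ poissonConst n s * (‖X‖ ^ s * (‖X‖ / 2) ^ (-((n : ℝ) + s))) * b := by
            have := hb y
            rw [Real.norm_eq_abs]
            gcongr
        _ = K := by rw [e2, hK]; ring
    · rw [indicator_of_notMem (by simpa using hy), hw0 y (not_lt.mp hy)]; simp
  rw [csExtension_eq, ← Real.norm_eq_abs]
  refine (norm_integral_le_of_norm_le ?_ (Eventually.of_forall hbd)).trans (le_of_eq ?_)
  · exact (integrable_indicator_iff measurableSet_ball).mpr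
      (integrableOn_const measure_ball_lt_top.ne)
  · rw [integral_indicator measurableSet_ball, setIntegral_const, smul_eq_mul, hK]; ring

lemma trace_csExtension_le (hs : 0 < s) {w : EuclideanSpace ℝ (Fin n) → ℝ}
    (hw : Measurable w) {b : ℝ} (hb : ∀ y, |w y| ≤ b) {ε : ℝ} (hε : 0 < ε)
    {D : Set (EuclideanSpace ℝ (Fin n))} :
    ∫⁻ x in D, ENNReal.ofReal ((csExtension s w (pt x ε) - w x) ^ 2) ≤
      ENNReal.ofReal (poissonConst n s * 2 ^ s * 5 ^ ((n : ℝ) + s) * ε ^ s) * gagliardo s D w := by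
  rw [gagliardo, ← lintegral_const_mul' _ _ ENNReal.ofReal_ne_top]
  refine lintegral_mono fun x => ?_
  exact trace_le hs hw hb (X := pt x ε) hε (by simp; linarith) (by simp; linarith)
    (by simp; linarith)

lemma exists_bound_of_scaled_gradient {χ' : ExtSpace n → ExtSpace n} {C : ℝ}
    (hC : ∀ X, ‖χ' X‖ ≤ C) (h1 : ∀ X, ‖X‖ < 1 → χ' X = 0) (h2 : ∀ X, 2 < ‖X‖ → χ' X = 0)
    {M : ℝ} (hM : 1 ≤ M) (X : ExtSpace n) :
    ‖M⁻¹ • χ' (M⁻¹ • X)‖ ≤ 4 * C * (1 + ‖X‖)⁻¹ ∧ (‖X‖ < M → M⁻¹ • χ' (M⁻¹ • X) = 0) := by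
  have hM0 : 0 < M := by linarith
  have hC0 : 0 ≤ C := (norm_nonneg _).trans (hC 0)
  have hn : ‖M⁻¹ • X‖ = M⁻¹ * ‖X‖ := by
    rw [norm_smul, Real.norm_of_nonneg (by positivity)]
  constructor
  · by_cases hX : ‖X‖ ≤ 2 * M
    · rw [norm_smul, Real.norm_of_nonneg (by positivity)]
      have h3 : M⁻¹ ≤ 4 * (1 + ‖X‖)⁻¹ := by
        rw [← div_eq_mul_inv, le_div_iff₀ (by positivity), ← div_eq_inv_mul,
          div_le_iff₀ hM0]
        linarith
      calc M⁻¹ * ‖χ' (M⁻¹ • X)‖ ≤ (4 * (1 + ‖X‖)⁻¹) * C := by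
            have := hC (M⁻¹ • X)
            gcongr
        _ = _ := by ring
    · rw [h2, smul_zero, norm_zero]
      · positivity
      · rw [hn, ← div_eq_inv_mul, lt_div_iff₀ hM0]; linarith
  · intro hX
    rw [h1, smul_zero]
    rw [hn, ← div_eq_inv_mul, div_lt_one hM0]; exact hX

/-- The extension of `w` is not compactly supported, so the weak equation is tested with `χ(X/M)`
times the extension and `M → ∞`. The cutoff error lives where `|X| ≥ M` and is dominated using the
decay of the extension. -/
theorem integral_energy_csExtension (hs : 0 < s) (hs1 : s < 1)
    {w : EuclideanSpace ℝ (Fin n) → ℝ} (hw : Measurable w) {b : ℝ} (hb : ∀ y, |w y| ≤ b)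
    {ρ : ℝ} (hρ : 0 < ρ) (hw0 : ∀ x, ρ ≤ ‖x‖ → w x = 0) (hgag : gagliardo s univ w ≠ ⊤) :
    ∫ X in upperHalf n, X.snd ^ (1 - s) * ‖extGrad s w X‖ ^ 2 =
      poissonConst n s * s / 2 * gForm s w w := by
  obtain ⟨χ, χ', C, hχ, hχg, hχc, hC, hχ1, hχone, hχzero, hχ'1, hχ'2⟩ := exists_cutoff n
  have hC0 : 0 ≤ C := (norm_nonneg _).trans (hC 0)
  obtain ⟨K, hK0, hK⟩ := exists_decay hs hb hρ hw0
  have hE : IntegrableOn (fun X : ExtSpace n => X.snd ^ (1 - s) * ‖extGrad s w X‖ ^ 2)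
      (upperHalf n) := by
    have := integrableOn_energy hs hw hb MeasurableSet.univ hgag
    rwa [cyl_univ] at this
  set U := csExtension s w with hU
  have hUm : Measurable U := measurable_csExtension hw
  have hGm : Measurable (extGrad s w) := measurable_extGrad hw
  set T : ℝ → ExtSpace n → ℝ := fun M X => χ (M⁻¹ • X) * ‖extGrad s w X‖ ^ 2 +
    U X * inner ℝ (M⁻¹ • χ' (M⁻¹ • X)) (extGrad s w X) with hT
  have hTm : ∀ M, Measurable (T M) := by
    intro M
    have h1 : Measurable fun X : ExtSpace n => χ (M⁻¹ • X) :=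
      (hχ.continuous.comp (continuous_const_smul _)).measurable
    have h2 : Measurable fun X : ExtSpace n => M⁻¹ • χ' (M⁻¹ • X) :=
      ((hχc.comp (continuous_const_smul M⁻¹)).const_smul M⁻¹).measurable
    exact (h1.mul (hGm.norm.pow_const 2)).add (hUm.mul (h2.inner hGm))
  set bound : ExtSpace n → ℝ := fun X => 2 * (X.snd ^ (1 - s) * ‖extGrad s w X‖ ^ 2) +
    (4 * C * (K * 2 ^ (n : ℝ))) ^ 2 * (1 + ‖X‖) ^ (-(2 * (n : ℝ) + 1 + s)) with hbound
  have hboundi : IntegrableOn bound (upperHalf n) := by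
    refine (hE.const_mul 2).add (Integrable.const_mul ?_ _)
    -- The exponent is twice `n + 1` (decay `n` of the extension, `1` from the cutoff) minus the
    -- weight `1 - s`; it exceeds the dimension `n + 1`.
    refine (integrable_one_add_norm (E := ExtSpace n) ?_).integrableOn
    have : Module.finrank ℝ (ExtSpace n) = n + 1 := by
      rw [(WithLp.linearEquiv 2 ℝ (EuclideanSpace ℝ (Fin n) × ℝ)).finrank_eq]
      simp
    rw [this]; push_cast
    have : (0 : ℝ) ≤ n := n.cast_nonneg
    linarith
  have hTb : ∀ M, max 1 (2 * ρ) ≤ M → ∀ X ∈ upperHalf n,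
      ‖X.snd ^ (1 - s) * T M X‖ ≤ bound X := by
    intro M hM X hX
    have hX0 : 0 < X.snd := hX
    have hM1 : 1 ≤ M := (le_max_left _ _).trans hM
    have hM2 : 2 * ρ ≤ M := (le_max_right _ _).trans hM
    obtain ⟨h1, h2⟩ := exists_bound_of_scaled_gradient hC hχ'1 hχ'2 hM1 X
    set G := ‖extGrad s w X‖ with hG
    have ha : 0 < X.snd ^ (1 - s) := by positivity
    have h3 : |U X * inner ℝ (M⁻¹ • χ' (M⁻¹ • X)) (extGrad s w X)| ≤
        (4 * C * (K * 2 ^ (n : ℝ))) * (1 + ‖X‖) ^ (-((n : ℝ) + 1)) * G := by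
      by_cases hXM : ‖X‖ < M
      · rw [h2 hXM, inner_zero_left, mul_zero, abs_zero]; positivity
      · have hXM : M ≤ ‖X‖ := not_lt.mp hXM
        have h4 := hK X hX (hM2.trans hXM)
        have h5 : ‖X‖ ^ (-(n : ℝ)) ≤ 2 ^ (n : ℝ) * (1 + ‖X‖) ^ (-(n : ℝ)) := by
          have : (2 : ℝ) ^ (n : ℝ) * (1 + ‖X‖) ^ (-(n : ℝ)) = ((1 + ‖X‖) / 2) ^ (-(n : ℝ)) := by
            rw [Real.div_rpow (by positivity) (by norm_num),
              Real.rpow_neg (by norm_num : (0 : ℝ) ≤ 2), div_inv_eq_mul, mul_comm]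
          rw [this]
          exact Real.rpow_le_rpow_of_nonpos (by positivity) (by linarith)
            (by simp)
        have h6 := norm_inner_le_norm (𝕜 := ℝ) (M⁻¹ • χ' (M⁻¹ • X)) (extGrad s w X)
        have e : (1 + ‖X‖) ^ (-((n : ℝ) + 1)) = (1 + ‖X‖) ^ (-(n : ℝ)) * (1 + ‖X‖)⁻¹ := by
          rw [← Real.rpow_neg_one, ← Real.rpow_add (by positivity)]; congr 1; ring
        rw [abs_mul, e]
        rw [Real.norm_eq_abs] at h6
        calc _ ≤ (K * (2 ^ (n : ℝ) * (1 + ‖X‖) ^ (-(n : ℝ)))) * ((4 * C * (1 + ‖X‖)⁻¹) * G) := by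
              refine mul_le_mul (h4.trans (by gcongr)) (h6.trans (by gcongr))
                (abs_nonneg _) (by positivity)
          _ = _ := by ring
    have h4 : |χ (M⁻¹ • X) * G ^ 2| ≤ G ^ 2 := by
      rw [abs_mul, abs_of_nonneg (sq_nonneg G)]
      exact mul_le_of_le_one_left (sq_nonneg _) (hχ1 _)
    have h5 : X.snd ^ (1 - s) ≤ (1 + ‖X‖) ^ (1 - s) := by
      refine Real.rpow_le_rpow hX0.le ?_ (by linarith)
      linarith [(le_abs_self _).trans (abs_snd_le X)]
    set A := 4 * C * (K * 2 ^ (n : ℝ)) with hA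
    have h6 : A * (1 + ‖X‖) ^ (-((n : ℝ) + 1)) * G ≤
        G ^ 2 + (A * (1 + ‖X‖) ^ (-((n : ℝ) + 1))) ^ 2 := by
      nlinarith [sq_nonneg (A * (1 + ‖X‖) ^ (-((n : ℝ) + 1)) - G),
        sq_nonneg (A * (1 + ‖X‖) ^ (-((n : ℝ) + 1))), sq_nonneg G]
    have h7 : ((1 + ‖X‖) ^ (-((n : ℝ) + 1))) ^ 2 * (1 + ‖X‖) ^ (1 - s) =
        (1 + ‖X‖) ^ (-(2 * (n : ℝ) + 1 + s)) := by
      rw [← Real.rpow_mul_natCast (by positivity), ← Real.rpow_add (by positivity)]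
      congr 1; push_cast; ring
    rw [norm_mul, Real.norm_of_nonneg ha.le, Real.norm_eq_abs, hbound]
    dsimp only
    rw [← h7]
    calc X.snd ^ (1 - s) * |T M X| ≤ X.snd ^ (1 - s) *
          (G ^ 2 + (G ^ 2 + (A * (1 + ‖X‖) ^ (-((n : ℝ) + 1))) ^ 2)) := by
          refine mul_le_mul_of_nonneg_left ?_ ha.le
          exact (abs_add_le _ _).trans (add_le_add h4 (h3.trans h6))
      _ = 2 * (X.snd ^ (1 - s) * G ^ 2) + A ^ 2 * ((1 + ‖X‖) ^ (-((n : ℝ) + 1))) ^ 2 *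
          X.snd ^ (1 - s) := by ring
      _ ≤ 2 * (X.snd ^ (1 - s) * G ^ 2) + A ^ 2 * ((1 + ‖X‖) ^ (-((n : ℝ) + 1))) ^ 2 *
          (1 + ‖X‖) ^ (1 - s) := by gcongr
      _ = _ := by ring
  have hlim : Tendsto (fun M => ∫ X in upperHalf n, X.snd ^ (1 - s) * T M X) atTop
      (𝓝 (∫ X in upperHalf n, X.snd ^ (1 - s) * ‖extGrad s w X‖ ^ 2)) := by
    refine tendsto_integral_filter_of_dominated_convergence bound ?_ ?_ hboundi ?_
    · exact Eventually.of_forall fun M =>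
        ((measurable_snd_ext.pow_const _).mul (hTm M)).aestronglyMeasurable
    · filter_upwards [eventually_ge_atTop (max 1 (2 * ρ))] with M hM
      exact (ae_restrict_iff' measurableSet_upperHalf).mpr (Eventually.of_forall (hTb M hM))
    · refine Eventually.of_forall fun X => ?_
      refine tendsto_const_nhds.congr' ?_
      filter_upwards [eventually_ge_atTop 1, eventually_gt_atTop ‖X‖] with M hM1 hMX
      have hM0 : 0 < M := by linarith
      have h1 := (exists_bound_of_scaled_gradient hC hχ'1 hχ'2 hM1 X).2 hMX
      have h2 : χ (M⁻¹ • X) = 1 := by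
        apply hχone
        rw [norm_smul, Real.norm_of_nonneg (by positivity), ← div_eq_inv_mul, div_le_one hM0]
        exact hMX.le
      simp only [hT, h1, h2, inner_zero_left, mul_zero, add_zero, one_mul]
  refine tendsto_nhds_unique hlim (tendsto_const_nhds.congr' ?_)
  -- `M ≥ ρ + 1` makes the cutoff equal to `1` at heights below one over the support of `w`, so it
  -- does not disturb the trace there.
  filter_upwards [eventually_ge_atTop (max 1 (2 * ρ)), eventually_ge_atTop (ρ + 1)] with M hM hM2
  have hM1 : 1 ≤ M := (le_max_left _ _).trans hM
  have hM0 : 0 < M := by linarith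
  have hn : ∀ X : ExtSpace n, ‖M⁻¹ • X‖ = M⁻¹ * ‖X‖ := fun X => by
    rw [norm_smul, Real.norm_of_nonneg (by positivity)]
  set W : ExtSpace n → ℝ := fun X => χ (M⁻¹ • X) * U X with hWdef
  have hχM : ∀ X, HasGradientAt (fun X => χ (M⁻¹ • X)) (M⁻¹ • χ' (M⁻¹ • X)) X := by
    intro X
    rw [hasGradientAt_iff_hasFDerivAt]
    have h := (hχg (M⁻¹ • X)).hasFDerivAt.comp X ((hasFDerivAt_id X).const_smul M⁻¹)
    refine h.congr_fderiv ?_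
    ext Y; simp
  have hWg : ∀ X ∈ upperHalf n,
      gradient W X = χ (M⁻¹ • X) • extGrad s w X + U X • (M⁻¹ • χ' (M⁻¹ • X)) := by
    intro X hX
    apply HasGradientAt.gradient
    rw [hasGradientAt_iff_hasFDerivAt]
    have h := (hχM X).hasFDerivAt.mul (hasGradientAt_csExtension hs hw hb hX).hasFDerivAt
    refine h.congr_fderiv ?_
    simp only [map_add, map_smul, hU]
  have hWT : ∀ X ∈ upperHalf n,
      X.snd ^ (1 - s) * inner ℝ (gradient W X) (extGrad s w X) = X.snd ^ (1 - s) * T M X := by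
    intro X hX
    rw [hWg X hX, inner_add_left, inner_smul_left, inner_smul_left _ _ (U X),
      real_inner_self_eq_norm_sq, hT]
    simp
  have hWc : ContDiffOn ℝ 1 W (upperHalf n) :=
    (hχ.comp (contDiff_const_smul M⁻¹)).contDiffOn.mul (contDiffOn_csExtension hs hw hb)
  have key := weak_equation hs hw hb hw hb (W := W) (ρ := 2 * M) hWc
    (fun X _ hXM => by
      have : χ (M⁻¹ • X) = 0 := by
        apply hχzero
        rw [hn, ← div_eq_inv_mul, le_div_iff₀ hM0]; exact hXM
      simp [hWdef, this])
    (fun x hx => hw0 x (by linarith))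
    (integrable_formDensity_self hw hgag)
    (ne_top_of_le_ne_top hgag (gagliardo_mono (subset_univ _) w))
    (by
      refine IntegrableOn.congr_fun (f := fun X => X.snd ^ (1 - s) * T M X) ?_
        (fun X hX => (hWT X hX).symm) measurableSet_upperHalf
      exact hboundi.mono' ((measurable_snd_ext.pow_const _).mul (hTm M)).aestronglyMeasurable
        ((ae_restrict_iff' measurableSet_upperHalf).mpr (Eventually.of_forall (hTb M hM))))
    one_pos
    (C := poissonConst n s * 2 ^ s * 5 ^ ((n : ℝ) + s) * (gagliardo s univ w).toReal)
    (by
      intro ε hε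
      have hε0 := hε.1
      have hc := poissonConst_pos (n := n) hs
      have h1 := trace_csExtension_le hs hw hb hε.1 (D := univ)
      rw [setLIntegral_univ] at h1
      refine le_trans (lintegral_mono fun x => ENNReal.ofReal_le_ofReal ?_) (h1.trans
        (le_of_eq ?_))
      · by_cases hx : ‖x‖ < ρ
        · have : χ (M⁻¹ • pt x ε) = 1 := by
            apply hχone
            rw [hn, ← div_eq_inv_mul, div_le_one hM0]
            have h2 := norm_sq_ext (pt x ε)
            simp only [pt_fst, pt_snd] at h2
            have h3 : ‖pt x ε‖ ≤ ‖x‖ + ε := by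
              nlinarith [norm_nonneg (pt x ε), norm_nonneg x]
            linarith [hε.2]
          simp only [hWdef, this, one_mul]; exact le_rfl
        · simp only [hWdef, hw0 x (not_lt.mp hx), sub_zero, mul_pow]
          refine mul_le_of_le_one_left (sq_nonneg _) ?_
          rw [← sq_abs]
          exact pow_le_one₀ (abs_nonneg _) (hχ1 _)
      · rw [mul_right_comm _ (gagliardo s univ w).toReal, ENNReal.ofReal_mul (by positivity)
          (q := (gagliardo s univ w).toReal), ENNReal.ofReal_toReal hgag])
  rw [← key]
  exact setIntegral_congr_fun measurableSet_upperHalf hWT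

/-- The weak equation gives the pairing of `∇W` with the gradient of the extension of `w` the same
value as the energy of that extension. Expanding the nonnegative energy of their difference then
shows that the extension has least energy for its trace. -/
theorem trace_inequality (hs : 0 < s) (hs1 : s < 1) {w : EuclideanSpace ℝ (Fin n) → ℝ}
    (hw : Measurable w) {b : ℝ} (hb : ∀ y, |w y| ≤ b) {W : ExtSpace n → ℝ} {ρ : ℝ} (hρ : 0 < ρ)
    (hW : ContDiffOn ℝ 1 W (upperHalf n)) (hW0 : ∀ X ∈ upperHalf n, ρ ≤ ‖X‖ → W X = 0)
    (hw0 : ∀ x, ρ ≤ ‖x‖ → w x = 0) (hgag : gagliardo s univ w ≠ ⊤)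
    (hWint : IntegrableOn (fun X => X.snd ^ (1 - s) * ‖gradient W X‖ ^ 2) (upperHalf n))
    {C ε₀ : ℝ} (hε₀ : 0 < ε₀) (htr : ∀ ε ∈ Ioo 0 ε₀,
      ∫⁻ x, ENNReal.ofReal ((W (pt x ε) - w x) ^ 2) ≤ ENNReal.ofReal (C * ε ^ s)) :
    poissonConst n s * s / 2 * gForm s w w ≤
      ∫ X in upperHalf n, X.snd ^ (1 - s) * ‖gradient W X‖ ^ 2 := by
  have hE : IntegrableOn (fun X : ExtSpace n => X.snd ^ (1 - s) * ‖extGrad s w X‖ ^ 2)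
      (upperHalf n) := by
    have := integrableOn_energy hs hw hb MeasurableSet.univ hgag
    rwa [cyl_univ] at this
  have hI := integrableOn_inner measurableSet_upperHalf subset_rfl (measurable_gradient W)
    (measurable_extGrad hw) hWint hE
  have h1 := weak_equation hs hw hb hw hb hW hW0 hw0 (integrable_formDensity_self hw hgag)
    (ne_top_of_le_ne_top hgag (gagliardo_mono (subset_univ _) w)) hI hε₀ htr
  have h2 := integral_energy_csExtension hs hs1 hw hb hρ hw0 hgag
  have h3 : 0 ≤ ∫ X in upperHalf n, (X.snd ^ (1 - s) * ‖gradient W X‖ ^ 2 +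
      X.snd ^ (1 - s) * ‖extGrad s w X‖ ^ 2 -
      2 * (X.snd ^ (1 - s) * inner ℝ (gradient W X) (extGrad s w X))) := by
    refine setIntegral_nonneg measurableSet_upperHalf fun X hX => ?_
    have hX0 : 0 < X.snd := hX
    have e := norm_sub_sq_real (gradient W X) (extGrad s w X)
    have : 0 ≤ X.snd ^ (1 - s) * ‖gradient W X - extGrad s w X‖ ^ 2 := by positivity
    rw [e] at this
    linarith
  rw [integral_sub (by exact hWint.add hE) (hI.const_mul 2), integral_add hWint hE, integral_const_mul,
    h1, h2] at h3
  linarith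

/-! ### The local energy and the Gagliardo form -/

/-- The pairs of points at least one of which lies in `Ω`. -/
def crossRegion (Ω : Set (EuclideanSpace ℝ (Fin n))) :
    Set (EuclideanSpace ℝ (Fin n) × EuclideanSpace ℝ (Fin n)) := {q | q.1 ∈ Ω ∨ q.2 ∈ Ω}

lemma measurableSet_crossRegion {Ω : Set (EuclideanSpace ℝ (Fin n))} (hΩ : MeasurableSet Ω) :
    MeasurableSet (crossRegion Ω) :=
  (measurable_fst hΩ).union (measurable_snd hΩ)

/-- The interaction kernel on pairs of points. -/
def pairKernel (s : ℝ) (q : EuclideanSpace ℝ (Fin n) × EuclideanSpace ℝ (Fin n)) : ENNReal :=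
  ENNReal.ofReal (1 / ‖q.1 - q.2‖ ^ ((n : ℝ) + s))

lemma measurable_pairKernel : Measurable (pairKernel (n := n) s) := by
  unfold pairKernel; fun_prop

lemma interaction_eq_lintegral {A B : Set (EuclideanSpace ℝ (Fin n))} (hA : MeasurableSet A)
    (hB : MeasurableSet B) :
    interaction s A B = ∫⁻ q, (A ×ˢ B).indicator (pairKernel s) q ∂(volume.prod volume) := by
  rw [lintegral_indicator (hA.prod hB), ← Measure.prod_restrict,
    lintegral_prod _ measurable_pairKernel.aemeasurable]
  rfl

lemma interaction_symm {A B : Set (EuclideanSpace ℝ (Fin n))} (hA : MeasurableSet A)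
    (hB : MeasurableSet B) : interaction s A B = interaction s B A := by
  rw [interaction_eq_lintegral hA hB, interaction_eq_lintegral hB hA, ← lintegral_prod_swap]
  refine lintegral_congr fun q => ?_
  have h : pairKernel s q.swap = pairKernel s q := by
    simp only [pairKernel, Prod.fst_swap, Prod.snd_swap, norm_sub_rev]
  by_cases hq : q.1 ∈ B ∧ q.2 ∈ A
  · rw [indicator_of_mem (show q.swap ∈ A ×ˢ B from ⟨hq.2, hq.1⟩),
      indicator_of_mem (show q ∈ B ×ˢ A from hq), h]
  · rw [indicator_of_notMem (show q.swap ∉ A ×ˢ B from fun h => hq ⟨h.2, h.1⟩),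
      indicator_of_notMem (show q ∉ B ×ˢ A from hq)]

lemma signChar_of_mem {E : Set (EuclideanSpace ℝ (Fin n))} {x : EuclideanSpace ℝ (Fin n)}
    (h : x ∈ E) : signChar E x = 1 := by simp [signChar, h]

lemma signChar_of_notMem {E : Set (EuclideanSpace ℝ (Fin n))} {x : EuclideanSpace ℝ (Fin n)}
    (h : x ∉ E) : signChar E x = -1 := by simp [signChar, h]

lemma abs_signChar_le (E : Set (EuclideanSpace ℝ (Fin n))) (x : EuclideanSpace ℝ (Fin n)) :
    |signChar E x| ≤ 1 := by
  by_cases h : x ∈ E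
  · simp [signChar_of_mem h]
  · simp [signChar_of_notMem h]

lemma measurable_signChar {E : Set (EuclideanSpace ℝ (Fin n))} (hE : MeasurableSet E) :
    Measurable (signChar E) :=
  (measurable_const.indicator hE).sub (measurable_const.indicator hE.compl)

/-- The squared difference of signs is `4` for points on opposite sides of `E` and `0` otherwise;
ordered pairs count each interaction twice, hence `8`. -/
lemma lintegral_crossRegion {E Ω : Set (EuclideanSpace ℝ (Fin n))} (hE : MeasurableSet E)
    (hΩ : MeasurableSet Ω) :
    ∫⁻ q in crossRegion Ω, ENNReal.ofReal (formDensity s (signChar E) (signChar E) q)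
      ∂(volume.prod volume) = 8 * localEnergy s Ω E := by
  have h1 : (8 : ENNReal) * localEnergy s Ω E =
      4 * (interaction s (E ∩ Ω) Eᶜ + interaction s (E \ Ω) (Eᶜ ∩ Ω) +
        (interaction s Eᶜ (E ∩ Ω) + interaction s (Eᶜ ∩ Ω) (E \ Ω))) := by
    rw [interaction_symm hE.compl (hE.inter hΩ),
      interaction_symm (hE.compl.inter hΩ) (hE.diff hΩ), localEnergy]
    ring
  have hm := measurable_pairKernel (n := n) (s := s)
  have m1 := (hE.inter hΩ).prod hE.compl
  have m2 := (hE.diff hΩ).prod (hE.compl.inter hΩ)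
  have m3 := hE.compl.prod (hE.inter hΩ)
  have m4 := (hE.compl.inter hΩ).prod (hE.diff hΩ)
  rw [h1, interaction_eq_lintegral (hE.inter hΩ) hE.compl,
    interaction_eq_lintegral (hE.diff hΩ) (hE.compl.inter hΩ),
    interaction_eq_lintegral hE.compl (hE.inter hΩ),
    interaction_eq_lintegral (hE.compl.inter hΩ) (hE.diff hΩ),
    ← lintegral_add_left (hm.indicator m1), ← lintegral_add_left (hm.indicator m3),
    ← lintegral_add_left (f := fun q => ((E ∩ Ω) ×ˢ Eᶜ).indicator (pairKernel s) q +
      ((E \ Ω) ×ˢ (Eᶜ ∩ Ω)).indicator (pairKernel s) q)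
      ((hm.indicator m1).add (hm.indicator m2)),
    ← lintegral_const_mul' _ _ (by norm_num),
    ← lintegral_indicator (measurableSet_crossRegion hΩ)]
  refine lintegral_congr fun q => ?_
  have key : ENNReal.ofReal (4 / ‖q.1 - q.2‖ ^ ((n : ℝ) + s)) = 4 * pairKernel s q := by
    rw [pairKernel, show (4 : ENNReal) = ENNReal.ofReal 4 by simp,
      ← ENNReal.ofReal_mul (by norm_num)]
    congr 1; ring
  have hp : ∀ A B : Set (EuclideanSpace ℝ (Fin n)), (A ×ˢ B).indicator (pairKernel s) q =
      A.indicator 1 q.1 * B.indicator 1 q.2 * pairKernel s q := by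
    intro A B
    by_cases h1 : q.1 ∈ A <;> by_cases h2 : q.2 ∈ B <;> simp [indicator, h1, h2]
  have hc : ∀ f : EuclideanSpace ℝ (Fin n) × EuclideanSpace ℝ (Fin n) → ENNReal,
      (crossRegion Ω).indicator f q = (Ω.indicator 1 q.1 + Ωᶜ.indicator 1 q.1 *
        Ω.indicator 1 q.2) * f q := by
    intro f
    by_cases h1 : q.1 ∈ Ω <;> by_cases h2 : q.2 ∈ Ω <;> simp [indicator, h1, h2, crossRegion]
  rw [hp, hp, hp, hp, hc, formDensity_self]
  -- On each of the sixteen cells both sides are explicit multiples of the pair kernel.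
  by_cases a1 : q.1 ∈ E <;> by_cases a2 : q.2 ∈ E <;> by_cases a3 : q.1 ∈ Ω <;>
    by_cases a4 : q.2 ∈ Ω <;> simp [signChar, a1, a2, a3, a4] <;> norm_num [key]

lemma integrableOn_crossRegion {E Ω : Set (EuclideanSpace ℝ (Fin n))} (hE : MeasurableSet E)
    (hΩ : MeasurableSet Ω) (hfin : localEnergy s Ω E ≠ ⊤) :
    IntegrableOn (formDensity s (signChar E) (signChar E)) (crossRegion Ω)
      (volume.prod volume) := by
  have hm := measurable_signChar hE
  refine ⟨(measurable_formDensity hm hm).aestronglyMeasurable, ?_⟩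
  rw [hasFiniteIntegral_iff_ofReal, lintegral_crossRegion hE hΩ]
  · exact ENNReal.mul_lt_top (by norm_num) hfin.lt_top
  · refine Eventually.of_forall fun q => ?_
    rw [formDensity_self]
    dsimp only [Pi.zero_apply]; positivity

lemma integral_crossRegion {E Ω : Set (EuclideanSpace ℝ (Fin n))} (hE : MeasurableSet E)
    (hΩ : MeasurableSet Ω) :
    ∫ q in crossRegion Ω, formDensity s (signChar E) (signChar E) q ∂(volume.prod volume) =
      8 * (localEnergy s Ω E).toReal := by
  have hm := measurable_signChar hE
  rw [integral_eq_lintegral_of_nonneg_ae, lintegral_crossRegion hE hΩ, ENNReal.toReal_mul]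
  · norm_num
  · refine Eventually.of_forall fun q => ?_
    rw [formDensity_self]
    dsimp only [Pi.zero_apply]; positivity
  · exact (measurable_formDensity hm hm).aestronglyMeasurable

lemma gagliardo_le_localEnergy {E Ω : Set (EuclideanSpace ℝ (Fin n))} (hE : MeasurableSet E)
    (hΩ : MeasurableSet Ω) : gagliardo s Ω (signChar E) ≤ 8 * localEnergy s Ω E := by
  have hm := measurable_signChar hE
  rw [← lintegral_crossRegion hE hΩ]
  have h : gagliardo s Ω (signChar E) = ∫⁻ q in Ω ×ˢ univ,
      ENNReal.ofReal (formDensity s (signChar E) (signChar E) q) ∂(volume.prod volume) := by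
    rw [← Measure.prod_restrict, lintegral_prod _
      (measurable_formDensity hm hm).ennreal_ofReal.aemeasurable, gagliardo, Measure.restrict_univ]
    simp_rw [formDensity_self]
  rw [h]
  exact lintegral_mono_set fun q hq => Or.inl hq.1

/-! ### Competitors that agree with `E` outside `Ω`. -/

section competitor

variable {E F Ω : Set (EuclideanSpace ℝ (Fin n))}

lemma signChar_eq_of_eqOn_compl (h : F ∩ Ωᶜ = E ∩ Ωᶜ) {x : EuclideanSpace ℝ (Fin n)} (hx : x ∉ Ω) :
    signChar F x = signChar E x := by
  have : x ∈ F ↔ x ∈ E := by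
    have := Set.ext_iff.mp h x
    simpa [hx] using this
  by_cases h : x ∈ E
  · rw [signChar_of_mem h, signChar_of_mem (this.mpr h)]
  · rw [signChar_of_notMem h, signChar_of_notMem (fun h' => h (this.mp h'))]

lemma formDensity_diff_le (h : F ∩ Ωᶜ = E ∩ Ωᶜ)
    (q : EuclideanSpace ℝ (Fin n) × EuclideanSpace ℝ (Fin n)) :
    formDensity s (fun x => signChar F x - signChar E x) (fun x => signChar F x - signChar E x) q ≤
      (crossRegion Ω).indicator (fun q => 2 * formDensity s (signChar F) (signChar F) q +
        2 * formDensity s (signChar E) (signChar E) q) q := by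
  by_cases hq : q ∈ crossRegion Ω
  · rw [indicator_of_mem hq]
    simp only [formDensity]
    rw [← mul_div_assoc, ← mul_div_assoc, ← add_div]
    refine div_le_div_of_nonneg_right ?_ (by positivity)
    nlinarith [sq_nonneg ((signChar F q.1 - signChar F q.2) + (signChar E q.1 - signChar E q.2))]
  · rw [indicator_of_notMem hq]
    have h1 : q.1 ∉ Ω := fun h => hq (Or.inl h)
    have h2 : q.2 ∉ Ω := fun h => hq (Or.inr h)
    simp [formDensity, signChar_eq_of_eqOn_compl h h1, signChar_eq_of_eqOn_compl h h2]

/-- The difference of the sign functions vanishes outside `Ω`, so its form density lives on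
`crossRegion Ω`, where the two local energies control it. This gives a global bound from purely
local energies. -/
lemma gagliardo_diff_ne_top (hE : MeasurableSet E) (hF : MeasurableSet F) (hΩ : MeasurableSet Ω)
    (h : F ∩ Ωᶜ = E ∩ Ωᶜ) (hEf : localEnergy s Ω E ≠ ⊤) (hFf : localEnergy s Ω F ≠ ⊤) :
    gagliardo s univ (fun x => signChar F x - signChar E x) ≠ ⊤ := by
  have hm : Measurable (fun x => signChar F x - signChar E x) :=
    (measurable_signChar hF).sub (measurable_signChar hE)
  rw [← lintegral_formDensity_self hm]
  have hi : Integrable ((crossRegion Ω).indicator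
      (fun q => 2 * formDensity s (signChar F) (signChar F) q +
        2 * formDensity s (signChar E) (signChar E) q)) (volume.prod volume) :=
    (integrable_indicator_iff (measurableSet_crossRegion hΩ)).mpr
      (((integrableOn_crossRegion hF hΩ hFf).const_mul 2).add
        ((integrableOn_crossRegion hE hΩ hEf).const_mul 2))
  refine ne_top_of_le_ne_top hi.lintegral_lt_top.ne (lintegral_mono fun q => ?_)
  exact ENNReal.ofReal_le_ofReal (formDensity_diff_le h q)

lemma integrable_formDensity_diff (hE : MeasurableSet E) (hF : MeasurableSet F)
    (hΩ : MeasurableSet Ω)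
    (h : F ∩ Ωᶜ = E ∩ Ωᶜ) (hEf : localEnergy s Ω E ≠ ⊤) (hFf : localEnergy s Ω F ≠ ⊤) :
    Integrable (formDensity s (fun x => signChar F x - signChar E x) (signChar E))
      (volume.prod volume) := by
  have hm : Measurable (fun x => signChar F x - signChar E x) :=
    (measurable_signChar hF).sub (measurable_signChar hE)
  have h1 := integrable_formDensity_self hm (gagliardo_diff_ne_top hE hF hΩ h hEf hFf)
  have h2 := (integrable_indicator_iff (measurableSet_crossRegion hΩ)).mpr
    (integrableOn_crossRegion hE hΩ hEf)
  refine (h1.add h2).mono'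
    (measurable_formDensity hm (measurable_signChar hE)).aestronglyMeasurable
    (Eventually.of_forall fun q => ?_)
  by_cases hq : q ∈ crossRegion Ω
  · simp only [Pi.add_apply, indicator_of_mem hq, formDensity]
    rw [← add_div, norm_div, Real.norm_of_nonneg (r := ‖q.1 - q.2‖ ^ ((n : ℝ) + s)) (by positivity)]
    refine div_le_div_of_nonneg_right ?_ (by positivity)
    rw [Real.norm_eq_abs, abs_le]
    constructor <;> nlinarith [
      sq_nonneg ((signChar F q.1 - signChar E q.1 - (signChar F q.2 - signChar E q.2)) +
        (signChar E q.1 - signChar E q.2)),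
      sq_nonneg ((signChar F q.1 - signChar E q.1 - (signChar F q.2 - signChar E q.2)) -
        (signChar E q.1 - signChar E q.2)),
      sq_nonneg (signChar F q.1 - signChar E q.1 - (signChar F q.2 - signChar E q.2)),
      sq_nonneg (signChar E q.1 - signChar E q.2)]
  · have h1 : q.1 ∉ Ω := fun h => hq (Or.inl h)
    have h2 : q.2 ∉ Ω := fun h => hq (Or.inr h)
    simp [formDensity, signChar_eq_of_eqOn_compl h h1, signChar_eq_of_eqOn_compl h h2,
      indicator_of_notMem hq]

/-- With `v = u + w`, the density of `v` minus that of `u` is the density of `w` plus twice the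
mixed one, and everything involving `w` vanishes off `crossRegion Ω`. -/
lemma gForm_diff (hE : MeasurableSet E) (hF : MeasurableSet F) (hΩ : MeasurableSet Ω)
    (h : F ∩ Ωᶜ = E ∩ Ωᶜ) (hEf : localEnergy s Ω E ≠ ⊤) (hFf : localEnergy s Ω F ≠ ⊤) :
    gForm s (fun x => signChar F x - signChar E x) (fun x => signChar F x - signChar E x) +
      2 * gForm s (fun x => signChar F x - signChar E x) (signChar E) =
      8 * ((localEnergy s Ω F).toReal - (localEnergy s Ω E).toReal) := by
  have hm : Measurable (fun x => signChar F x - signChar E x) :=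
    (measurable_signChar hF).sub (measurable_signChar hE)
  have h1 := integrable_formDensity_self hm (gagliardo_diff_ne_top hE hF hΩ h hEf hFf)
  have h2 := integrable_formDensity_diff hE hF hΩ h hEf hFf
  rw [mul_sub, ← integral_crossRegion hF hΩ, ← integral_crossRegion hE hΩ,
    ← integral_sub (integrableOn_crossRegion hF hΩ hFf) (integrableOn_crossRegion hE hΩ hEf),
    ← integral_indicator (measurableSet_crossRegion hΩ), gForm, gForm, ← integral_const_mul,
    ← integral_add (by exact h1) (h2.const_mul 2)]
  refine integral_congr_ae (Eventually.of_forall fun q => ?_)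
  by_cases hq : q ∈ crossRegion Ω
  · simp only [indicator_of_mem hq, formDensity]; ring
  · have h1 : q.1 ∉ Ω := fun h => hq (Or.inl h)
    have h2 : q.2 ∉ Ω := fun h => hq (Or.inr h)
    simp [formDensity, signChar_eq_of_eqOn_compl h h1, signChar_eq_of_eqOn_compl h h2,
      indicator_of_notMem hq]

end competitor

/-! ### Minimality of the extension in the half-ball. -/

lemma halfBall_subset_cyl (r : ℝ) :
    halfBall n r ⊆ cyl (Metric.ball (0 : EuclideanSpace ℝ (Fin n)) r) := fun X hX => by
  refine ⟨?_, hX.2⟩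
  have h1 : ‖X‖ < r := by simpa using hX.1
  simpa using (norm_fst_le X).trans_lt h1

lemma measurableSet_halfBall (r : ℝ) : MeasurableSet (halfBall n r) :=
  measurableSet_ball.inter measurableSet_upperHalf

/-- Put `W = V - U` and `w = signChar F - signChar E`. The energy of `V` exceeds that of `U` by the
energy of `W` plus twice the cross term. The first is at least `(c s / 2) gForm w w`, the cross term
equals `(c s / 2) gForm w u`, and `gForm w w + 2 gForm w u` is eight times the increase of the local
energy, which is nonnegative. -/
theorem energy_le_competitor (hs : 0 < s) (hs1 : s < 1) {E F : Set (EuclideanSpace ℝ (Fin n))}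
    (hE : MeasurableSet E) (hF : MeasurableSet F) {ρ R : ℝ} (hρ : 0 < ρ) (hρR : ρ < R)
    (hFE : ∀ x : EuclideanSpace ℝ (Fin n), ρ ≤ ‖x‖ → (x ∈ F ↔ x ∈ E))
    (hEf : localEnergy s (Metric.ball 0 R) E ≠ ⊤) (hFf : localEnergy s (Metric.ball 0 R) F ≠ ⊤)
    (hmin : localEnergy s (Metric.ball 0 R) E ≤ localEnergy s (Metric.ball 0 R) F)
    {V : ExtSpace n → ℝ} (hV : ContDiffOn ℝ 1 V (upperHalf n))
    (hVU : ∀ X ∈ upperHalf n, ρ ≤ ‖X‖ → V X = csExtension s (signChar E) X)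
    (hVint : IntegrableOn (fun X => X.snd ^ (1 - s) * ‖gradient V X‖ ^ 2) (halfBall n R))
    {C ε₀ : ℝ} (hε₀ : 0 < ε₀) (htr : ∀ ε ∈ Ioo 0 ε₀,
      ∫⁻ x in Metric.ball 0 ρ, ENNReal.ofReal ((V (pt x ε) - signChar F x) ^ 2) ≤
        ENNReal.ofReal (C * ε ^ s)) :
    ∫ X in halfBall n R, X.snd ^ (1 - s) * ‖extGrad s (signChar E) X‖ ^ 2 ≤
      ∫ X in halfBall n R, X.snd ^ (1 - s) * ‖gradient V X‖ ^ 2 := by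
  set u := signChar E with hu
  set v := signChar F with hv
  set w : EuclideanSpace ℝ (Fin n) → ℝ := fun x => v x - u x with hw
  set U := csExtension s u with hU
  set W : ExtSpace n → ℝ := fun X => V X - U X with hWdef
  have hum : Measurable u := measurable_signChar hE
  have hub : ∀ y, |u y| ≤ 1 := abs_signChar_le E
  have hwm : Measurable w := (measurable_signChar hF).sub hum
  have hwb : ∀ y, |w y| ≤ 2 := fun y =>
    (abs_sub _ _).trans (by linarith [hub y, abs_signChar_le F y])
  have hFE' : F ∩ (Metric.ball 0 R)ᶜ = E ∩ (Metric.ball 0 R)ᶜ := by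
    ext x
    simp only [mem_inter_iff, mem_compl_iff, Metric.mem_ball, dist_zero_right, not_lt]
    refine and_congr_left fun hx => hFE x (by linarith)
  have hw0 : ∀ x, ρ ≤ ‖x‖ → w x = 0 := by
    intro x hx
    by_cases h : x ∈ E
    · simp [hw, hu, hv, signChar_of_mem h, signChar_of_mem ((hFE x hx).mpr h)]
    · simp [hw, hu, hv, signChar_of_notMem h, signChar_of_notMem (fun h' => h ((hFE x hx).mp h'))]
  have hgR : gagliardo s (Metric.ball 0 R) u ≠ ⊤ :=
    ne_top_of_le_ne_top (ENNReal.mul_ne_top (by norm_num) hEf)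
      (gagliardo_le_localEnergy hE measurableSet_ball)
  have hgρ : gagliardo s (Metric.ball 0 ρ) u ≠ ⊤ :=
    ne_top_of_le_ne_top hgR (gagliardo_mono (Metric.ball_subset_ball hρR.le) u)
  have hgw : gagliardo s univ w ≠ ⊤ :=
    gagliardo_diff_ne_top hE hF measurableSet_ball hFE' hEf hFf
  have hWc : ContDiffOn ℝ 1 W (upperHalf n) := hV.sub (contDiffOn_csExtension hs hum hub)
  have hW0 : ∀ X ∈ upperHalf n, ρ ≤ ‖X‖ → W X = 0 := fun X hX h => by
    simp [hWdef, hVU X hX h]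
  have hgrad : ∀ X ∈ upperHalf n, gradient W X = gradient V X - extGrad s u X := by
    intro X hX
    refine HasGradientAt.gradient ?_
    rw [hasGradientAt_iff_hasFDerivAt, map_sub]
    exact (hasGradientAt_of_contDiffOn hV hX).hasFDerivAt.sub
      (hasGradientAt_csExtension hs hum hub hX).hasFDerivAt
  have hUint : IntegrableOn (fun X : ExtSpace n => X.snd ^ (1 - s) * ‖extGrad s u X‖ ^ 2)
      (halfBall n R) :=
    (integrableOn_energy hs hum hub measurableSet_ball hgR).mono_set (halfBall_subset_cyl R)
  have hhs : halfBall n R ⊆ upperHalf n := inter_subset_right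
  have hout : ∀ X ∈ upperHalf n \ halfBall n R, gradient W X = 0 := by
    intro X hX
    refine gradient_eq_zero hW0 hX.1 ?_
    have : R ≤ ‖X‖ := by
      by_contra h
      exact hX.2 ⟨by simpa using lt_of_not_ge h, hX.1⟩
    linarith
  have hVUi := integrableOn_inner (measurableSet_halfBall R) hhs (measurable_gradient V)
    (measurable_extGrad hum) hVint hUint
  have hWi : IntegrableOn (fun X => X.snd ^ (1 - s) * ‖gradient W X‖ ^ 2) (upperHalf n) := by
    refine IntegrableOn.of_forall_sdiff_eq_zero (s := halfBall n R) ?_ measurableSet_upperHalf ?_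
    · refine (((hVint.add hUint).sub (hVUi.const_mul 2)).congr_fun ?_ (measurableSet_halfBall R))
      intro X hX
      simp only [Pi.add_apply, Pi.sub_apply]
      rw [hgrad X (hhs hX), @norm_sub_sq_real]
      ring
    · intro X hX
      simp [hout X hX]
  have hWUi : IntegrableOn (fun X => X.snd ^ (1 - s) * inner ℝ (gradient W X) (extGrad s u X))
      (upperHalf n) := by
    refine IntegrableOn.of_forall_sdiff_eq_zero (s := halfBall n R) ?_ measurableSet_upperHalf ?_
    · exact integrableOn_inner (measurableSet_halfBall R) hhs (measurable_gradient W)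
        (measurable_extGrad hum) (hWi.mono_set hhs) hUint
    · intro X hX
      simp [hout X hX]
  set K := poissonConst n s * 2 ^ s * 5 ^ ((n : ℝ) + s) with hK
  have hK0 : 0 ≤ K := by have := poissonConst_pos (n := n) hs; positivity
  set G := (gagliardo s (Metric.ball 0 ρ) u).toReal with hG
  -- The trace error of `W` is the difference of those of `V` and `U`: the former is assumed of
  -- order `ε^s`, the latter is so by `trace_csExtension_le`.
  have htrW : ∀ ε ∈ Ioo 0 ε₀, ∫⁻ x, ENNReal.ofReal ((W (pt x ε) - w x) ^ 2) ≤
      ENNReal.ofReal ((2 * max C 0 + 2 * (K * G)) * ε ^ s) := by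
    intro ε hε
    have hε0 : 0 < ε := hε.1
    have hsupp : ∫⁻ x, ENNReal.ofReal ((W (pt x ε) - w x) ^ 2) =
        ∫⁻ x in Metric.ball 0 ρ, ENNReal.ofReal ((W (pt x ε) - w x) ^ 2) := by
      rw [← lintegral_indicator measurableSet_ball]
      refine lintegral_congr fun x => ?_
      by_cases hx : x ∈ Metric.ball (0 : EuclideanSpace ℝ (Fin n)) ρ
      · rw [indicator_of_mem hx]
      · have hx' : ρ ≤ ‖x‖ := by simpa using hx
        rw [indicator_of_notMem hx, hw0 x hx', hW0 _ (show 0 < (pt x ε).snd by simpa using hε0)]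
        · simp
        · exact hx'.trans (by simpa using norm_fst_le (pt x ε))
    rw [hsupp]
    have h1 := htr ε hε
    have h2 := trace_csExtension_le hs hum hub hε0 (D := Metric.ball 0 ρ)
    have hUm : Measurable fun x => csExtension s u (pt x ε) - u x :=
      ((measurable_csExtension hum).comp
        (continuous_pt.comp (continuous_id.prodMk continuous_const)).measurable).sub hum
    calc ∫⁻ x in Metric.ball 0 ρ, ENNReal.ofReal ((W (pt x ε) - w x) ^ 2)
        ≤ ∫⁻ x in Metric.ball 0 ρ, (2 * ENNReal.ofReal ((V (pt x ε) - v x) ^ 2) +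
            2 * ENNReal.ofReal ((csExtension s u (pt x ε) - u x) ^ 2)) := by
          refine lintegral_mono fun x => ?_
          rw [show (2 : ENNReal) = ENNReal.ofReal 2 by simp, ← ENNReal.ofReal_mul (by norm_num),
            ← ENNReal.ofReal_mul (by norm_num), ← ENNReal.ofReal_add (by positivity)
            (by positivity)]
          refine ENNReal.ofReal_le_ofReal ?_
          simp only [hWdef, hw, hU]
          nlinarith [sq_nonneg ((V (pt x ε) - v x) + (csExtension s u (pt x ε) - u x))]
      _ = 2 * (∫⁻ x in Metric.ball 0 ρ, ENNReal.ofReal ((V (pt x ε) - v x) ^ 2)) +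
            2 * ∫⁻ x in Metric.ball 0 ρ,
              ENNReal.ofReal ((csExtension s u (pt x ε) - u x) ^ 2) := by
          rw [lintegral_add_right _ ((hUm.pow_const 2).ennreal_ofReal.const_mul 2),
            lintegral_const_mul' _ _ (by norm_num), lintegral_const_mul' _ _ (by norm_num)]
      _ ≤ 2 * ENNReal.ofReal (max C 0 * ε ^ s) + 2 * (ENNReal.ofReal (K * ε ^ s) *
            ENNReal.ofReal G) := by
          gcongr
          · refine h1.trans (ENNReal.ofReal_le_ofReal ?_)
            gcongr; exact le_max_left _ _
          · rw [hG, ENNReal.ofReal_toReal hgρ]; exact h2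
      _ = ENNReal.ofReal ((2 * max C 0 + 2 * (K * G)) * ε ^ s) := by
          have hG0 : 0 ≤ G := ENNReal.toReal_nonneg
          have hm : 0 ≤ max C 0 := le_max_right _ _
          rw [show (2 : ENNReal) = ENNReal.ofReal 2 by simp,
            ← ENNReal.ofReal_mul (by positivity), ← ENNReal.ofReal_mul (by positivity),
            ← ENNReal.ofReal_mul (by positivity), ← ENNReal.ofReal_add (by positivity)
            (by positivity)]
          congr 1; ring
  have e1 := weak_equation hs hum hub hwm hwb hWc hW0 hw0
    (integrable_formDensity_diff hE hF measurableSet_ball hFE' hEf hFf) hgρ hWUi hε₀ htrW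
  have e2 := trace_inequality hs hs1 hwm hwb hρ hWc hW0 hw0 hgw hWi hε₀ htrW
  have e3 := gForm_diff hE hF measurableSet_ball hFE' hEf hFf
  have e4 : (localEnergy s (Metric.ball 0 R) E).toReal ≤
      (localEnergy s (Metric.ball 0 R) F).toReal := ENNReal.toReal_mono hFf hmin
  have e5 : ∫ X in halfBall n R, X.snd ^ (1 - s) * ‖gradient V X‖ ^ 2 =
      (∫ X in halfBall n R, X.snd ^ (1 - s) * ‖extGrad s u X‖ ^ 2) +
      ((∫ X in upperHalf n, X.snd ^ (1 - s) * ‖gradient W X‖ ^ 2) +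
      2 * ∫ X in upperHalf n, X.snd ^ (1 - s) * inner ℝ (gradient W X) (extGrad s u X)) := by
    rw [setIntegral_eq_of_subset_of_forall_sdiff_eq_zero
        (f := fun X => X.snd ^ (1 - s) * ‖gradient W X‖ ^ 2) measurableSet_upperHalf hhs
        (fun X hX => by simp [hout X hX]),
      setIntegral_eq_of_subset_of_forall_sdiff_eq_zero
        (f := fun X => X.snd ^ (1 - s) * inner ℝ (gradient W X) (extGrad s u X))
        measurableSet_upperHalf hhs (fun X hX => by simp [hout X hX]),
      ← integral_const_mul, ← integral_add (hWi.mono_set hhs) ((hWUi.mono_set hhs).const_mul 2),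
      ← integral_add hUint (by exact (hWi.mono_set hhs).add ((hWUi.mono_set hhs).const_mul 2))]
    refine setIntegral_congr_fun (measurableSet_halfBall R) fun X hX => ?_
    have h : gradient V X = extGrad s u X + gradient W X := by
      rw [hgrad X (hhs hX)]; abel
    rw [h, @norm_add_sq_real, real_inner_comm (gradient W X)]
    ring
  have hκ : 0 < poissonConst n s * s / 2 := by have := poissonConst_pos (n := n) hs; positivity
  have e6 : 0 ≤ poissonConst n s * s / 2 * (gForm s w w + 2 * gForm s w u) := by
    rw [e3]
    exact mul_nonneg hκ.le (by linarith)
  rw [e5, e1]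
  linarith

/-! ### Radial deformations -/

section radial

variable {H : Type*} [NormedAddCommGroup H] [InnerProductSpace ℝ H] {η : ℝ → ℝ} {ρ : ℝ}

/-- The radial map with the profile `1 + η`. -/
def radialMap (η : ℝ → ℝ) (X : H) : H := (1 + η (‖X‖ ^ 2)) • X

/-- The derivative of the displacement `η(|X|²) X`. -/
def radialDispDeriv (η : ℝ → ℝ) (X : H) : H →L[ℝ] H :=
  η (‖X‖ ^ 2) • ContinuousLinearMap.id ℝ H +
    (2 * deriv η (‖X‖ ^ 2)) • (innerSL ℝ X).smulRight X

/-- The derivative of `radialMap η`. -/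
def radialDeriv (η : ℝ → ℝ) (X : H) : H →L[ℝ] H :=
  ContinuousLinearMap.id ℝ H + radialDispDeriv η X

lemma radialDeriv_apply (X v : H) : radialDeriv η X v =
    (1 + η (‖X‖ ^ 2)) • v + (2 * deriv η (‖X‖ ^ 2) * inner ℝ X v) • X := by
  simp only [radialDeriv, radialDispDeriv, add_apply,
    ContinuousLinearMap.id_apply, smul_apply,
    ContinuousLinearMap.smulRight_apply, innerSL_apply_apply]
  module

/-- A radial profile that is small in `C¹` and vanishes outside the ball of radius `ρ`. -/
structure IsSmallProfile (η : ℝ → ℝ) (ρ : ℝ) : Prop where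
  contDiff : ContDiff ℝ 1 η
  abs_le : ∀ q, 0 ≤ q → |η q| ≤ 1 / 8
  abs_deriv_le : ∀ q, 0 ≤ q → |2 * q * deriv η q| ≤ 1 / 4
  eq_zero : ∀ q, ρ ^ 2 ≤ q → η q = 0

lemma IsSmallProfile.bounds (h : IsSmallProfile η ρ) {q : ℝ} (hq : 0 ≤ q) :
    7 / 8 ≤ 1 + η q ∧ 1 + η q ≤ 9 / 8 ∧ 5 / 8 ≤ 1 + η q + 2 * q * deriv η q ∧
      1 + η q + 2 * q * deriv η q ≤ 11 / 8 := by
  have h1 := _root_.abs_le.mp (h.abs_le q hq)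
  have h2 := _root_.abs_le.mp (h.abs_deriv_le q hq)
  refine ⟨?_, ?_, ?_, ?_⟩ <;> linarith [h1.1, h1.2, h2.1, h2.2]

lemma hasFDerivAt_radialDisp (hη : ContDiff ℝ 1 η) (X : H) :
    HasFDerivAt (fun X : H => η (‖X‖ ^ 2) • X) (radialDispDeriv η X) X := by
  have h1 : HasFDerivAt (fun X : H => ‖X‖ ^ 2) (2 • innerSL ℝ X) X :=
    (hasStrictFDerivAt_norm_sq X).hasFDerivAt
  have h2 : HasDerivAt η (deriv η (‖X‖ ^ 2)) (‖X‖ ^ 2) :=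
    (hη.differentiable one_ne_zero).differentiableAt.hasDerivAt
  refine ((h2.comp_hasFDerivAt X h1).smul (hasFDerivAt_id X)).congr_fderiv ?_
  ext v
  simp [radialDispDeriv]
  module

lemma hasFDerivAt_radialMap (hη : ContDiff ℝ 1 η) (X : H) :
    HasFDerivAt (radialMap η) (radialDeriv η X) X := by
  refine ((hasFDerivAt_id X).add (hasFDerivAt_radialDisp hη X)).congr_of_eventuallyEq ?_
  exact Eventually.of_forall fun Y => by simp [radialMap, add_smul]

lemma contDiff_radialMap (hη : ContDiff ℝ 1 η) : ContDiff ℝ 1 (radialMap η : H → H) :=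
  (contDiff_const.add (hη.comp (contDiff_id.norm_sq ℝ))).smul contDiff_id

lemma radialMap_of_le (h : IsSmallProfile η ρ) {X : H} (hρ : 0 ≤ ρ) (hX : ρ ≤ ‖X‖) :
    radialMap η X = X := by
  simp [radialMap, h.eq_zero (‖X‖ ^ 2) (by gcongr)]

/-- `3/8 = 1/8 + 1/4`, one summand for each of the two bounds in `IsSmallProfile`. Being below `1`,
it makes `radialMap η` a Lipschitz perturbation of the identity, hence a homeomorphism. -/
lemma norm_radialDispDeriv_le (h : IsSmallProfile η ρ) (X : H) :
    ‖radialDispDeriv η X‖ ≤ 3 / 8 := by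
  refine ContinuousLinearMap.opNorm_le_bound _ (by norm_num) fun v => ?_
  have h1 := h.abs_le (‖X‖ ^ 2) (by positivity)
  have h2 := h.abs_deriv_le (‖X‖ ^ 2) (by positivity)
  have h3 := abs_real_inner_le_norm X v
  simp only [radialDispDeriv, add_apply, ContinuousLinearMap.id_apply,
    smul_apply, ContinuousLinearMap.smulRight_apply, innerSL_apply_apply]
  calc _ ≤ ‖η (‖X‖ ^ 2) • v‖ + ‖(2 * deriv η (‖X‖ ^ 2)) • (inner ℝ X v : ℝ) • X‖ :=
        norm_add_le _ _
    _ = |η (‖X‖ ^ 2)| * ‖v‖ + |2 * deriv η (‖X‖ ^ 2)| * (|inner ℝ X v| * ‖X‖) := by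
        simp [norm_smul, abs_mul]
    _ ≤ |η (‖X‖ ^ 2)| * ‖v‖ + |2 * deriv η (‖X‖ ^ 2)| * (‖X‖ * ‖v‖ * ‖X‖) := by gcongr
    _ = |η (‖X‖ ^ 2)| * ‖v‖ + |2 * ‖X‖ ^ 2 * deriv η (‖X‖ ^ 2)| * ‖v‖ := by
        rw [mul_right_comm 2 (‖X‖ ^ 2), abs_mul _ (‖X‖ ^ 2), abs_of_nonneg (sq_nonneg ‖X‖)]; ring
    _ ≤ 1 / 8 * ‖v‖ + 1 / 4 * ‖v‖ := by gcongr
    _ = 3 / 8 * ‖v‖ := by ring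

lemma norm_radialMap_sub_sub_le (h : IsSmallProfile η ρ) (X Y : H) :
    ‖radialMap η X - radialMap η Y - (X - Y)‖ ≤ 3 / 8 * ‖X - Y‖ := by
  have h1 : LipschitzWith (3 / 8) (fun X : H => η (‖X‖ ^ 2) • X) := by
    refine lipschitzWith_of_nnnorm_fderiv_le (𝕜 := ℝ)
      (fun X => (hasFDerivAt_radialDisp h.contDiff X).differentiableAt) fun X => ?_
    rw [(hasFDerivAt_radialDisp h.contDiff X).fderiv, ← NNReal.coe_le_coe]
    simpa using norm_radialDispDeriv_le h X
  have h2 := h1.norm_sub_le X Y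
  refine le_of_eq_of_le (congrArg _ ?_) (h2.trans_eq (by simp))
  simp only [radialMap, add_smul, one_smul]
  abel

/-- The map contracts distances by at worst `1 - 3/8 = 5/8`, which is more than `1/2`. -/
lemma norm_sub_le_radialMap (h : IsSmallProfile η ρ) (X Y : H) :
    ‖X - Y‖ ≤ 2 * ‖radialMap η X - radialMap η Y‖ := by
  have h1 := norm_radialMap_sub_sub_le h X Y
  have h2 := norm_sub_norm_le (X - Y) (radialMap η X - radialMap η Y)
  rw [norm_sub_rev (X - Y)] at h2
  linarith [norm_nonneg (radialMap η X - radialMap η Y)]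

variable [FiniteDimensional ℝ H]

/-- The derivative is a multiple of a transvection in the direction `X`: it stretches tangentially
by `1 + η` and radially by `1 + η + 2|X|²η'`. Writing the result with a quotient avoids the exponent
`finrank - 1`. -/
lemma det_radialDeriv {X : H} (h : 1 + η (‖X‖ ^ 2) ≠ 0) :
    (radialDeriv η X).det = (1 + η (‖X‖ ^ 2)) ^ Module.finrank ℝ H *
      ((1 + η (‖X‖ ^ 2) + 2 * ‖X‖ ^ 2 * deriv η (‖X‖ ^ 2)) / (1 + η (‖X‖ ^ 2))) := by
  have : ((radialDeriv η X : H →L[ℝ] H) : H →ₗ[ℝ] H) = (1 + η (‖X‖ ^ 2)) •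
      LinearMap.transvection ((2 * deriv η (‖X‖ ^ 2) / (1 + η (‖X‖ ^ 2))) •
        (innerSL ℝ X : H →ₗ[ℝ] ℝ)) X := by
    ext v
    simp only [ContinuousLinearMap.coe_coe, radialDeriv_apply, LinearMap.smul_apply,
      LinearMap.transvection.apply, smul_add, smul_smul, innerSL_apply_apply, smul_eq_mul]
    congr 2
    field_simp
  rw [ContinuousLinearMap.det, this, LinearMap.det_smul, LinearMap.transvection.det]
  simp only [LinearMap.smul_apply, ContinuousLinearMap.coe_coe, innerSL_apply_apply, smul_eq_mul,
    real_inner_self_eq_norm_sq]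
  field_simp

lemma IsSmallProfile.det_pos (h : IsSmallProfile η ρ) (X : H) : 0 < (radialDeriv η X).det := by
  obtain ⟨h1, h2, h3, h4⟩ := h.bounds (sq_nonneg ‖X‖)
  rw [det_radialDeriv (by linarith)]
  exact mul_pos (pow_pos (by linarith) _) (div_pos (by linarith) (by linarith))

lemma IsSmallProfile.det_le (h : IsSmallProfile η ρ) (X : H) :
    (radialDeriv η X).det ≤ 2 ^ (Module.finrank ℝ H + 1) := by
  obtain ⟨h1, h2, h3, h4⟩ := h.bounds (sq_nonneg ‖X‖)
  rw [det_radialDeriv (by linarith), pow_succ (2 : ℝ)]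
  have h5 : 0 ≤ 1 + η (‖X‖ ^ 2) := by linarith
  refine mul_le_mul (pow_le_pow_left₀ h5 (by linarith) _) ?_
    (div_nonneg (by linarith) (by linarith)) (by positivity)
  rw [div_le_iff₀ (by linarith)]
  linarith

/-- The homeomorphism `radialMap η`. -/
def radialHomeo (h : IsSmallProfile η ρ) : H ≃ₜ H :=
  ApproximatesLinearOn.toHomeomorph (radialMap η : H → H)
    (f' := ContinuousLinearEquiv.refl ℝ H) (c := 3 / 8)
    (fun X _ Y _ => by
      simpa using norm_radialMap_sub_sub_le h X Y) (by
    rcases subsingleton_or_nontrivial H with h' | h'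
    · exact Or.inl h'
    · right
      have : ‖((ContinuousLinearEquiv.refl ℝ H).symm : H →L[ℝ] H)‖₊ = 1 := by
        simp [ContinuousLinearMap.nnnorm_id]
      rw [this, ← NNReal.coe_lt_coe]
      norm_num)

@[simp] lemma radialHomeo_apply (h : IsSmallProfile η ρ) (X : H) :
    radialHomeo h X = radialMap η X := rfl

lemma contDiff_radialHomeo_symm (h : IsSmallProfile η ρ) :
    ContDiff ℝ 1 ((radialHomeo h : H ≃ₜ H).symm : H → H) := by
  refine Homeomorph.contDiff_symm (𝕜 := ℝ) _ (f₀' := fun X =>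
    (radialDeriv η X).toContinuousLinearEquivOfDetNeZero (h.det_pos X).ne') (fun X => ?_)
    (contDiff_radialMap h.contDiff)
  rw [ContinuousLinearMap.coe_toContinuousLinearEquivOfDetNeZero]
  exact hasFDerivAt_radialMap h.contDiff X

lemma radialHomeo_symm_of_le (h : IsSmallProfile η ρ) {X : H} (hρ : 0 ≤ ρ) (hX : ρ ≤ ‖X‖) :
    (radialHomeo h).symm X = X := by
  rw [Homeomorph.symm_apply_eq, radialHomeo_apply, radialMap_of_le h hρ hX]

/-- The map and its inverse both fix every point of norm at least `ρ`, so no point can cross the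
sphere of radius `r`. -/
lemma norm_radialMap_lt_iff (h : IsSmallProfile η ρ) (hρ : 0 ≤ ρ) {r : ℝ} (hr : ρ ≤ r) {X : H} :
    ‖radialMap η X‖ < r ↔ ‖X‖ < r := by
  constructor
  · intro h1
    by_contra h2
    rw [radialMap_of_le h hρ (hr.trans (not_lt.mp h2))] at h1
    exact h2 h1
  · intro h1
    by_contra h2
    have h3 := radialHomeo_symm_of_le h hρ (hr.trans (not_lt.mp h2))
    rw [← radialHomeo_apply h, Homeomorph.symm_apply_apply, radialHomeo_apply] at h3
    rw [← h3] at h2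
    exact h2 h1

lemma radialHomeo_image_ball (h : IsSmallProfile η ρ) (hρ : 0 ≤ ρ) {r : ℝ} (hr : ρ ≤ r) :
    radialMap η '' Metric.ball (0 : H) r = Metric.ball 0 r := by
  ext Y
  constructor
  · rintro ⟨X, hX, rfl⟩
    simpa [norm_radialMap_lt_iff h hρ hr] using hX
  · intro hY
    refine ⟨(radialHomeo h).symm Y, ?_, (radialHomeo h).apply_symm_apply Y⟩
    rw [mem_ball_zero_iff, ← norm_radialMap_lt_iff h hρ hr, ← radialHomeo_apply h,
      Homeomorph.apply_symm_apply]
    simpa using hY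

variable [MeasurableSpace H] [BorelSpace H] {μ : Measure H} [μ.IsAddHaarMeasure]

lemma lintegral_radialMap_image_le (h : IsSmallProfile η ρ) {A : Set H} (hA : MeasurableSet A)
    (f : H → ENNReal) : ∫⁻ x in radialMap η '' A, f x ∂μ ≤
      2 ^ (Module.finrank ℝ H + 1) * ∫⁻ x in A, f (radialMap η x) ∂μ := by
  rw [lintegral_image_eq_lintegral_abs_det_fderiv_mul μ hA
    (fun X _ => (hasFDerivAt_radialMap h.contDiff X).hasFDerivWithinAt)
    (radialHomeo h).injective.injOn, ← lintegral_const_mul' _ _ (by finiteness)]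
  refine lintegral_mono fun X => ?_
  gcongr
  rw [abs_of_pos (h.det_pos X)]
  refine (ENNReal.ofReal_le_ofReal (h.det_le X)).trans_eq ?_
  rw [ENNReal.ofReal_pow (by norm_num)]
  simp

end radial

/-! ### Finiteness of the local energy -/

/-- With `δ = R - |x|`, every `y` outside the ball has `|x - y| ≥ δ`, so `|x - y|²` is at least half
of `|x - y|² + δ²`. The kernel is thus bounded by the radial profile at height `δ`, whose mass is
known. -/
lemma lintegral_compl_ball_le (hs : 0 < s) {x : EuclideanSpace ℝ (Fin n)} {R : ℝ} (hx : ‖x‖ < R) :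
    ∫⁻ y in (Metric.ball 0 R)ᶜ, ENNReal.ofReal (1 / ‖x - y‖ ^ ((n : ℝ) + s)) ≤
      ENNReal.ofReal (2 ^ (((n : ℝ) + s) / 2) * radMass n s * (R - ‖x‖) ^ (-s)) := by
  have hδ : 0 < R - ‖x‖ := by linarith
  have hp : 0 < (n : ℝ) + s := by positivity
  calc ∫⁻ y in (Metric.ball 0 R)ᶜ, ENNReal.ofReal (1 / ‖x - y‖ ^ ((n : ℝ) + s))
      ≤ ∫⁻ y in (Metric.ball 0 R)ᶜ, ENNReal.ofReal (2 ^ (((n : ℝ) + s) / 2) *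
          (‖x - y‖ ^ 2 + (R - ‖x‖) ^ 2) ^ (-((n : ℝ) + s) / 2)) := by
        refine setLIntegral_mono' measurableSet_ball.compl fun y hy => ?_
        refine ENNReal.ofReal_le_ofReal ?_
        have hy' : R ≤ ‖y‖ := by simpa using hy
        have h1 : R - ‖x‖ ≤ ‖x - y‖ := by
          have := norm_sub_norm_le y x
          rw [norm_sub_rev]; linarith
        have h2 : 0 < ‖x - y‖ := by linarith
        have h3 : (R - ‖x‖) ^ 2 ≤ ‖x - y‖ ^ 2 := by gcongr
        rw [neg_div, Real.rpow_neg (by positivity), ← div_eq_mul_inv,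
          ← Real.div_rpow (by norm_num) (by positivity), one_div, ← Real.rpow_neg h2.le]
        have h4 : ‖x - y‖ ^ (-((n : ℝ) + s)) = (1 / ‖x - y‖ ^ 2) ^ (((n : ℝ) + s) / 2) := by
          rw [one_div, ← Real.rpow_natCast, ← Real.rpow_neg h2.le, ← Real.rpow_mul h2.le]
          congr 1; push_cast; ring
        rw [h4]
        refine Real.rpow_le_rpow (by positivity) ?_ (by positivity)
        rw [div_le_div_iff₀ (by positivity) (by positivity)]
        linarith
    _ ≤ ∫⁻ y, ENNReal.ofReal (2 ^ (((n : ℝ) + s) / 2) *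
          (‖x - y‖ ^ 2 + (R - ‖x‖) ^ 2) ^ (-((n : ℝ) + s) / 2)) := setLIntegral_le_lintegral _ _
    _ = ENNReal.ofReal (2 ^ (((n : ℝ) + s) / 2) * radMass n s * (R - ‖x‖) ^ (-s)) := by
        rw [← ofReal_integral_eq_lintegral_ofReal
          (((integrable_rad hδ hs).comp_sub_left x).const_mul _)
          (Eventually.of_forall fun y => by dsimp only [Pi.zero_apply]; positivity),
          integral_const_mul, integral_sub_left_eq_self (fun y : EuclideanSpace ℝ (Fin n) =>
            (‖y‖ ^ 2 + (R - ‖x‖) ^ 2) ^ (-((n : ℝ) + s) / 2)) volume x, integral_rad hδ]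
        congr 1; ring

/-- In polar coordinates the singularity at the sphere is the one-dimensional power `-s`, integrable
because `s < 1`. The condition `n ≥ 1` makes the space nontrivial, as polar coordinates require. -/
lemma integrableOn_ball_rpow (hn : 1 ≤ n) (hs1 : s < 1) (R : ℝ) :
    IntegrableOn (fun x : EuclideanSpace ℝ (Fin n) => (R - ‖x‖) ^ (-s)) (Metric.ball 0 R) := by
  have : Nonempty (Fin n) := ⟨⟨0, hn⟩⟩
  rw [← integrable_indicator_iff measurableSet_ball]
  have h1 : (Metric.ball (0 : EuclideanSpace ℝ (Fin n)) R).indicator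
      (fun x : EuclideanSpace ℝ (Fin n) => (R - ‖x‖) ^ (-s)) =
      fun x => (Iio R).indicator (fun r => (R - r) ^ (-s)) ‖x‖ := by
    ext x
    by_cases hx : ‖x‖ < R
    · rw [indicator_of_mem (by simpa using hx), indicator_of_mem (by exact hx)]
    · rw [indicator_of_notMem (by simpa using hx), indicator_of_notMem (by exact hx)]
  rw [h1, integrable_fun_norm_addHaar volume]
  have h2 : IntegrableOn (fun r : ℝ => (R - r) ^ (-s)) (Ioc 0 R) := by
    rcases le_or_gt R 0 with hR | hR
    · simp [Ioc_eq_empty_of_le hR]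
    · rw [← intervalIntegrable_iff_integrableOn_Ioc_of_le hR.le]
      have := (intervalIntegral.intervalIntegrable_rpow' (a := 0) (b := R) (r := -s)
        (by linarith)).comp_sub_left R
      simpa using this.symm
  rw [← integrable_indicator_iff measurableSet_Ioi]
  have h3 : Integrable ((Ioc 0 R).indicator fun r : ℝ => R ^ (n - 1) * (R - r) ^ (-s)) :=
    (integrable_indicator_iff measurableSet_Ioc).mpr (h2.const_mul _)
  refine h3.mono' (by
    refine (Measurable.indicator ?_ measurableSet_Ioi).aestronglyMeasurable
    refine (measurable_id.pow_const _).smul (Measurable.indicator ?_ measurableSet_Iio)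
    exact (measurable_const.sub measurable_id).pow_const _) (Eventually.of_forall fun r => ?_)
  by_cases hr : 0 < r ∧ r < R
  · rw [indicator_of_mem (show r ∈ Ioi 0 from hr.1), indicator_of_mem (show r ∈ Iio R from hr.2),
      indicator_of_mem (show r ∈ Ioc 0 R from ⟨hr.1, hr.2.le⟩)]
    have h4 : 0 < R - r := by linarith [hr.2]
    have h5 : 0 < r := hr.1
    rw [smul_eq_mul, Real.norm_of_nonneg (by positivity), finrank_euclideanSpace_fin]
    gcongr
    exact hr.2.le
  · have h4 : (Ioi (0 : ℝ)).indicator (fun y => y ^ (Module.finrank ℝ (EuclideanSpace ℝ (Fin n)) - 1) •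
        (Iio R).indicator (fun r => (R - r) ^ (-s)) y) r = 0 := by
      by_cases h0 : 0 < r
      · rw [indicator_of_mem (show r ∈ Ioi 0 from h0),
          indicator_of_notMem (show r ∉ Iio R from fun h => hr ⟨h0, h⟩), smul_zero]
      · rw [indicator_of_notMem (show r ∉ Ioi 0 from h0)]
    rw [h4, norm_zero]
    refine indicator_nonneg (fun r hr => ?_) r
    have : 0 ≤ R - r := by linarith [hr.2]
    have : 0 ≤ R := by linarith [hr.1, hr.2]
    positivity

lemma interaction_ball_compl_ne_top (hn : 1 ≤ n) (hs : 0 < s) (hs1 : s < 1) (R : ℝ) :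
    interaction s (Metric.ball (0 : EuclideanSpace ℝ (Fin n)) R) (Metric.ball 0 R)ᶜ ≠ ⊤ := by
  have h := (integrableOn_ball_rpow hn hs1 R).const_mul (2 ^ (((n : ℝ) + s) / 2) * radMass n s)
  refine ne_top_of_le_ne_top h.lintegral_lt_top.ne ?_
  exact setLIntegral_mono' measurableSet_ball fun x hx =>
    lintegral_compl_ball_le hs (by simpa using hx)

lemma interaction_mono {A A' B B' : Set (EuclideanSpace ℝ (Fin n))} (hA : A ⊆ A') (hB : B ⊆ B') :
    interaction s A B ≤ interaction s A' B' :=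
  (lintegral_mono fun _ => lintegral_mono_set hB).trans (lintegral_mono_set hA)

/-- Emptying the ball leaves only interactions between the ball and its complement. This competitor
shows that a minimizer has finite local energy. -/
lemma localEnergy_diff_ball_ne_top (hn : 1 ≤ n) (hs : 0 < s) (hs1 : s < 1) (R : ℝ)
    {E : Set (EuclideanSpace ℝ (Fin n))} :
    localEnergy s (Metric.ball 0 R) (E \ Metric.ball 0 R) ≠ ⊤ := by
  have h1 : interaction s (E \ Metric.ball 0 R ∩ Metric.ball 0 R) (E \ Metric.ball 0 R)ᶜ = 0 := by
    have : E \ Metric.ball (0 : EuclideanSpace ℝ (Fin n)) R ∩ Metric.ball 0 R = ∅ :=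
      sdiff_inter_self
    simp [interaction, this]
  have h2 := interaction_ball_compl_ne_top hn hs hs1 R
  rw [interaction_symm measurableSet_ball measurableSet_ball.compl] at h2
  rw [localEnergy, h1, zero_add]
  exact ne_top_of_le_ne_top h2 (interaction_mono (fun x hx => hx.2) inter_subset_right)

/-! ### Deformed sets -/

section deform

variable {η : ℝ → ℝ} {ρ : ℝ}

/-- Changing variables costs one Jacobian bound in each variable, and distances shrink by at most a
factor `2`, which costs `2^{n+s}` in the kernel. -/
lemma interaction_radialMap_le (hs : 0 < s) (h : IsSmallProfile η ρ)
    {A B : Set (EuclideanSpace ℝ (Fin n))} (hA : MeasurableSet A) (hB : MeasurableSet B) :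
    interaction s (radialMap η '' A) (radialMap η '' B) ≤
      2 ^ (n + 1) * 2 ^ (n + 1) * ENNReal.ofReal (2 ^ ((n : ℝ) + s)) * interaction s A B := by
  have hp : 0 < (n : ℝ) + s := by positivity
  refine (lintegral_radialMap_image_le h hA _).trans ?_
  rw [finrank_euclideanSpace_fin, mul_assoc, mul_assoc]
  refine mul_le_mul_right ?_ _
  rw [interaction, ← lintegral_const_mul' _ _ (by finiteness),
    ← lintegral_const_mul' _ _ (by finiteness)]
  refine lintegral_mono fun x => (lintegral_radialMap_image_le h hB _).trans ?_
  rw [finrank_euclideanSpace_fin]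
  refine mul_le_mul_right ?_ _
  rw [← lintegral_const_mul' _ _ (by finiteness)]
  refine lintegral_mono fun y => ?_
  rw [← ENNReal.ofReal_mul (by positivity)]
  refine ENNReal.ofReal_le_ofReal ?_
  rcases eq_or_ne x y with rfl | hxy
  · simp [Real.zero_rpow hp.ne']
  · have h1 := norm_sub_le_radialMap h x y
    have h2 : 0 < ‖x - y‖ := norm_pos_iff.mpr (sub_ne_zero.mpr hxy)
    have h3 : 0 < ‖radialMap η x - radialMap η y‖ := by linarith
    rw [mul_one_div, div_le_div_iff₀ (by positivity) (by positivity), one_mul,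
      ← Real.mul_rpow (by norm_num) h3.le]
    gcongr

lemma localEnergy_radialMap_ne_top (hs : 0 < s) (h : IsSmallProfile η ρ) (hρ : 0 ≤ ρ) {R : ℝ}
    (hR : ρ ≤ R) {E : Set (EuclideanSpace ℝ (Fin n))} (hE : MeasurableSet E)
    (hfin : localEnergy s (Metric.ball 0 R) E ≠ ⊤) :
    localEnergy s (Metric.ball 0 R) (radialMap η '' E) ≠ ⊤ := by
  have hinj : Function.Injective (radialMap η : EuclideanSpace ℝ (Fin n) → _) :=
    (radialHomeo h).injective
  have hbij : Function.Bijective (radialMap η : EuclideanSpace ℝ (Fin n) → _) :=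
    (radialHomeo h).bijective
  rw [localEnergy, ← radialHomeo_image_ball (H := EuclideanSpace ℝ (Fin n)) h hρ hR,
    ← image_inter hinj, ← image_compl_eq hbij, ← image_sdiff hinj, ← image_inter hinj]
  rw [localEnergy, ENNReal.add_ne_top] at hfin
  refine ENNReal.add_ne_top.mpr ⟨?_, ?_⟩
  · exact ne_top_of_le_ne_top (ENNReal.mul_ne_top (by finiteness) hfin.1)
      (interaction_radialMap_le hs h (hE.inter measurableSet_ball) hE.compl)
  · exact ne_top_of_le_ne_top (ENNReal.mul_ne_top (by finiteness) hfin.2)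
      (interaction_radialMap_le hs h (hE.diff measurableSet_ball)
        (hE.compl.inter measurableSet_ball))

lemma measurableSet_radialMap_image (h : IsSmallProfile η ρ)
    {E : Set (EuclideanSpace ℝ (Fin n))} (hE : MeasurableSet E) :
    MeasurableSet (radialMap η '' E) :=
  ((radialHomeo h).measurableEmbedding.measurableSet_image).mpr hE

lemma mem_radialMap_image_iff (h : IsSmallProfile η ρ) {E : Set (EuclideanSpace ℝ (Fin n))}
    {x : EuclideanSpace ℝ (Fin n)} : x ∈ radialMap η '' E ↔ (radialHomeo h).symm x ∈ E := by
  constructor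
  · rintro ⟨y, hy, rfl⟩
    rwa [← radialHomeo_apply h, Homeomorph.symm_apply_apply]
  · intro hx
    exact ⟨_, hx, (radialHomeo h).apply_symm_apply x⟩

lemma signChar_radialMap_image (h : IsSmallProfile η ρ) (E : Set (EuclideanSpace ℝ (Fin n)))
    (x : EuclideanSpace ℝ (Fin n)) :
    signChar (radialMap η '' E) x = signChar E ((radialHomeo h).symm x) := by
  by_cases hx : x ∈ radialMap η '' E
  · rw [signChar_of_mem hx, signChar_of_mem ((mem_radialMap_image_iff h).mp hx)]
  · rw [signChar_of_notMem hx, signChar_of_notMem fun h' => hx ((mem_radialMap_image_iff h).mpr h')]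

lemma radialMap_snd (X : ExtSpace n) : (radialMap η X).snd = (1 + η (‖X‖ ^ 2)) * X.snd := by
  simp [radialMap]

lemma norm_bdry (x : EuclideanSpace ℝ (Fin n)) : ‖bdry x‖ = ‖x‖ := by
  have h : ‖bdry x‖ ^ 2 = ‖x‖ ^ 2 := by rw [norm_sq_ext]; simp
  exact (sq_eq_sq₀ (norm_nonneg _) (norm_nonneg _)).mp h

/-- The same profile deforms the half-space and its boundary, so transporting the extension by the
one transports the trace by the other. -/
lemma radialMap_bdry (x : EuclideanSpace ℝ (Fin n)) :
    radialMap η (bdry x) = bdry (radialMap η x) := by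
  rw [radialMap, radialMap, norm_bdry]
  refine (WithLp.ofLp_injective 2) (Prod.ext ?_ ?_)
  · rfl
  · exact mul_zero _

lemma radialMap_mem_upperHalf_iff (h : IsSmallProfile η ρ) {X : ExtSpace n} :
    radialMap η X ∈ upperHalf n ↔ X ∈ upperHalf n := by
  have := (h.bounds (sq_nonneg ‖X‖)).1
  show 0 < (radialMap η X).snd ↔ 0 < X.snd
  rw [radialMap_snd, mul_pos_iff_of_pos_left (by linarith)]

lemma radialHomeo_symm_mem_upperHalf_iff (h : IsSmallProfile η ρ) {X : ExtSpace n} :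
    (radialHomeo h).symm X ∈ upperHalf n ↔ X ∈ upperHalf n := by
  rw [← radialMap_mem_upperHalf_iff h, ← radialHomeo_apply h, Homeomorph.apply_symm_apply]

lemma radialMap_image_halfBall (h : IsSmallProfile η ρ) (hρ : 0 ≤ ρ) {R : ℝ} (hR : ρ ≤ R) :
    radialMap η '' halfBall n R = halfBall n R := by
  rw [halfBall, image_inter (f := radialMap η) (radialHomeo h).injective, radialHomeo_image_ball h hρ hR]
  congr 1
  ext Y
  constructor
  · rintro ⟨X, hX, rfl⟩
    exact (radialMap_mem_upperHalf_iff h).mpr hX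
  · intro hY
    exact ⟨_, (radialHomeo_symm_mem_upperHalf_iff h).mpr hY, (radialHomeo h).apply_symm_apply Y⟩

end deform

/-! ### The energy of a deformed extension -/

section radial

variable {H : Type*} [NormedAddCommGroup H] [InnerProductSpace ℝ H] {η : ℝ → ℝ}

lemma gradient_comp_radialMap [CompleteSpace H] (hη : ContDiff ℝ 1 η) {V : H → ℝ} {G g X : H}
    (hV : HasGradientAt V G (radialMap η X))
    (hU : HasGradientAt (fun Y => V (radialMap η Y)) g X) :
    g = (1 + η (‖X‖ ^ 2)) • G + (2 * deriv η (‖X‖ ^ 2) * inner ℝ X G) • X := by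
  have h1 := hV.hasFDerivAt.comp X (hasFDerivAt_radialMap hη X)
  have h2 := hU.hasFDerivAt.unique h1
  refine ext_inner_right ℝ fun v => ?_
  have h3 := congrArg (fun L : H →L[ℝ] ℝ => L v) h2
  simp only [InnerProductSpace.toDual_apply_apply, ContinuousLinearMap.comp_apply,
    radialDeriv_apply, inner_add_right, inner_smul_right] at h3
  rw [h3, inner_add_left, inner_smul_left, inner_smul_left, real_inner_comm X G]
  simp only [conj_trivial]
  ring

/-- Pairing the relation with `X` gives `X · g = β (X · G)`; eliminating `X · G` from the expansion
of `|g|²` expresses `|G|²` through `g` alone. -/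
lemma norm_sq_of_radial_relation {G g X : H} {α β γ : ℝ} (hα : α ≠ 0) (hβ : β ≠ 0)
    (hβ' : β = α + γ * ‖X‖ ^ 2) (hg : g = α • G + (γ * inner ℝ X G) • X) :
    ‖G‖ ^ 2 = (‖g‖ ^ 2 - γ * (α + β) * inner ℝ X g ^ 2 / β ^ 2) / α ^ 2 := by
  have h1 : inner ℝ X g = β * inner ℝ X G := by
    rw [hg, inner_add_right, inner_smul_right, inner_smul_right, real_inner_self_eq_norm_sq, hβ']
    ring
  have h2 : ‖g‖ ^ 2 = α ^ 2 * ‖G‖ ^ 2 + (2 * α * γ + γ ^ 2 * ‖X‖ ^ 2) * inner ℝ X G ^ 2 := by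
    rw [hg, norm_add_sq_real, norm_smul, norm_smul, inner_smul_left, inner_smul_right,
      real_inner_comm X G, mul_pow, mul_pow, Real.norm_eq_abs, Real.norm_eq_abs, sq_abs, sq_abs]
    simp only [conj_trivial]
    ring
  rw [h1, h2]
  field_simp
  rw [hβ']
  ring

end radial

/-- The factor of `|∇U|²` in the energy density of a radially deformed function. -/
def deformFactor (κ a b : ℝ) : ℝ := (1 + a) ^ κ * (1 + b)

/-- The factor of `-(X · ∇U)²` in the energy density of a radially deformed function. -/
def deformFactor' (κ a b c : ℝ) : ℝ := (1 + a) ^ κ * (c * (2 + a + b) / (1 + b))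

section deform

variable {η : ℝ → ℝ} {ρ R : ℝ} {E : Set (EuclideanSpace ℝ (Fin n))}

/-- The energy density of the extension deformed by `radialMap η`, pulled back. -/
def deformDensity (s : ℝ) (η : ℝ → ℝ) (E : Set (EuclideanSpace ℝ (Fin n))) (X : ExtSpace n) : ℝ :=
  X.snd ^ (1 - s) *
    (deformFactor (n - 1 - s) (η (‖X‖ ^ 2)) (η (‖X‖ ^ 2) + 2 * ‖X‖ ^ 2 * deriv η (‖X‖ ^ 2)) *
      ‖extGrad s (signChar E) X‖ ^ 2 -
    deformFactor' (n - 1 - s) (η (‖X‖ ^ 2)) (η (‖X‖ ^ 2) + 2 * ‖X‖ ^ 2 * deriv η (‖X‖ ^ 2))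
      (2 * deriv η (‖X‖ ^ 2)) * inner ℝ X (extGrad s (signChar E) X) ^ 2)

lemma measurable_deformDensity (hη : ContDiff ℝ 1 η) (hE : MeasurableSet E) :
    Measurable (deformDensity s η E) := by
  have h1 := measurable_extGrad (s := s) (measurable_signChar hE)
  have h2 : Measurable fun X : ExtSpace n => η (‖X‖ ^ 2) :=
    hη.continuous.measurable.comp (by fun_prop)
  have h3 : Measurable fun X : ExtSpace n => deriv η (‖X‖ ^ 2) :=
    (measurable_deriv η).comp (by fun_prop)
  have h4 : Measurable fun X : ExtSpace n => (inner ℝ X (extGrad s (signChar E) X) : ℝ) :=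
    measurable_id.inner h1
  have key : ∀ a d m P : ExtSpace n → ℝ, Measurable a → Measurable d → Measurable m →
      Measurable P → Measurable fun X : ExtSpace n => X.snd ^ (1 - s) *
        (deformFactor (n - 1 - s) (a X) (a X + 2 * ‖X‖ ^ 2 * d X) * P X ^ 2 -
        deformFactor' (n - 1 - s) (a X) (a X + 2 * ‖X‖ ^ 2 * d X) (2 * d X) * m X ^ 2) := by
    intro a d m P ha hd hm hP
    unfold deformFactor deformFactor'
    fun_prop
  exact key _ _ _ _ h2 h3 h4 h1.norm

/-- With `α`, `β` the tangential and radial stretches, the Jacobian is `α^n β`, the weight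
contributes `α^{1-s}` and the gradient `α^{-2}`: this is the origin of the exponent `n - 1 - s`. -/
lemma det_mul_energy_eq_deformDensity (hs : 0 < s) (h : IsSmallProfile η ρ) (hE : MeasurableSet E)
    {X : ExtSpace n} (hX : X ∈ upperHalf n) :
    |(radialDeriv η X).det| • ((radialMap η X).snd ^ (1 - s) *
      ‖gradient (fun Y => csExtension s (signChar E) ((radialHomeo h).symm Y))
        (radialMap η X)‖ ^ 2) = deformDensity s η E X := by
  set V : ExtSpace n → ℝ := fun Y => csExtension s (signChar E) ((radialHomeo h).symm Y) with hV
  obtain ⟨h1, h2, h3, h4⟩ := h.bounds (sq_nonneg ‖X‖)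
  have hVc : ContDiffOn ℝ 1 V (upperHalf n) :=
    (contDiffOn_csExtension hs (measurable_signChar hE) (abs_signChar_le E)).comp
      (contDiff_radialHomeo_symm h).contDiffOn
      fun Y hY => (radialHomeo_symm_mem_upperHalf_iff h).mpr hY
  have hg := gradient_comp_radialMap h.contDiff
    (hasGradientAt_of_contDiffOn hVc ((radialMap_mem_upperHalf_iff h).mpr hX))
    (g := extGrad s (signChar E) X) (by
      have := hasGradientAt_csExtension hs (measurable_signChar hE) (abs_signChar_le E) hX
      refine this.congr_of_eventuallyEq (Eventually.of_forall fun Y => ?_)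
      simp only [hV]
      rw [← radialHomeo_apply h, Homeomorph.symm_apply_apply])
  have hn := norm_sq_of_radial_relation (by linarith)
    (by linarith : 1 + η (‖X‖ ^ 2) + 2 * ‖X‖ ^ 2 * deriv η (‖X‖ ^ 2) ≠ 0) (by ring) hg
  have hfr : Module.finrank ℝ (ExtSpace n) = n + 1 := by
    rw [(WithLp.linearEquiv 2 ℝ (EuclideanSpace ℝ (Fin n) × ℝ)).finrank_eq]; simp
  have hX0 : 0 < X.snd := hX
  rw [hn, abs_of_pos (h.det_pos X), det_radialDeriv (by linarith), hfr, radialMap_snd, smul_eq_mul,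
    deformDensity, deformFactor, deformFactor', Real.mul_rpow (by linarith) hX0.le]
  set α := 1 + η (‖X‖ ^ 2) with hα
  have hα0 : 0 < α := by linarith
  have h5 : α ^ ((n : ℝ) - 1 - s) = α ^ n * α ^ (1 - s) / α ^ 2 := by
    rw [← Real.rpow_natCast, ← Real.rpow_natCast, ← Real.rpow_add hα0, ← Real.rpow_sub hα0]
    congr 1; push_cast; ring
  have h6 : 1 + (η (‖X‖ ^ 2) + 2 * ‖X‖ ^ 2 * deriv η (‖X‖ ^ 2)) =
    α + 2 * ‖X‖ ^ 2 * deriv η (‖X‖ ^ 2) := by rw [hα]; ring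
  have h7 : 2 + η (‖X‖ ^ 2) + (η (‖X‖ ^ 2) + 2 * ‖X‖ ^ 2 * deriv η (‖X‖ ^ 2)) =
    α + (α + 2 * ‖X‖ ^ 2 * deriv η (‖X‖ ^ 2)) := by rw [hα]; ring
  rw [h5, h6, h7]
  set β := α + 2 * ‖X‖ ^ 2 * deriv η (‖X‖ ^ 2) with hβ
  have hβ0 : 0 < β := by linarith
  field_simp
  ring

/-- `energy_le_competitor` is applied to the transported extension, whose trace is the sign function
of the transported set; the energy is then pulled back by the change of variables. -/
theorem energy_le_deformed (hn : 1 ≤ n) (hs : 0 < s) (hs1 : s < 1) (hE : MeasurableSet E)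
    (hρ : 0 < ρ) (hρR : ρ < R)
    (hmin : ∀ F : Set (EuclideanSpace ℝ (Fin n)), MeasurableSet F →
      F ∩ (Metric.ball 0 R)ᶜ = E ∩ (Metric.ball 0 R)ᶜ →
      localEnergy s (Metric.ball 0 R) E ≤ localEnergy s (Metric.ball 0 R) F)
    (h : IsSmallProfile η ρ) (hint : IntegrableOn (deformDensity s η E) (halfBall n R)) :
    ∫ X in halfBall n R, X.snd ^ (1 - s) * ‖extGrad s (signChar E) X‖ ^ 2 ≤
      ∫ X in halfBall n R, deformDensity s η E X := by
  set u := signChar E with hu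
  have hum : Measurable u := measurable_signChar hE
  have hub : ∀ y, |u y| ≤ 1 := abs_signChar_le E
  set F := radialMap η '' E with hF
  set V : ExtSpace n → ℝ := fun Y => csExtension s u ((radialHomeo h).symm Y) with hV
  have hEf : localEnergy s (Metric.ball 0 R) E ≠ ⊤ := by
    refine ne_top_of_le_ne_top (localEnergy_diff_ball_ne_top hn hs hs1 R (E := E))
      (hmin _ (hE.diff measurableSet_ball) ?_)
    ext x; simp
  have hFf := localEnergy_radialMap_ne_top hs h hρ.le hρR.le hE hEf
  have hFE : ∀ x : EuclideanSpace ℝ (Fin n), ρ ≤ ‖x‖ → (x ∈ F ↔ x ∈ E) := by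
    intro x hx
    rw [hF, mem_radialMap_image_iff h, radialHomeo_symm_of_le h hρ.le hx]
  have hFm := measurableSet_radialMap_image h hE
  have hFE' : F ∩ (Metric.ball 0 R)ᶜ = E ∩ (Metric.ball 0 R)ᶜ := by
    ext x
    simp only [mem_inter_iff, mem_compl_iff, Metric.mem_ball, dist_zero_right, not_lt]
    exact and_congr_left fun hx => hFE x (by linarith)
  have hVc : ContDiffOn ℝ 1 V (upperHalf n) :=
    (contDiffOn_csExtension hs hum hub).comp (contDiff_radialHomeo_symm h).contDiffOn
      fun Y hY => (radialHomeo_symm_mem_upperHalf_iff h).mpr hY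
  have hder : ∀ X ∈ halfBall n R, HasFDerivWithinAt (radialMap η) (radialDeriv η X)
      (halfBall n R) X := fun X _ => (hasFDerivAt_radialMap h.contDiff X).hasFDerivWithinAt
  have hinj : InjOn (radialMap η) (halfBall n R) := (radialHomeo h).injective.injOn
  have himg := radialMap_image_halfBall (n := n) h hρ.le hρR.le
  have hVint : IntegrableOn (fun X => X.snd ^ (1 - s) * ‖gradient V X‖ ^ 2) (halfBall n R) := by
    rw [← himg, integrableOn_image_iff_integrableOn_abs_det_fderiv_smul volume
      (measurableSet_halfBall R) hder hinj]
    exact hint.congr_fun (fun X hX => (det_mul_energy_eq_deformDensity hs h hE hX.2).symm)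
      (measurableSet_halfBall R)
  have heq : ∫ X in halfBall n R, X.snd ^ (1 - s) * ‖gradient V X‖ ^ 2 =
      ∫ X in halfBall n R, deformDensity s η E X := by
    rw [← himg, integral_image_eq_integral_abs_det_fderiv_smul volume
      (measurableSet_halfBall R) hder hinj, himg]
    exact setIntegral_congr_fun (measurableSet_halfBall R)
      fun X hX => det_mul_energy_eq_deformDensity hs h hE hX.2
  have hgρ : gagliardo s (Metric.ball 0 ρ) u ≠ ⊤ :=
    ne_top_of_le_ne_top (ne_top_of_le_ne_top (ENNReal.mul_ne_top (by norm_num) hEf)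
      (gagliardo_le_localEnergy hE measurableSet_ball))
      (gagliardo_mono (Metric.ball_subset_ball hρR.le) u)
  set K := poissonConst n s * 2 ^ s * 5 ^ ((n : ℝ) + s) with hK
  have hK0 : 0 ≤ K := by have := poissonConst_pos (n := n) hs; positivity
  set G := (gagliardo s (Metric.ball 0 ρ) u).toReal with hG
  have htr : ∀ ε ∈ Ioo (0 : ℝ) 1, ∫⁻ x in Metric.ball 0 ρ,
      ENNReal.ofReal ((V (pt x ε) - signChar F x) ^ 2) ≤
        ENNReal.ofReal (K * (2 ^ (n + 1) * G) * ε ^ s) := by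
    intro ε hε
    have hε0 : 0 < ε := hε.1
    calc ∫⁻ x in Metric.ball 0 ρ, ENNReal.ofReal ((V (pt x ε) - signChar F x) ^ 2)
        ≤ ∫⁻ x in Metric.ball 0 ρ, ENNReal.ofReal (K * ε ^ s) *
          ∫⁻ y, ENNReal.ofReal ((u ((radialHomeo h).symm x) - u y) ^ 2 /
            ‖(radialHomeo h).symm x - y‖ ^ ((n : ℝ) + s)) := by
          refine lintegral_mono fun x => ?_
          rw [hF, signChar_radialMap_image h]
          set X := (radialHomeo h).symm (pt x ε) with hX
          have hX' : radialMap η X = pt x ε := (radialHomeo h).apply_symm_apply _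
          obtain ⟨h1, h2, -, -⟩ := h.bounds (sq_nonneg ‖X‖)
          have h3 : (1 + η (‖X‖ ^ 2)) * X.snd = ε := by
            rw [← radialMap_snd, hX', pt_snd]
          have h4 : 0 < X.snd := pos_of_mul_pos_right (h3 ▸ hε0) (by linarith)
          -- The pulled-back point has height between `ε/2` and `2ε`, and lies within `2ε` of the
          -- pulled-back boundary point, because the inverse map at most doubles distances.
          refine trace_le hs hum hub hε0 (by nlinarith) (by nlinarith) ?_
          set ξ := (radialHomeo h).symm x with hξ
          have hξ' : radialMap η (bdry ξ) = bdry x := by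
            rw [radialMap_bdry]; congr 1; exact (radialHomeo h).apply_symm_apply _
          have h5 := norm_sub_le_radialMap h X (bdry ξ)
          rw [hX', hξ'] at h5
          have h6 : ‖pt x ε - bdry x‖ = ε := by
            have : ‖pt x ε - bdry x‖ ^ 2 = ε ^ 2 := by rw [norm_sq_sub_bdry]; simp
            exact (sq_eq_sq₀ (norm_nonneg _) hε0.le).mp this
          rw [h6] at h5
          exact (norm_fst_le (X - bdry ξ)).trans h5
      _ = ENNReal.ofReal (K * ε ^ s) * ∫⁻ x in radialMap η '' Metric.ball 0 ρ,
          ∫⁻ y, ENNReal.ofReal ((u ((radialHomeo h).symm x) - u y) ^ 2 /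
            ‖(radialHomeo h).symm x - y‖ ^ ((n : ℝ) + s)) := by
          rw [lintegral_const_mul' _ _ ENNReal.ofReal_ne_top,
            radialHomeo_image_ball h hρ.le le_rfl]
      _ ≤ ENNReal.ofReal (K * ε ^ s) * (2 ^ (n + 1) * ENNReal.ofReal G) := by
          gcongr
          refine (lintegral_radialMap_image_le h measurableSet_ball _).trans_eq ?_
          rw [finrank_euclideanSpace_fin, hG, ENNReal.ofReal_toReal hgρ, gagliardo]
          simp_rw [← radialHomeo_apply h, Homeomorph.symm_apply_apply]
      _ = ENNReal.ofReal (K * (2 ^ (n + 1) * G) * ε ^ s) := by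
          have hG0 : 0 ≤ G := ENNReal.toReal_nonneg
          rw [show (2 : ENNReal) = ENNReal.ofReal 2 by simp, ← ENNReal.ofReal_pow (by norm_num),
            ← ENNReal.ofReal_mul (by positivity), ← ENNReal.ofReal_mul (by positivity)]
          congr 1; ring
  rw [← heq]
  refine energy_le_competitor hs hs1 hE hFm hρ hρR hFE hEf hFf (hmin F hFm hFE') hVc ?_ hVint
    one_pos htr
  intro X _ hX
  simp only [hV]
  rw [radialHomeo_symm_of_le h hρ.le hX]

end deform

/-! ### The Pohozaev identity -/

lemma hasDerivAt_deformFactor {κ a b t : ℝ} (ha : 0 < 1 + t * a) :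
    HasDerivAt (fun t => deformFactor κ (t * a) (t * b))
      (a * κ * (1 + t * a) ^ (κ - 1) * (1 + t * b) + (1 + t * a) ^ κ * b) t := by
  have h1 : HasDerivAt (fun t : ℝ => 1 + t * a) a t := by
    simpa using ((hasDerivAt_id t).mul_const a).const_add 1
  have h2 : HasDerivAt (fun t : ℝ => 1 + t * b) b t := by
    simpa using ((hasDerivAt_id t).mul_const b).const_add 1
  exact (h1.rpow_const (Or.inl ha.ne')).mul h2

lemma hasDerivAt_deformFactor' {κ a b c t : ℝ} (ha : 0 < 1 + t * a) (hb : 0 < 1 + t * b) :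
    HasDerivAt (fun t => deformFactor' κ (t * a) (t * b) (t * c))
      (a * κ * (1 + t * a) ^ (κ - 1) * (t * c * (2 + t * a + t * b) / (1 + t * b)) +
        (1 + t * a) ^ κ * (((c * (2 + t * a + t * b) + t * c * (a + b)) * (1 + t * b) -
          t * c * (2 + t * a + t * b) * b) / (1 + t * b) ^ 2)) t := by
  have h0 : ∀ d : ℝ, HasDerivAt (fun t : ℝ => t * d) d t := fun d => by
    simpa using (hasDerivAt_id t).mul_const d
  have h1 : HasDerivAt (fun t : ℝ => 1 + t * a) a t := (h0 a).const_add 1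
  have h2 : HasDerivAt (fun t : ℝ => 1 + t * b) b t := (h0 b).const_add 1
  have h3 : HasDerivAt (fun t : ℝ => 2 + t * a + t * b) (a + b) t := ((h0 a).const_add 2).add (h0 b)
  exact (h1.rpow_const (Or.inl ha.ne')).mul (((h0 c).mul h3).div h2 hb.ne')

/-- All four expressions are continuous on a compact box of parameters, because `1 + t a` and `1 + t
b` stay at least `1/2` there. The last two are the `t`-derivatives of the first two. -/
lemma exists_deformFactor_bound (κ M : ℝ) {t₀ : ℝ} (ht₀ : t₀ * M ≤ 1 / 2) :
    ∃ C : ℝ, ∀ t a b c : ℝ, |t| ≤ t₀ → |a| ≤ M → |b| ≤ M → |c| ≤ M →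
      |deformFactor κ (t * a) (t * b)| ≤ C ∧ |deformFactor' κ (t * a) (t * b) (t * c)| ≤ C ∧
      |a * κ * (1 + t * a) ^ (κ - 1) * (1 + t * b) + (1 + t * a) ^ κ * b| ≤ C ∧
      |a * κ * (1 + t * a) ^ (κ - 1) * (t * c * (2 + t * a + t * b) / (1 + t * b)) +
        (1 + t * a) ^ κ * (((c * (2 + t * a + t * b) + t * c * (a + b)) * (1 + t * b) -
          t * c * (2 + t * a + t * b) * b) / (1 + t * b) ^ 2)| ≤ C := by
  set K : Set (ℝ × ℝ × ℝ × ℝ) := Icc (-t₀) t₀ ×ˢ Icc (-M) M ×ˢ Icc (-M) M ×ˢ Icc (-M) M with hK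
  have hKc : IsCompact K := isCompact_Icc.prod (isCompact_Icc.prod (isCompact_Icc.prod isCompact_Icc))
  have hpos : ∀ t a : ℝ, t ∈ Icc (-t₀) t₀ → a ∈ Icc (-M) M → 0 < 1 + t * a := by
    intro t a ht ha
    have h1 : |t * a| ≤ 1 / 2 := by
      rw [abs_mul]
      exact (mul_le_mul (abs_le.mpr ht) (abs_le.mpr ha) (abs_nonneg _)
        ((abs_nonneg t).trans (abs_le.mpr ht))).trans ht₀
    linarith [(abs_le.mp h1).1]
  have hpa : ∀ v ∈ K, 1 + v.1 * v.2.1 ≠ 0 := fun v hv => (hpos _ _ hv.1 hv.2.1).ne'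
  have hpb : ∀ v ∈ K, 1 + v.1 * v.2.2.1 ≠ 0 := fun v hv => (hpos _ _ hv.1 hv.2.2.1).ne'
  have hr : ∀ κ : ℝ, ContinuousOn (fun v : ℝ × ℝ × ℝ × ℝ => (1 + v.1 * v.2.1) ^ κ) K := fun κ =>
    ContinuousOn.rpow_const (by fun_prop) fun v hv => Or.inl (hpa v hv)
  have c1 : ContinuousOn (fun v : ℝ × ℝ × ℝ × ℝ =>
      deformFactor κ (v.1 * v.2.1) (v.1 * v.2.2.1)) K := (hr κ).mul (by fun_prop)
  have c2 : ContinuousOn (fun v : ℝ × ℝ × ℝ × ℝ =>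
      deformFactor' κ (v.1 * v.2.1) (v.1 * v.2.2.1) (v.1 * v.2.2.2)) K :=
    (hr κ).mul (ContinuousOn.div (by fun_prop) (by fun_prop) hpb)
  have c3 : ContinuousOn (fun v : ℝ × ℝ × ℝ × ℝ => v.2.1 * κ * (1 + v.1 * v.2.1) ^ (κ - 1) *
      (1 + v.1 * v.2.2.1) + (1 + v.1 * v.2.1) ^ κ * v.2.2.1) K :=
    (((by fun_prop : ContinuousOn (fun v : ℝ × ℝ × ℝ × ℝ => v.2.1 * κ) K).mul (hr (κ - 1))).mul
      (by fun_prop)).add ((hr κ).mul (by fun_prop))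
  have c4 : ContinuousOn (fun v : ℝ × ℝ × ℝ × ℝ => v.2.1 * κ * (1 + v.1 * v.2.1) ^ (κ - 1) *
      (v.1 * v.2.2.2 * (2 + v.1 * v.2.1 + v.1 * v.2.2.1) / (1 + v.1 * v.2.2.1)) +
        (1 + v.1 * v.2.1) ^ κ * (((v.2.2.2 * (2 + v.1 * v.2.1 + v.1 * v.2.2.1) +
          v.1 * v.2.2.2 * (v.2.1 + v.2.2.1)) * (1 + v.1 * v.2.2.1) -
          v.1 * v.2.2.2 * (2 + v.1 * v.2.1 + v.1 * v.2.2.1) * v.2.2.1) /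
          (1 + v.1 * v.2.2.1) ^ 2)) K :=
    (((by fun_prop : ContinuousOn (fun v : ℝ × ℝ × ℝ × ℝ => v.2.1 * κ) K).mul (hr (κ - 1))).mul
      (ContinuousOn.div (by fun_prop) (by fun_prop) hpb)).add ((hr κ).mul
      (ContinuousOn.div (by fun_prop) (by fun_prop) fun v hv => pow_ne_zero _ (hpb v hv)))
  obtain ⟨C1, h1⟩ := hKc.exists_bound_of_continuousOn c1
  obtain ⟨C2, h2⟩ := hKc.exists_bound_of_continuousOn c2
  obtain ⟨C3, h3⟩ := hKc.exists_bound_of_continuousOn c3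
  obtain ⟨C4, h4⟩ := hKc.exists_bound_of_continuousOn c4
  refine ⟨max (max C1 C2) (max C3 C4), fun t a b c ht ha hb hc => ?_⟩
  have hv : (t, a, b, c) ∈ K := ⟨abs_le.mp ht, abs_le.mp ha, abs_le.mp hb, abs_le.mp hc⟩
  exact ⟨(h1 _ hv).trans (by simp), (h2 _ hv).trans (by simp), (h3 _ hv).trans (by simp),
    (h4 _ hv).trans (by simp)⟩

lemma exists_profile_bound {η : ℝ → ℝ} {ρ : ℝ} (hη : ContDiff ℝ 1 η)
    (h0 : ∀ q, ρ ^ 2 ≤ q → η q = 0) :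
    ∃ M : ℝ, 0 < M ∧ ∀ q, 0 ≤ q → |η q| ≤ M ∧ |2 * deriv η q| ≤ M ∧ |2 * q * deriv η q| ≤ M := by
  have hd : Continuous (deriv η) := hη.continuous_deriv le_rfl
  obtain ⟨C1, h1⟩ := (isCompact_Icc (a := (0 : ℝ)) (b := ρ ^ 2)).exists_bound_of_continuousOn
    hη.continuous.continuousOn
  obtain ⟨C2, h2⟩ := (isCompact_Icc (a := (0 : ℝ)) (b := ρ ^ 2)).exists_bound_of_continuousOn
    (f := fun q => 2 * deriv η q) (by fun_prop)
  obtain ⟨C3, h3⟩ := (isCompact_Icc (a := (0 : ℝ)) (b := ρ ^ 2)).exists_bound_of_continuousOn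
    (f := fun q => 2 * q * deriv η q) (by fun_prop)
  refine ⟨max 1 (max C1 (max C2 C3)), by positivity, fun q hq => ?_⟩
  rcases le_or_gt q (ρ ^ 2) with hq' | hq'
  · exact ⟨(h1 q ⟨hq, hq'⟩).trans (by simp), (h2 q ⟨hq, hq'⟩).trans (by simp),
      (h3 q ⟨hq, hq'⟩).trans (by simp)⟩
  · have : deriv η q = 0 := by
      have : η =ᶠ[𝓝 q] fun _ => 0 := by
        filter_upwards [lt_mem_nhds hq'] with x hx using h0 x hx.le
      rw [this.deriv_eq, deriv_const]
    rw [h0 q hq'.le, this]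
    simp

section pohozaev

variable {η : ℝ → ℝ} {ρ R : ℝ} {E : Set (EuclideanSpace ℝ (Fin n))}

lemma sq_inner_le {H : Type*} [NormedAddCommGroup H] [InnerProductSpace ℝ H] {X v : H}
    (hX : ‖X‖ ≤ R) : inner ℝ X v ^ 2 ≤ R ^ 2 * ‖v‖ ^ 2 := by
  have h1 := abs_real_inner_le_norm X v
  rw [← sq_abs, ← mul_pow]
  gcongr
  exact h1.trans (by gcongr)

lemma norm_le_of_mem_halfBall {X : ExtSpace n} (hX : X ∈ halfBall n R) : ‖X‖ ≤ R := by
  have : ‖X‖ < R := by simpa using hX.1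
  exact this.le

lemma abs_weighted_le {X : ExtSpace n} (hX : X ∈ halfBall n R) {v : ExtSpace n} {A B C : ℝ}
    (hA : |A| ≤ C) (hB : |B| ≤ C) :
    |X.snd ^ (1 - s) * (A * ‖v‖ ^ 2 - B * inner ℝ X v ^ 2)| ≤
      (C + C * R ^ 2) * (X.snd ^ (1 - s) * ‖v‖ ^ 2) := by
  have hX0 : 0 < X.snd := hX.2
  have h1 := sq_inner_le (v := v) (norm_le_of_mem_halfBall hX)
  have h2 : 0 < X.snd ^ (1 - s) := by positivity
  have hC : 0 ≤ C := (abs_nonneg A).trans hA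
  rw [abs_mul, abs_of_pos h2]
  calc X.snd ^ (1 - s) * |A * ‖v‖ ^ 2 - B * inner ℝ X v ^ 2|
      ≤ X.snd ^ (1 - s) * (C * ‖v‖ ^ 2 + C * (R ^ 2 * ‖v‖ ^ 2)) := by
        gcongr
        refine (abs_sub _ _).trans ?_
        rw [abs_mul, abs_mul, abs_of_nonneg (sq_nonneg ‖v‖), abs_of_nonneg (sq_nonneg (inner ℝ X v))]
        gcongr
    _ = _ := by ring

/-- The deformations with profile `t η`, for small `t` of either sign, have energy at least that of
`U`, so the energy has a local minimum at `t = 0`. The identity is its vanishing derivative there,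
taken under the integral sign. -/
theorem pohozaev (hn : 1 ≤ n) (hs : 0 < s) (hs1 : s < 1) (hE : MeasurableSet E)
    (hρ : 0 < ρ) (hρR : ρ < R)
    (hmin : ∀ F : Set (EuclideanSpace ℝ (Fin n)), MeasurableSet F →
      F ∩ (Metric.ball 0 R)ᶜ = E ∩ (Metric.ball 0 R)ᶜ →
      localEnergy s (Metric.ball 0 R) E ≤ localEnergy s (Metric.ball 0 R) F)
    (hint : IntegrableOn (fun X => X.snd ^ (1 - s) * ‖extGrad s (signChar E) X‖ ^ 2)
      (halfBall n R))
    (hη : ContDiff ℝ 1 η) (h0 : ∀ q, ρ ^ 2 ≤ q → η q = 0) :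
    ∫ X in halfBall n R, X.snd ^ (1 - s) *
      (((n - s) * η (‖X‖ ^ 2) + 2 * ‖X‖ ^ 2 * deriv η (‖X‖ ^ 2)) *
        ‖extGrad s (signChar E) X‖ ^ 2 -
      4 * deriv η (‖X‖ ^ 2) * inner ℝ X (extGrad s (signChar E) X) ^ 2) = 0 := by
  obtain ⟨M, hM0, hM⟩ := exists_profile_bound hη h0
  -- This keeps `t η` and `2 q t η'` below `1/8`, so that `t η` is a small profile for `|t| ≤ t₀`.
  set t₀ : ℝ := 1 / (8 * M) with ht₀
  have ht₀pos : 0 < t₀ := by positivity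
  have htM : t₀ * M = 1 / 8 := by rw [ht₀]; field_simp
  obtain ⟨C, hC⟩ := exists_deformFactor_bound ((n : ℝ) - 1 - s) (2 * M) (t₀ := t₀)
    (by linarith)
  set F : ℝ → ExtSpace n → ℝ := fun t => deformDensity s (fun q => t * η q) E with hF
  have hFeq : ∀ t X, F t X = X.snd ^ (1 - s) *
      (deformFactor (n - 1 - s) (t * η (‖X‖ ^ 2))
        (t * (η (‖X‖ ^ 2) + 2 * ‖X‖ ^ 2 * deriv η (‖X‖ ^ 2))) * ‖extGrad s (signChar E) X‖ ^ 2 -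
      deformFactor' (n - 1 - s) (t * η (‖X‖ ^ 2))
        (t * (η (‖X‖ ^ 2) + 2 * ‖X‖ ^ 2 * deriv η (‖X‖ ^ 2))) (t * (2 * deriv η (‖X‖ ^ 2))) *
        inner ℝ X (extGrad s (signChar E) X) ^ 2) := by
    intro t X
    have hd : deriv (fun q => t * η q) (‖X‖ ^ 2) = t * deriv η (‖X‖ ^ 2) := by
      rw [deriv_const_mul_field]
    simp only [hF, deformDensity, hd]
    rw [show t * η (‖X‖ ^ 2) + 2 * ‖X‖ ^ 2 * (t * deriv η (‖X‖ ^ 2)) =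
      t * (η (‖X‖ ^ 2) + 2 * ‖X‖ ^ 2 * deriv η (‖X‖ ^ 2)) by ring,
      show 2 * (t * deriv η (‖X‖ ^ 2)) = t * (2 * deriv η (‖X‖ ^ 2)) by ring]
  have hηt : ∀ t : ℝ, ContDiff ℝ 1 (fun q => t * η q) := fun t => contDiff_const.mul hη
  have hFm : ∀ t, Measurable (F t) := fun t => measurable_deformDensity (hηt t) hE
  have hb : ∀ X : ExtSpace n, |η (‖X‖ ^ 2)| ≤ 2 * M ∧
      |η (‖X‖ ^ 2) + 2 * ‖X‖ ^ 2 * deriv η (‖X‖ ^ 2)| ≤ 2 * M ∧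
      |2 * deriv η (‖X‖ ^ 2)| ≤ 2 * M := by
    intro X
    obtain ⟨h1, h2, h3⟩ := hM (‖X‖ ^ 2) (sq_nonneg _)
    exact ⟨by linarith, (abs_add_le _ _).trans (by linarith), by linarith⟩
  have hFint : ∀ t, |t| ≤ t₀ → IntegrableOn (F t) (halfBall n R) := by
    intro t ht
    refine (hint.const_mul (C + C * R ^ 2)).mono' (hFm t).aestronglyMeasurable
      ((ae_restrict_iff' (measurableSet_halfBall R)).mpr (Eventually.of_forall fun X hX => ?_))
    obtain ⟨h1, h2, h3⟩ := hb X
    obtain ⟨h4, h5, -, -⟩ := hC t _ _ _ ht h1 h2 h3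
    rw [hFeq, Real.norm_eq_abs]
    exact abs_weighted_le hX h4 h5
  have hprof : ∀ t, |t| ≤ t₀ → IsSmallProfile (fun q => t * η q) ρ := by
    intro t ht
    refine ⟨hηt t, fun q hq => ?_, fun q hq => ?_, fun q hq => by simp [h0 q hq]⟩
    · rw [abs_mul, ← htM]
      exact mul_le_mul ht (hM q hq).1 (abs_nonneg _) ht₀pos.le
    · rw [deriv_const_mul_field, show 2 * q * (t * deriv η q) = t * (2 * q * deriv η q) by ring,
        abs_mul]
      refine (mul_le_mul ht (hM q hq).2.2 (abs_nonneg _) ht₀pos.le).trans ?_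
      rw [htM]; norm_num
  have hF0 : ∀ X, F 0 X = X.snd ^ (1 - s) * ‖extGrad s (signChar E) X‖ ^ 2 := by
    intro X
    rw [hFeq]
    simp [deformFactor, deformFactor']
  have hlm : IsLocalMin (fun t => ∫ X in halfBall n R, F t X) 0 := by
    filter_upwards [Metric.ball_mem_nhds (0 : ℝ) ht₀pos] with t ht
    have ht' : |t| ≤ t₀ := by
      rw [mem_ball_zero_iff, Real.norm_eq_abs] at ht
      exact ht.le
    simp only [hF0]
    exact energy_le_deformed hn hs hs1 hE hρ hρR hmin (hprof t ht') (hFint t ht')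
  set F' : ℝ → ExtSpace n → ℝ := fun t X => X.snd ^ (1 - s) *
    ((η (‖X‖ ^ 2) * (n - 1 - s) * (1 + t * η (‖X‖ ^ 2)) ^ ((n : ℝ) - 1 - s - 1) *
      (1 + t * (η (‖X‖ ^ 2) + 2 * ‖X‖ ^ 2 * deriv η (‖X‖ ^ 2))) +
      (1 + t * η (‖X‖ ^ 2)) ^ ((n : ℝ) - 1 - s) *
        (η (‖X‖ ^ 2) + 2 * ‖X‖ ^ 2 * deriv η (‖X‖ ^ 2))) * ‖extGrad s (signChar E) X‖ ^ 2 -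
    (η (‖X‖ ^ 2) * (n - 1 - s) * (1 + t * η (‖X‖ ^ 2)) ^ ((n : ℝ) - 1 - s - 1) *
      (t * (2 * deriv η (‖X‖ ^ 2)) * (2 + t * η (‖X‖ ^ 2) +
        t * (η (‖X‖ ^ 2) + 2 * ‖X‖ ^ 2 * deriv η (‖X‖ ^ 2))) /
        (1 + t * (η (‖X‖ ^ 2) + 2 * ‖X‖ ^ 2 * deriv η (‖X‖ ^ 2)))) +
      (1 + t * η (‖X‖ ^ 2)) ^ ((n : ℝ) - 1 - s) * ((((2 * deriv η (‖X‖ ^ 2)) *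
        (2 + t * η (‖X‖ ^ 2) + t * (η (‖X‖ ^ 2) + 2 * ‖X‖ ^ 2 * deriv η (‖X‖ ^ 2))) +
        t * (2 * deriv η (‖X‖ ^ 2)) * (η (‖X‖ ^ 2) +
          (η (‖X‖ ^ 2) + 2 * ‖X‖ ^ 2 * deriv η (‖X‖ ^ 2)))) *
        (1 + t * (η (‖X‖ ^ 2) + 2 * ‖X‖ ^ 2 * deriv η (‖X‖ ^ 2))) -
        t * (2 * deriv η (‖X‖ ^ 2)) * (2 + t * η (‖X‖ ^ 2) +
          t * (η (‖X‖ ^ 2) + 2 * ‖X‖ ^ 2 * deriv η (‖X‖ ^ 2))) *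
          (η (‖X‖ ^ 2) + 2 * ‖X‖ ^ 2 * deriv η (‖X‖ ^ 2))) /
        (1 + t * (η (‖X‖ ^ 2) + 2 * ‖X‖ ^ 2 * deriv η (‖X‖ ^ 2))) ^ 2)) *
      inner ℝ X (extGrad s (signChar E) X) ^ 2) with hF'
  have hF'0 : F' 0 = fun X => X.snd ^ (1 - s) *
      (((n - s) * η (‖X‖ ^ 2) + 2 * ‖X‖ ^ 2 * deriv η (‖X‖ ^ 2)) *
        ‖extGrad s (signChar E) X‖ ^ 2 -
      4 * deriv η (‖X‖ ^ 2) * inner ℝ X (extGrad s (signChar E) X) ^ 2) := by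
    ext X
    simp only [hF', zero_mul, add_zero, Real.one_rpow, mul_one, mul_zero, one_mul,
      sub_zero, one_pow, div_one, zero_add]
    ring
  have hF'm : Measurable (F' 0) := by
    rw [hF'0]
    have h1 := measurable_extGrad (s := s) (measurable_signChar hE)
    have h2 : Measurable fun X : ExtSpace n => η (‖X‖ ^ 2) :=
      hη.continuous.measurable.comp (by fun_prop)
    have h3 : Measurable fun X : ExtSpace n => deriv η (‖X‖ ^ 2) :=
      (measurable_deriv η).comp (by fun_prop)
    have h4 : Measurable fun X : ExtSpace n => (inner ℝ X (extGrad s (signChar E) X) : ℝ) :=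
      measurable_id.inner h1
    have key : ∀ a d m P : ExtSpace n → ℝ, Measurable a → Measurable d → Measurable m →
        Measurable P → Measurable fun X : ExtSpace n => X.snd ^ (1 - s) *
          (((n - s) * a X + 2 * ‖X‖ ^ 2 * d X) * P X ^ 2 - 4 * d X * m X ^ 2) := by
      intro a d m P ha hd hm hP
      fun_prop
    exact key _ _ _ _ h2 h3 h4 h1.norm
  have hball : ∀ t ∈ Metric.ball (0 : ℝ) t₀, |t| ≤ t₀ := fun t ht => by
    rw [mem_ball_zero_iff, Real.norm_eq_abs] at ht
    exact ht.le
  obtain ⟨-, hder⟩ := hasDerivAt_integral_of_dominated_loc_of_deriv_le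
    (μ := volume.restrict (halfBall n R)) (F := F) (F' := F') (x₀ := (0 : ℝ))
    (bound := fun X => (C + C * R ^ 2) * (X.snd ^ (1 - s) * ‖extGrad s (signChar E) X‖ ^ 2))
    (Metric.ball_mem_nhds (0 : ℝ) ht₀pos)
    (Eventually.of_forall fun t => (hFm t).aestronglyMeasurable)
    (hFint 0 (by simpa using ht₀pos.le)) hF'm.aestronglyMeasurable
    ((ae_restrict_iff' (measurableSet_halfBall R)).mpr (Eventually.of_forall fun X hX t ht => by
      obtain ⟨h1, h2, h3⟩ := hb X
      obtain ⟨-, -, h4, h5⟩ := hC t _ _ _ (hball t ht) h1 h2 h3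
      rw [Real.norm_eq_abs]
      exact abs_weighted_le hX h4 h5))
    (hint.const_mul _)
    (Eventually.of_forall fun X t ht => by
      have h1 : 0 < 1 + t * η (‖X‖ ^ 2) := by
        have := ((hprof t (hball t ht)).bounds (sq_nonneg ‖X‖)).1
        linarith
      have h2 : 0 < 1 + t * (η (‖X‖ ^ 2) + 2 * ‖X‖ ^ 2 * deriv η (‖X‖ ^ 2)) := by
        have := ((hprof t (hball t ht)).bounds (sq_nonneg ‖X‖)).2.2.1
        rw [deriv_const_mul_field] at this
        linarith
      simp only [hFeq]
      exact (((hasDerivAt_deformFactor h1).mul_const _).sub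
        ((hasDerivAt_deformFactor' h1 h2).mul_const _)).const_mul _)
  have := hlm.hasDerivAt_eq_zero hder
  rwa [hF'0] at this

end pohozaev

/-! ### The monotonicity identity -/

section identity

variable {ρ R M : ℝ} {E : Set (EuclideanSpace ℝ (Fin n))}

/-- The integrand of the Pohozaev identity for a profile with derivative `ζ`. -/
def pohozaevDensity (s ρ : ℝ) (ζ : ℝ → ℝ) (E : Set (EuclideanSpace ℝ (Fin n))) (X : ExtSpace n) :
    ℝ :=
  X.snd ^ (1 - s) *
    (((n - s) * (-∫ q in ‖X‖ ^ 2..ρ ^ 2, ζ q) + 2 * ‖X‖ ^ 2 * ζ (‖X‖ ^ 2)) *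
      ‖extGrad s (signChar E) X‖ ^ 2 -
    4 * ζ (‖X‖ ^ 2) * inner ℝ X (extGrad s (signChar E) X) ^ 2)

lemma integral_pohozaevDensity_of_continuous (hn : 1 ≤ n) (hs : 0 < s) (hs1 : s < 1)
    (hE : MeasurableSet E) (hρ : 0 < ρ) (hρR : ρ < R)
    (hmin : ∀ F : Set (EuclideanSpace ℝ (Fin n)), MeasurableSet F →
      F ∩ (Metric.ball 0 R)ᶜ = E ∩ (Metric.ball 0 R)ᶜ →
      localEnergy s (Metric.ball 0 R) E ≤ localEnergy s (Metric.ball 0 R) F)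
    (hint : IntegrableOn (fun X => X.snd ^ (1 - s) * ‖extGrad s (signChar E) X‖ ^ 2)
      (halfBall n R))
    {ζ : ℝ → ℝ} (hζ : Continuous ζ) (h0 : ∀ q, ρ ^ 2 ≤ q → ζ q = 0) :
    ∫ X in halfBall n R, pohozaevDensity s ρ ζ E X = 0 := by
  set η : ℝ → ℝ := fun q => -∫ x in q..ρ ^ 2, ζ x with hη
  have hd : ∀ q, HasDerivAt η (ζ q) q := fun q => by
    have := (intervalIntegral.integral_hasDerivAt_left (hζ.intervalIntegrable q (ρ ^ 2))
      hζ.stronglyMeasurable.stronglyMeasurableAtFilter hζ.continuousAt).neg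
    rw [neg_neg] at this
    exact this
  have hderiv : deriv η = ζ := funext fun q => (hd q).deriv
  have hηc : ContDiff ℝ 1 η := by
    rw [contDiff_one_iff_deriv, hderiv]
    exact ⟨fun q => (hd q).differentiableAt, hζ⟩
  have hη0 : ∀ q, ρ ^ 2 ≤ q → η q = 0 := by
    intro q hq
    simp only [hη, neg_eq_zero]
    rw [intervalIntegral.integral_symm, neg_eq_zero]
    refine (intervalIntegral.integral_congr fun x hx => ?_).trans intervalIntegral.integral_zero
    rw [uIcc_of_le hq] at hx
    exact h0 x hx.1
  have := pohozaev hn hs hs1 hE hρ hρR hmin hint hηc hη0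
  rwa [hderiv] at this

lemma measurable_pohozaevDensity (hE : MeasurableSet E) {ζ : ℝ → ℝ} (hζ : Continuous ζ) :
    Measurable (pohozaevDensity s ρ ζ E) := by
  have h1 := measurable_extGrad (s := s) (measurable_signChar hE)
  have h2 : Measurable fun X : ExtSpace n => -∫ q in ‖X‖ ^ 2..ρ ^ 2, ζ q := by
    have : Continuous fun x : ℝ => -∫ q in x..ρ ^ 2, ζ q := by
      have h : (fun x : ℝ => -∫ q in x..ρ ^ 2, ζ q) = fun x => ∫ q in ρ ^ 2..x, ζ q :=
        funext fun x => by rw [intervalIntegral.integral_symm, neg_neg]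
      rw [h]
      exact intervalIntegral.continuous_primitive (fun a b => hζ.intervalIntegrable a b) _
    exact this.measurable.comp (by fun_prop)
  have h3 : Measurable fun X : ExtSpace n => ζ (‖X‖ ^ 2) := hζ.measurable.comp (by fun_prop)
  have h4 : Measurable fun X : ExtSpace n => (inner ℝ X (extGrad s (signChar E) X) : ℝ) :=
    measurable_id.inner h1
  have key : ∀ a d m P : ExtSpace n → ℝ, Measurable a → Measurable d → Measurable m →
      Measurable P → Measurable fun X : ExtSpace n => X.snd ^ (1 - s) *
        (((n - s) * a X + 2 * ‖X‖ ^ 2 * d X) * P X ^ 2 - 4 * d X * m X ^ 2) := by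
    intro a d m P ha hd hm hP
    fun_prop
  exact key _ _ _ _ h2 h3 h4 h1.norm

/-- The density involves `ζ` only through its values and its integral, so the identity passes to
bounded pointwise limits of continuous functions. This admits the profile derivative with jumps
needed for sharp radii. -/
lemma integral_pohozaevDensity_of_tendsto (hn : 1 ≤ n) (hs : 0 < s) (hs1 : s < 1)
    (hE : MeasurableSet E) (hρ : 0 < ρ) (hρR : ρ < R)
    (hmin : ∀ F : Set (EuclideanSpace ℝ (Fin n)), MeasurableSet F →
      F ∩ (Metric.ball 0 R)ᶜ = E ∩ (Metric.ball 0 R)ᶜ →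
      localEnergy s (Metric.ball 0 R) E ≤ localEnergy s (Metric.ball 0 R) F)
    (hint : IntegrableOn (fun X => X.snd ^ (1 - s) * ‖extGrad s (signChar E) X‖ ^ 2)
      (halfBall n R))
    {ζ : ℕ → ℝ → ℝ} {ζ₀ : ℝ → ℝ} (hζ : ∀ k, Continuous (ζ k))
    (h0 : ∀ k q, ρ ^ 2 ≤ q → ζ k q = 0) (hM : ∀ k q, |ζ k q| ≤ M)
    (hlim : ∀ q, Tendsto (fun k => ζ k q) atTop (𝓝 (ζ₀ q))) :
    ∫ X in halfBall n R, pohozaevDensity s ρ ζ₀ E X = 0 := by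
  have hM0 : 0 ≤ M := (abs_nonneg _).trans (hM 0 0)
  have hn1 : (1 : ℝ) ≤ n := by exact_mod_cast hn
  have hns : 0 ≤ (n : ℝ) - s := by linarith
  set C : ℝ := (n - s) * (M * (ρ ^ 2 + R ^ 2)) + 2 * R ^ 2 * M + 4 * M with hC
  have hlim' : ∀ X : ExtSpace n, Tendsto (fun k => pohozaevDensity s ρ (ζ k) E X) atTop
      (𝓝 (pohozaevDensity s ρ ζ₀ E X)) := by
    intro X
    have h1 : Tendsto (fun k => ∫ q in ‖X‖ ^ 2..ρ ^ 2, ζ k q) atTop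
        (𝓝 (∫ q in ‖X‖ ^ 2..ρ ^ 2, ζ₀ q)) :=
      intervalIntegral.tendsto_integral_filter_of_dominated_convergence (fun _ => M)
        (Eventually.of_forall fun k => (hζ k).aestronglyMeasurable)
        (Eventually.of_forall fun k => Eventually.of_forall fun q _ => hM k q)
        intervalIntegrable_const (Eventually.of_forall fun q _ => hlim q)
    have h2 := hlim (‖X‖ ^ 2)
    exact ((((h1.neg.const_mul _).add (h2.const_mul _)).mul_const _).sub
      ((h2.const_mul _).mul_const _)).const_mul _
  have hlt := tendsto_integral_of_dominated_convergence (μ := volume.restrict (halfBall n R))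
    (fun X => (C + C * R ^ 2) * (X.snd ^ (1 - s) * ‖extGrad s (signChar E) X‖ ^ 2))
    (fun k => (measurable_pohozaevDensity (s := s) (ρ := ρ) hE (hζ k)).aestronglyMeasurable)
    (hint.const_mul _)
    (fun k => (ae_restrict_iff' (measurableSet_halfBall R)).mpr (Eventually.of_forall
      fun X hX => by
        have hXR : ‖X‖ ^ 2 ≤ R ^ 2 := by
          have := norm_le_of_mem_halfBall hX
          gcongr
        have h1 : |∫ q in ‖X‖ ^ 2..ρ ^ 2, ζ k q| ≤ M * (ρ ^ 2 + R ^ 2) := by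
          refine (intervalIntegral.norm_integral_le_of_norm_le_const (C := M)
            fun q _ => (Real.norm_eq_abs _).le.trans (hM k q)).trans ?_
          refine mul_le_mul_of_nonneg_left ?_ hM0
          rw [abs_le]
          constructor <;> nlinarith [sq_nonneg ‖X‖, sq_nonneg ρ]
        have h2 := hM k (‖X‖ ^ 2)
        rw [Real.norm_eq_abs]
        refine abs_weighted_le hX ?_ ?_
        · refine (abs_add_le _ _).trans ?_
          rw [abs_mul, abs_neg, abs_of_nonneg hns, abs_mul (2 * ‖X‖ ^ 2), abs_of_nonneg
            (by positivity : 0 ≤ 2 * ‖X‖ ^ 2)]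
          have : 2 * ‖X‖ ^ 2 * |ζ k (‖X‖ ^ 2)| ≤ 2 * R ^ 2 * M := by gcongr
          have : (n - s) * |∫ q in ‖X‖ ^ 2..ρ ^ 2, ζ k q| ≤ (n - s) * (M * (ρ ^ 2 + R ^ 2)) := by
            gcongr
          rw [hC]; linarith
        · rw [abs_mul, abs_of_pos (by norm_num : (0 : ℝ) < 4), hC]
          have : 0 ≤ (n - s) * (M * (ρ ^ 2 + R ^ 2)) := by positivity
          have : 0 ≤ 2 * R ^ 2 * M := by positivity
          linarith))
    (Eventually.of_forall hlim')
  refine tendsto_nhds_unique hlt ?_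
  simp_rw [integral_pohozaevDensity_of_continuous hn hs hs1 hE hρ hρR hmin hint (hζ _) (h0 _)]
  exact tendsto_const_nhds

/-- A continuous approximation of the indicator function of `[a, b)`. -/
def trapezoid (a b : ℝ) (k : ℕ) (q : ℝ) : ℝ :=
  max 0 (min 1 (k * (q - a) + 1)) * max 0 (min 1 (k * (b - q)))

lemma continuous_trapezoid (a b : ℝ) (k : ℕ) : Continuous (trapezoid a b k) := by
  unfold trapezoid; fun_prop

lemma trapezoid_mem (a b : ℝ) (k : ℕ) (q : ℝ) : 0 ≤ trapezoid a b k q ∧ trapezoid a b k q ≤ 1 := by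
  have h : ∀ x : ℝ, 0 ≤ max 0 (min 1 x) ∧ max 0 (min 1 x) ≤ 1 := fun x =>
    ⟨le_max_left _ _, max_le zero_le_one (min_le_left _ _)⟩
  exact ⟨mul_nonneg (h _).1 (h _).1, mul_le_one₀ (h _).2 (h _).1 (h _).2⟩

lemma trapezoid_eq_zero {a b q : ℝ} (k : ℕ) (hq : b ≤ q) : trapezoid a b k q = 0 := by
  have h : (k : ℝ) * (b - q) ≤ 0 := mul_nonpos_of_nonneg_of_nonpos (by positivity) (by linarith)
  rw [trapezoid, max_eq_left (min_le_of_right_le h), mul_zero]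

/-- The rising ramp ends at `a` and the falling ramp ends at `b`; hence the limit is `1` at `a` and
`0` at `b`, and each approximant already vanishes from `b` on. -/
lemma tendsto_trapezoid (a b q : ℝ) :
    Tendsto (fun k => trapezoid a b k q) atTop (𝓝 ((Ico a b).indicator 1 q)) := by
  by_cases hqb : q < b
  · obtain ⟨k₁, hk₁⟩ := exists_nat_gt (1 / (b - q))
    have h1 : ∀ k : ℕ, k₁ ≤ k → max 0 (min 1 ((k : ℝ) * (b - q))) = 1 := by
      intro k hk
      have : (k₁ : ℝ) ≤ k := by exact_mod_cast hk
      have h2 : 1 ≤ (k : ℝ) * (b - q) := by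
        rw [← div_le_iff₀ (by linarith)]; linarith
      rw [min_eq_left h2, max_eq_right zero_le_one]
    by_cases hqa : a ≤ q
    · rw [indicator_of_mem (show q ∈ Ico a b from ⟨hqa, hqb⟩)]
      refine tendsto_const_nhds.congr' ?_
      filter_upwards [eventually_ge_atTop k₁] with k hk
      have h2 : (1 : ℝ) ≤ k * (q - a) + 1 := by
        have : 0 ≤ (k : ℝ) * (q - a) := mul_nonneg (by positivity) (by linarith)
        linarith
      rw [trapezoid, h1 k hk, min_eq_left h2, max_eq_right zero_le_one, mul_one, Pi.one_apply]
    · rw [indicator_of_notMem (fun h => hqa h.1)]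
      obtain ⟨k₂, hk₂⟩ := exists_nat_gt (1 / (a - q))
      refine tendsto_const_nhds.congr' ?_
      filter_upwards [eventually_ge_atTop k₂] with k hk
      have : (k₂ : ℝ) ≤ k := by exact_mod_cast hk
      have h2 : 1 ≤ (k : ℝ) * (a - q) := by
        rw [← div_le_iff₀ (by linarith)]; linarith
      rw [trapezoid, max_eq_left (min_le_of_right_le (by linarith)), zero_mul]
  · rw [indicator_of_notMem (fun h => hqb h.2)]
    simp_rw [trapezoid_eq_zero _ (not_lt.mp hqb)]
    exact tendsto_const_nhds

lemma integral_profile {d a b q : ℝ} (hd : 0 < d) (ha : 0 < a) (haq : a ≤ q) (hqb : q ≤ b) :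
    ∫ x in q..b, (Ico a b).indicator (fun x => -(d / 2) * x ^ (-(d / 2) - 1)) x =
      b ^ (-(d / 2)) - q ^ (-(d / 2)) := by
  have hq : 0 < q := by linarith
  have h1 : ∫ x in q..b, (Ico a b).indicator (fun x => -(d / 2) * x ^ (-(d / 2) - 1)) x =
      ∫ x in q..b, -(d / 2) * x ^ (-(d / 2) - 1) := by
    refine intervalIntegral.integral_congr_ae ?_
    have : ∀ᵐ x : ℝ, x ≠ b := by simp [ae_iff, measure_singleton]
    filter_upwards [this] with x hx hx'
    rw [uIoc_of_le hqb] at hx'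
    exact indicator_of_mem (show x ∈ Ico a b from ⟨by linarith [hx'.1], lt_of_le_of_ne hx'.2 hx⟩) _
  have h0 : (0 : ℝ) ∉ uIcc q b := by
    rw [uIcc_of_le hqb]; exact fun h => by linarith [h.1]
  rw [h1, intervalIntegral.integral_const_mul, integral_rpow (Or.inr ⟨by linarith, h0⟩)]
  rw [show -(d / 2) - 1 + 1 = -(d / 2) by ring]
  field_simp

lemma scaledEnergy_eq (hs : 0 < s) (hE : MeasurableSet E) (r : ℝ) : scaledEnergy s E r =
    (∫ X in halfBall n r, X.snd ^ (1 - s) * ‖extGrad s (signChar E) X‖ ^ 2) /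
      r ^ ((n : ℝ) - s) := by
  rw [scaledEnergy, show (n : ℝ) + (1 - s) - 1 = n - s by ring]
  congr 1
  refine setIntegral_congr_fun (measurableSet_halfBall r) fun X hX => ?_
  simp only [energyDensity]
  rw [gradient_csExtension hs (measurable_signChar hE) (abs_signChar_le E) hX.2]

lemma halfBall_mono {r r' : ℝ} (h : r ≤ r') : halfBall n r ⊆ halfBall n r' :=
  inter_subset_inter_left _ (Metric.ball_subset_ball h)

/-- The profile is `q^{-d/2} - b^{-d/2}` on `[a, b)`, constant below `a` and zero from `b` on. The
power solves `d η + 2 q η' = 0`, so in the annulus the coefficient of `|∇U|²` reduces to the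
constant `-d b^{-d/2}`. The inner ball carries `d (a^{-d/2} - b^{-d/2})`, and the sum is `d` times
the difference of scaled energies, up to sign, plus the radial term. -/
theorem scaledEnergy_sub (hn : 1 ≤ n) (hs : 0 < s) (hs1 : s < 1)
    (hE : MeasurableSet E)
    (hmin : ∀ F : Set (EuclideanSpace ℝ (Fin n)), MeasurableSet F →
      F ∩ (Metric.ball 0 R)ᶜ = E ∩ (Metric.ball 0 R)ᶜ →
      localEnergy s (Metric.ball 0 R) E ≤ localEnergy s (Metric.ball 0 R) F)
    (hint : IntegrableOn (fun X => X.snd ^ (1 - s) * ‖extGrad s (signChar E) X‖ ^ 2)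
      (halfBall n R)) {r₁ r₂ : ℝ} (h₁ : 0 < r₁) (h₁₂ : r₁ < r₂) (h₂ : r₂ < R) :
    IntegrableOn (fun X => X.snd ^ (1 - s) * (‖X‖ ^ 2) ^ (-((n - s) / 2) - 1) *
      inner ℝ X (extGrad s (signChar E) X) ^ 2) (halfBall n r₂ \ halfBall n r₁) ∧
    scaledEnergy s E r₂ - scaledEnergy s E r₁ =
      2 * ∫ X in halfBall n r₂ \ halfBall n r₁, X.snd ^ (1 - s) *
        (‖X‖ ^ 2) ^ (-((n - s) / 2) - 1) * inner ℝ X (extGrad s (signChar E) X) ^ 2 := by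
  set d : ℝ := n - s with hd
  have hd0 : 0 < d := by
    have hn1 : (1 : ℝ) ≤ n := by exact_mod_cast hn
    rw [hd]; linarith
  set a : ℝ := r₁ ^ 2 with ha
  set b : ℝ := r₂ ^ 2 with hb
  have ha0 : 0 < a := by positivity
  have h0₂ : 0 < r₂ := h₁.trans h₁₂
  have hab : a < b := by rw [ha, hb]; gcongr
  set P : ExtSpace n → ℝ := fun X => X.snd ^ (1 - s) * ‖extGrad s (signChar E) X‖ ^ 2 with hP
  set Q : ExtSpace n → ℝ := fun X => X.snd ^ (1 - s) * (‖X‖ ^ 2) ^ (-(d / 2) - 1) *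
      inner ℝ X (extGrad s (signChar E) X) ^ 2 with hQ
  set ζ₀ : ℝ → ℝ := (Ico a b).indicator (fun x => -(d / 2) * x ^ (-(d / 2) - 1)) with hζ₀
  have hmax : ∀ q, 0 < max q a := fun q => ha0.trans_le (le_max_right _ _)
  -- Replacing `q` by `max q a` in the power leaves the limit unchanged, since the indicator
  -- vanishes below `a`, and keeps the approximants continuous and bounded across `q = 0`.
  have hzero := integral_pohozaevDensity_of_tendsto (M := d / 2 * a ^ (-(d / 2) - 1))
    (ζ := fun k q => trapezoid a b k q * (-(d / 2) * (max q a) ^ (-(d / 2) - 1))) (ζ₀ := ζ₀)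
    hn hs hs1 hE h0₂ h₂ hmin hint
    (fun k => (continuous_trapezoid a b k).mul (continuous_const.mul
      ((continuous_id.max continuous_const).rpow_const fun q => Or.inl (hmax q).ne')))
    (fun k q hq => by rw [trapezoid_eq_zero k hq, zero_mul])
    (fun k q => by
      have h1 := trapezoid_mem a b k q
      have h2 : (max q a) ^ (-(d / 2) - 1) ≤ a ^ (-(d / 2) - 1) :=
        Real.rpow_le_rpow_of_nonpos ha0 (le_max_right _ _) (by linarith)
      have h3 := Real.rpow_nonneg (hmax q).le (-(d / 2) - 1)
      rw [abs_mul, abs_mul, abs_neg, abs_of_nonneg h1.1, abs_of_pos (by positivity : 0 < d / 2),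
        abs_of_nonneg h3]
      calc _ ≤ 1 * (d / 2 * (max q a) ^ (-(d / 2) - 1)) := by gcongr; exact h1.2
        _ ≤ _ := by rw [one_mul]; gcongr)
    (fun q => by
      have h1 := (tendsto_trapezoid a b q).mul_const (-(d / 2) * (max q a) ^ (-(d / 2) - 1))
      convert h1 using 2
      by_cases hq : q ∈ Ico a b
      · rw [hζ₀, indicator_of_mem hq, indicator_of_mem hq, max_eq_left hq.1, Pi.one_apply, one_mul]
      · rw [hζ₀, indicator_of_notMem hq, indicator_of_notMem hq, zero_mul])
  set A := halfBall n r₁ with hA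
  set B := halfBall n r₂ \ halfBall n r₁ with hB
  have hAm : MeasurableSet A := measurableSet_halfBall r₁
  have hBm : MeasurableSet B := (measurableSet_halfBall r₂).diff hAm
  have hAB : A ∪ B = halfBall n r₂ := union_sdiff_cancel (halfBall_mono h₁₂.le)
  have hdisj : Disjoint A B := disjoint_sdiff_right
  have hsub : halfBall n r₂ ⊆ halfBall n R := halfBall_mono h₂.le
  have hnormA : ∀ X ∈ A, ‖X‖ ^ 2 < a := fun X hX => by
    have : ‖X‖ < r₁ := by simpa using hX.1
    rw [ha]; gcongr
  have hnormB : ∀ X ∈ B, a ≤ ‖X‖ ^ 2 ∧ ‖X‖ ^ 2 < b := fun X hX => by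
    have h1 : ‖X‖ < r₂ := by simpa using hX.1.1
    have h2 : r₁ ≤ ‖X‖ := by
      by_contra h
      exact hX.2 ⟨by simpa using lt_of_not_ge h, hX.1.2⟩
    rw [ha, hb]
    exact ⟨by gcongr, by gcongr⟩
  have hQint : IntegrableOn Q B := by
    have hm : Measurable Q := by
      refine ((measurable_snd_ext.pow_const _).mul ((measurable_norm.pow_const 2).pow_const _)).mul
        ((measurable_id.inner (measurable_extGrad (measurable_signChar hE))).pow_const 2)
    refine ((hint.mono_set (sdiff_subset.trans hsub)).const_mul
      (a ^ (-(d / 2) - 1) * R ^ 2)).mono' hm.aestronglyMeasurable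
      ((ae_restrict_iff' hBm).mpr (Eventually.of_forall fun X hX => ?_))
    have hX0 : 0 < X.snd := hX.1.2
    have h1 := sq_inner_le (v := extGrad s (signChar E) X)
      (norm_le_of_mem_halfBall (hsub hX.1))
    have h2 : (‖X‖ ^ 2) ^ (-(d / 2) - 1) ≤ a ^ (-(d / 2) - 1) :=
      Real.rpow_le_rpow_of_nonpos ha0 (hnormB X hX).1 (by linarith)
    rw [Real.norm_of_nonneg (by positivity)]
    calc Q X ≤ X.snd ^ (1 - s) * a ^ (-(d / 2) - 1) *
          (R ^ 2 * ‖extGrad s (signChar E) X‖ ^ 2) := by simp only [hQ]; gcongr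
      _ = _ := by ring
  have hdA : ∀ X ∈ A, pohozaevDensity s r₂ ζ₀ E X =
      d * (a ^ (-(d / 2)) - b ^ (-(d / 2))) * P X := by
    intro X hX
    have hq := hnormA X hX
    have h1 : ζ₀ (‖X‖ ^ 2) = 0 := indicator_of_notMem (fun h => absurd h.1 (not_le.mpr hq)) _
    have hbd : ∀ x y : ℝ, IntervalIntegrable ζ₀ volume x y := fun x y => by
      rw [intervalIntegrable_iff]
      refine IntegrableOn.of_bound (C := d / 2 * a ^ (-(d / 2) - 1)) (by simp) ?_ ?_
      · exact ((measurable_const.mul (measurable_id.pow_const _)).indicator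
          measurableSet_Ico).aestronglyMeasurable
      · refine Eventually.of_forall fun q => ?_
        by_cases hq : q ∈ Ico a b
        · have hq0 : 0 < q := ha0.trans_le hq.1
          rw [hζ₀, indicator_of_mem hq, norm_mul, norm_neg, Real.norm_of_nonneg (by positivity),
            Real.norm_of_nonneg (by positivity)]
          gcongr ?_ * ?_
          exact Real.rpow_le_rpow_of_nonpos ha0 hq.1 (by linarith)
        · rw [hζ₀, indicator_of_notMem hq, norm_zero]
          positivity
    have h2 : ∫ q in ‖X‖ ^ 2..b, ζ₀ q = b ^ (-(d / 2)) - a ^ (-(d / 2)) := by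
      rw [← intervalIntegral.integral_add_adjacent_intervals (hbd (‖X‖ ^ 2) a) (hbd a b),
        integral_profile hd0 ha0 le_rfl hab.le]
      have : ∫ q in ‖X‖ ^ 2..a, ζ₀ q = 0 := by
        refine (intervalIntegral.integral_congr_ae ?_).trans intervalIntegral.integral_zero
        have : ∀ᵐ x : ℝ, x ≠ a := by simp [ae_iff, measure_singleton]
        filter_upwards [this] with x hx hx'
        rw [uIoc_of_le hq.le] at hx'
        exact indicator_of_notMem (fun h => hx (le_antisymm hx'.2 h.1)) _
      rw [this, zero_add]
    rw [pohozaevDensity, h1, h2, hP]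
    ring
  have hdB : ∀ X ∈ B, pohozaevDensity s r₂ ζ₀ E X =
      -(d * b ^ (-(d / 2))) * P X + 2 * d * Q X := by
    intro X hX
    obtain ⟨hq, hq'⟩ := hnormB X hX
    have h1 : ζ₀ (‖X‖ ^ 2) = -(d / 2) * (‖X‖ ^ 2) ^ (-(d / 2) - 1) := 
      indicator_of_mem (show ‖X‖ ^ 2 ∈ Ico a b from ⟨hq, hq'⟩) _
    have h2 := integral_profile hd0 ha0 hq hq'.le
    have h3 : (‖X‖ ^ 2) ^ (-(d / 2)) = (‖X‖ ^ 2) ^ (-(d / 2) - 1) * ‖X‖ ^ 2 := by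
      have : ‖X‖ ^ 2 ≠ 0 := by linarith
      rw [Real.rpow_sub_one this, div_mul_cancel₀ _ this]
    rw [pohozaevDensity, h1, h2, h3, hP, hQ]
    ring
  have hdO : ∀ X ∈ halfBall n R \ halfBall n r₂, pohozaevDensity s r₂ ζ₀ E X = 0 := by
    intro X hX
    have h1 : r₂ ≤ ‖X‖ := by
      by_contra h
      exact hX.2 ⟨by simpa using lt_of_not_ge h, hX.1.2⟩
    have hq : b ≤ ‖X‖ ^ 2 := by rw [hb]; gcongr
    have h2 : ζ₀ (‖X‖ ^ 2) = 0 := indicator_of_notMem (fun h => absurd h.2 (not_lt.mpr hq)) _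
    have h3 : ∫ q in ‖X‖ ^ 2..b, ζ₀ q = 0 := by
      rw [intervalIntegral.integral_symm, neg_eq_zero]
      refine (intervalIntegral.integral_congr fun x hx => ?_).trans intervalIntegral.integral_zero
      rw [uIcc_of_le hq] at hx
      exact indicator_of_notMem (fun h => absurd h.2 (not_lt.mpr hx.1)) _
    rw [pohozaevDensity, h2, h3]
    ring
  have hPA : IntegrableOn P A := hint.mono_set ((halfBall_mono h₁₂.le).trans hsub)
  have hPB : IntegrableOn P B := hint.mono_set (sdiff_subset.trans hsub)
  have hiA : IntegrableOn (pohozaevDensity s r₂ ζ₀ E) A :=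
    IntegrableOn.congr_fun (hPA.const_mul _) (fun X hX => (hdA X hX).symm) hAm
  have hiB : IntegrableOn (pohozaevDensity s r₂ ζ₀ E) B :=
    IntegrableOn.congr_fun ((hPB.const_mul _).add (hQint.const_mul _))
      (fun X hX => (hdB X hX).symm) hBm
  have hG2 : ∫ X in halfBall n r₂, P X = (∫ X in A, P X) + ∫ X in B, P X := by
    rw [← hAB, setIntegral_union hdisj hBm hPA hPB]
  rw [setIntegral_eq_of_subset_of_forall_sdiff_eq_zero (measurableSet_halfBall R) hsub hdO,
    ← hAB, setIntegral_union hdisj hBm hiA hiB, setIntegral_congr_fun hAm hdA,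
    setIntegral_congr_fun hBm hdB, integral_add (hPB.const_mul _) (hQint.const_mul _),
    integral_const_mul, integral_const_mul, integral_const_mul] at hzero
  refine ⟨hQint, ?_⟩
  have hpow : ∀ r : ℝ, 0 < r → (r ^ 2) ^ (-(d / 2)) = (r ^ d)⁻¹ := fun r hr => by
    rw [← Real.rpow_natCast, ← Real.rpow_mul hr.le, ← Real.rpow_neg hr.le]
    congr 1; push_cast; ring
  rw [ha, hb, hpow r₁ h₁, hpow r₂ h0₂] at hzero
  rw [scaledEnergy_eq hs hE, scaledEnergy_eq hs hE, ← hd, hG2, div_eq_mul_inv, div_eq_mul_inv]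
  refine mul_left_cancel₀ hd0.ne' ?_
  linarith

end identity

/-! ### Analyticity along rays -/

section ray

variable {g : EuclideanSpace ℝ (Fin n) → ℝ} {b : ℝ}

/-- The complexification in `w` of `|wX - (y, 0)|²`. -/
def raySq (X : ExtSpace n) (y : EuclideanSpace ℝ (Fin n)) (w : ℂ) : ℂ :=
  w ^ 2 * (‖X‖ ^ 2 : ℝ) - 2 * w * (inner ℝ X.fst y : ℝ) + (‖y‖ ^ 2 : ℝ)

lemma raySq_ofReal (X : ExtSpace n) (y : EuclideanSpace ℝ (Fin n)) (t : ℝ) :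
    raySq X y t = ((‖t • X - bdry y‖ ^ 2 : ℝ) : ℂ) := by
  have h : ‖t • X - bdry y‖ ^ 2 = t ^ 2 * ‖X‖ ^ 2 - 2 * t * inner ℝ X.fst y + ‖y‖ ^ 2 := by
    rw [norm_sub_sq_real, norm_smul, inner_smul_left, norm_bdry, mul_pow, Real.norm_eq_abs, sq_abs,
      inner_ext]
    simp
    ring
  rw [h, raySq]
  push_cast
  ring

/-- At the real point `t₀` the height `t₀ z > 0` gives a lower bound proportional to `1 + |y|²`. A
complex perturbation changes the polynomial by at most a small multiple of `1 + |y|²`, since `y`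
enters its increment only linearly. -/
lemma exists_re_raySq_ge {X : ExtSpace n} (hX : 0 < X.snd) {t₀ : ℝ} (ht₀ : 0 < t₀) :
    ∃ δ c : ℝ, 0 < δ ∧ 0 < c ∧ ∀ w ∈ Metric.ball (t₀ : ℂ) δ, ∀ y : EuclideanSpace ℝ (Fin n),
      c * (1 + ‖y‖ ^ 2) ≤ (raySq X y w).re := by
  set B : ℝ := t₀ ^ 2 * X.snd ^ 2 with hB
  have hB0 : 0 < B := by positivity
  -- The denominator contains `2B` so that `2 c₀ ≤ 1`, which lets the horizontal square be absorbed.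
  set c₀ : ℝ := B / (1 + 2 * t₀ ^ 2 * ‖X.fst‖ ^ 2 + 2 * B) with hc₀
  have hc₀pos : 0 < c₀ := by positivity
  have hc₀eq : c₀ * (1 + 2 * t₀ ^ 2 * ‖X.fst‖ ^ 2) + 2 * c₀ * B = B := by
    rw [hc₀]; field_simp
  have hc₀2 : 2 * c₀ ≤ 1 := by
    have : 0 ≤ c₀ * (1 + 2 * t₀ ^ 2 * ‖X.fst‖ ^ 2) := by positivity
    nlinarith
  have hbase : ∀ y : EuclideanSpace ℝ (Fin n), c₀ * (1 + ‖y‖ ^ 2) ≤ ‖t₀ • X - bdry y‖ ^ 2 := by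
    intro y
    have h1 : ‖t₀ • X - bdry y‖ ^ 2 = ‖t₀ • X.fst - y‖ ^ 2 + B := by
      rw [norm_sq_sub_bdry, hB]; simp; ring
    have h2 : ‖y‖ ^ 2 ≤ 2 * ‖t₀ • X.fst - y‖ ^ 2 + 2 * (t₀ ^ 2 * ‖X.fst‖ ^ 2) := by
      have h3 : ‖y‖ ≤ ‖t₀ • X.fst - y‖ + t₀ * ‖X.fst‖ := by
        have := norm_sub_norm_le y (t₀ • X.fst)
        rw [norm_sub_rev, norm_smul, Real.norm_of_nonneg ht₀.le] at this
        linarith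
      have h4 : ‖y‖ ^ 2 ≤ (‖t₀ • X.fst - y‖ + t₀ * ‖X.fst‖) ^ 2 := by gcongr
      nlinarith [sq_nonneg (‖t₀ • X.fst - y‖ - t₀ * ‖X.fst‖)]
    rw [h1]
    have h5 : c₀ * ‖y‖ ^ 2 ≤ c₀ * (2 * ‖t₀ • X.fst - y‖ ^ 2 + 2 * (t₀ ^ 2 * ‖X.fst‖ ^ 2)) := by
      gcongr
    have h6 : 2 * c₀ * ‖t₀ • X.fst - y‖ ^ 2 ≤ 1 * ‖t₀ • X.fst - y‖ ^ 2 := by gcongr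
    nlinarith
  set C : ℝ := 2 * t₀ * ‖X‖ ^ 2 + ‖X‖ ^ 2 + ‖X‖ + 1 with hC
  have hCpos : 0 < C := by positivity
  refine ⟨min 1 (c₀ / (2 * C)), c₀ / 2, by positivity, by positivity, fun w hw y => ?_⟩
  set h : ℂ := w - t₀ with hh
  have hδ : ‖h‖ < min 1 (c₀ / (2 * C)) := by simpa [dist_eq_norm] using hw
  have hδ1 : ‖h‖ ≤ 1 := (hδ.trans_le (min_le_left _ _)).le
  have hδ2 : ‖h‖ * C ≤ c₀ / 2 := by
    have := (hδ.trans_le (min_le_right _ _)).le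
    rw [le_div_iff₀ (by positivity)] at this
    linarith
  have hexp : raySq X y w = ((‖t₀ • X - bdry y‖ ^ 2 : ℝ) : ℂ) +
      (h * ((2 * t₀ * ‖X‖ ^ 2 - 2 * inner ℝ X.fst y : ℝ) : ℂ) + h ^ 2 * (‖X‖ ^ 2 : ℝ)) := by
    rw [← raySq_ofReal, show w = t₀ + h by rw [hh]; ring, raySq, raySq]
    push_cast
    ring
  have hin : |inner ℝ X.fst y| ≤ ‖X‖ * ‖y‖ :=
    (abs_real_inner_le_norm _ _).trans (by gcongr; exact norm_fst_le X)
  have hpert : ‖h * ((2 * t₀ * ‖X‖ ^ 2 - 2 * inner ℝ X.fst y : ℝ) : ℂ) +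
      h ^ 2 * (‖X‖ ^ 2 : ℝ)‖ ≤ c₀ / 2 * (1 + ‖y‖ ^ 2) := by
    calc _ ≤ ‖h‖ * (2 * t₀ * ‖X‖ ^ 2 + 2 * (‖X‖ * ‖y‖)) + ‖h‖ * 1 * ‖X‖ ^ 2 := by
          refine (norm_add_le _ _).trans ?_
          rw [norm_mul, norm_mul, norm_pow, Complex.norm_real, Complex.norm_real,
            Real.norm_of_nonneg (sq_nonneg ‖X‖), Real.norm_eq_abs, sq ‖h‖]
          gcongr
          refine (abs_sub _ _).trans ?_
          rw [abs_mul 2 (inner ℝ X.fst y), abs_two, abs_of_nonneg (by positivity)]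
          gcongr
      _ ≤ ‖h‖ * C * (1 + ‖y‖ ^ 2) := by
          have h1 : 2 * (‖X‖ * ‖y‖) ≤ ‖X‖ * (1 + ‖y‖ ^ 2) := by
            nlinarith [norm_nonneg X, sq_nonneg (‖y‖ - 1),
              mul_nonneg (norm_nonneg X) (sq_nonneg (‖y‖ - 1))]
          have h2 : (2 * t₀ * ‖X‖ ^ 2 + ‖X‖ ^ 2 + 1) * 1 ≤
              (2 * t₀ * ‖X‖ ^ 2 + ‖X‖ ^ 2 + 1) * (1 + ‖y‖ ^ 2) := by
            gcongr; linarith [sq_nonneg ‖y‖]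
          have h3 : 2 * t₀ * ‖X‖ ^ 2 + 2 * (‖X‖ * ‖y‖) + ‖X‖ ^ 2 ≤ C * (1 + ‖y‖ ^ 2) := by
            rw [hC]; linarith
          calc _ = ‖h‖ * (2 * t₀ * ‖X‖ ^ 2 + 2 * (‖X‖ * ‖y‖) + ‖X‖ ^ 2) := by ring
            _ ≤ ‖h‖ * (C * (1 + ‖y‖ ^ 2)) := by gcongr
            _ = _ := by ring
      _ ≤ c₀ / 2 * (1 + ‖y‖ ^ 2) := by gcongr
  have hre := (abs_le.mp ((Complex.abs_re_le_norm _).trans hpert)).1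
  rw [hexp, Complex.add_re, Complex.ofReal_re]
  linarith [hbase y]

/-- A positive real part keeps the base in the slit plane, so the integrand is holomorphic in `w`,
and the quadratic lower bound supplies an integrable majorant. -/
lemma differentiableOn_integral_raySq (hs : 0 < s) (hg : Measurable g) (hb : ∀ y, |g y| ≤ b)
    {X : ExtSpace n} {S : Set ℂ} (hS : IsOpen S) {c : ℝ} (hc : 0 < c)
    (hQ : ∀ w ∈ S, ∀ y : EuclideanSpace ℝ (Fin n), c * (1 + ‖y‖ ^ 2) ≤ (raySq X y w).re) :
    DifferentiableOn ℂ
      (fun w => ∫ y, raySq X y w ^ (((-((n : ℝ) + s) / 2 : ℝ) : ℂ)) * (g y : ℂ)) S := by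
  set α : ℝ := -((n : ℝ) + s) / 2 with hα
  have hα0 : α ≤ 0 := by rw [hα]; have : (0 : ℝ) ≤ n := by positivity
                         linarith
  set F : ℂ → EuclideanSpace ℝ (Fin n) → ℂ := fun w y => raySq X y w ^ (α : ℂ) * (g y : ℂ) with hF
  set F' : ℂ → EuclideanSpace ℝ (Fin n) → ℂ := fun w y =>
    (α * raySq X y w ^ ((α : ℂ) - 1) * (2 * w * (‖X‖ ^ 2 : ℝ) - 2 * (inner ℝ X.fst y : ℝ))) *
      (g y : ℂ) with hF'
  have hslit : ∀ w ∈ S, ∀ y, raySq X y w ∈ Complex.slitPlane := fun w hw y =>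
    Or.inl ((by positivity : 0 < c * (1 + ‖y‖ ^ 2)).trans_le (hQ w hw y))
  have hder : ∀ w ∈ S, ∀ y, HasDerivAt (fun w => F w y) (F' w y) w := by
    intro w hw y
    have h1 : HasDerivAt (raySq X y) (2 * w * (‖X‖ ^ 2 : ℝ) - 2 * (inner ℝ X.fst y : ℝ)) w := by
      refine HasDerivAt.congr_deriv (((((hasDerivAt_id' w).pow 2).mul_const _).sub
        (((hasDerivAt_id' w).const_mul 2).mul_const _)).add_const _) ?_
      simp
    exact (h1.cpow_const (hslit w hw y)).mul_const _
  have hmQ : ∀ w, Measurable fun y => raySq X y w := fun w => by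
    unfold raySq
    fun_prop
  have hFm : ∀ w, Measurable (F w) := fun w =>
    ((hmQ w).pow_const _).mul (Complex.measurable_ofReal.comp hg)
  have hF'm : ∀ w, Measurable (F' w) := fun w => by
    refine (((measurable_const.mul ((hmQ w).pow_const _)).mul ?_)).mul
      (Complex.measurable_ofReal.comp hg)
    fun_prop
  set bd : EuclideanSpace ℝ (Fin n) → ℝ := fun y => c ^ α * (‖y‖ ^ 2 + 1 ^ 2) ^ α * b with hbd
  have hbdi : Integrable bd := ((integrable_rad one_pos hs).const_mul _).mul_const _
  have hFb : ∀ w ∈ S, ∀ y, ‖F w y‖ ≤ bd y := by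
    intro w hw y
    have h1 : c * (1 + ‖y‖ ^ 2) ≤ ‖raySq X y w‖ := (hQ w hw y).trans (Complex.re_le_norm _)
    have h2 : 0 < c * (1 + ‖y‖ ^ 2) := by positivity
    simp only [hF, hbd]
    rw [norm_mul, Complex.norm_cpow_real, Complex.norm_real, Real.norm_eq_abs,
      ← Real.mul_rpow hc.le (by positivity)]
    refine mul_le_mul ?_ (hb y) (abs_nonneg _) (by positivity)
    refine Real.rpow_le_rpow_of_nonpos (by positivity) ?_ hα0
    linarith
  intro w₀ hw₀
  obtain ⟨ε, hε, hεS⟩ := Metric.isOpen_iff.mp hS w₀ hw₀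
  have hε2 : 0 < ε / 2 := by positivity
  have hsub : ∀ w ∈ Metric.ball w₀ (ε / 2), Metric.closedBall w (ε / 2) ⊆ S := by
    intro w hw v hv
    refine hεS ?_
    rw [Metric.mem_ball] at hw ⊢
    rw [Metric.mem_closedBall] at hv
    linarith [dist_triangle v w w₀]
  have := hasDerivAt_integral_of_dominated_loc_of_deriv_le (𝕜 := ℂ) (μ := volume) (F := F)
    (F' := F') (x₀ := w₀) (bound := fun y => bd y / (ε / 2)) (Metric.ball_mem_nhds w₀ hε2)
    (Eventually.of_forall fun w => (hFm w).aestronglyMeasurable)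
    (hbdi.mono' (hFm w₀).aestronglyMeasurable (Eventually.of_forall (hFb w₀ hw₀)))
    (hF'm w₀).aestronglyMeasurable
    (Eventually.of_forall fun y w hw => by
      have hwS : w ∈ S := hsub w hw (Metric.mem_closedBall_self hε2.le)
      rw [← (hder w hwS y).deriv]
      -- Cauchy's estimate on a disc of radius `ε/2` bounds the derivative by the majorant of the
      -- function itself.
      refine Complex.norm_deriv_le_of_forall_mem_sphere_norm_le hε2 ?_ fun v hv =>
        hFb v (hsub w hw (Metric.sphere_subset_closedBall hv)) y
      refine DifferentiableOn.diffContOnCl fun v hv => ?_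
      rw [closure_ball _ hε2.ne'] at hv
      exact (hder v (hsub w hw hv) y).differentiableAt.differentiableWithinAt)
    (hbdi.div_const _)
    (Eventually.of_forall fun y w hw =>
      hder w (hsub w hw (Metric.mem_closedBall_self hε2.le)) y)
  exact this.2.differentiableAt.differentiableWithinAt

/-- On real `t` near `t₀` the extension agrees with the real part of a holomorphic function, namely
a complex power of the height times the complexified integral. -/
lemma analyticAt_csExtension_ray (hs : 0 < s) (hg : Measurable g) (hb : ∀ y, |g y| ≤ b)
    {X : ExtSpace n} (hX : X ∈ upperHalf n) {t₀ : ℝ} (ht₀ : 0 < t₀) :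
    AnalyticAt ℝ (fun t : ℝ => csExtension s g (t • X)) t₀ := by
  have hX0 : 0 < X.snd := hX
  obtain ⟨δ, c, hδ, hc, hQ⟩ := exists_re_raySq_ge hX0 ht₀
  have h1 : AnalyticAt ℂ (fun w => ∫ y, raySq X y w ^ (((-((n : ℝ) + s) / 2 : ℝ) : ℂ)) *
      (g y : ℂ)) (t₀ : ℂ) :=
    (differentiableOn_integral_raySq hs hg hb Metric.isOpen_ball hc hQ).analyticAt
      (Metric.ball_mem_nhds _ hδ)
  have h2 : AnalyticAt ℂ (fun w : ℂ => (poissonConst n s : ℂ) * (w * X.snd) ^ (s : ℂ)) (t₀ : ℂ) := by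
    refine analyticAt_const.mul ((analyticAt_id.mul analyticAt_const).cpow analyticAt_const ?_)
    rw [Pi.mul_apply]
    show ((t₀ : ℂ) * (X.snd : ℂ)) ∈ Complex.slitPlane
    rw [← Complex.ofReal_mul]
    exact Complex.ofReal_mem_slitPlane.mpr (by positivity)
  refine (h2.mul h1).re_ofReal.congr ?_
  filter_upwards [lt_mem_nhds ht₀] with t ht
  have h3 : ∀ y, raySq X y t ^ (((-((n : ℝ) + s) / 2 : ℝ) : ℂ)) * (g y : ℂ) =
      (((‖t • X - bdry y‖ ^ 2) ^ (-((n : ℝ) + s) / 2) * g y : ℝ) : ℂ) := by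
    intro y
    rw [raySq_ofReal, ← Complex.ofReal_cpow (sq_nonneg _), Complex.ofReal_mul]
  rw [Pi.mul_apply, integral_congr_ae (Eventually.of_forall h3), integral_complex_ofReal, ← Complex.ofReal_mul, ← Complex.ofReal_cpow (by positivity),
    ← Complex.ofReal_mul, ← Complex.ofReal_mul, Complex.ofReal_re, csExtension_eq,
    ← integral_const_mul]
  refine integral_congr_ae (Eventually.of_forall fun y => ?_)
  simp only [baseKernel]
  rw [show (t • X - bdry y).snd = t * X.snd by simp]
  ring

end ray

/-! ### Monotonicity and the case of equality -/

lemma hasDerivAt_ray {H : Type*} [NormedAddCommGroup H] [InnerProductSpace ℝ H] [CompleteSpace H]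
    {U : H → ℝ} {G X : H} {t : ℝ} (h : HasGradientAt U G (t • X)) :
    HasDerivAt (fun t : ℝ => U (t • X)) (inner ℝ G X) t := by
  have h1 : HasDerivAt (fun t : ℝ => t • X) X t := by
    simpa using (hasDerivAt_id t).smul_const X
  have := h.hasFDerivAt.comp_hasDerivAt t h1
  rwa [InnerProductSpace.toDual_apply_apply] at this

lemma smul_mem_upperHalf {X : ExtSpace n} (hX : X ∈ upperHalf n) {t : ℝ} (ht : 0 < t) :
    t • X ∈ upperHalf n := by
  have hX0 : 0 < X.snd := hX
  show 0 < (t • X).snd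
  rw [WithLp.smul_snd, smul_eq_mul]
  positivity

section

variable {g : EuclideanSpace ℝ (Fin n) → ℝ} {b R : ℝ}

/-- Along each ray the extension is constant while inside the half-ball of radius `R`; analyticity
in `t` carries the constancy to the entire ray. -/
lemma isHomogeneousZero_of_radial_derivative (hs : 0 < s) (hg : Measurable g)
    (hb : ∀ y, |g y| ≤ b) (hR : 0 < R)
    (h0 : ∀ X ∈ halfBall n R, inner ℝ X (extGrad s g X) = 0) :
    IsHomogeneousZero (csExtension (n := n) s g) := by
  intro X hX
  have hX0 : 0 < ‖X‖ := (show 0 < X.snd from hX).trans_le ((le_abs_self _).trans (abs_snd_le X))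
  set f : ℝ → ℝ := fun t => csExtension s g (t • X) with hf
  have hder : ∀ t, 0 < t → HasDerivAt f (inner ℝ (extGrad s g (t • X)) X) t := fun t ht =>
    hasDerivAt_ray (hasGradientAt_csExtension hs hg hb (smul_mem_upperHalf hX ht))
  have hsmall : ∀ t ∈ Ioo 0 (R / ‖X‖), deriv f t = 0 := by
    intro t ht
    have h1 : t • X ∈ halfBall n R := by
      refine ⟨?_, smul_mem_upperHalf hX ht.1⟩
      rw [mem_ball_zero_iff, norm_smul, Real.norm_of_nonneg ht.1.le, ← lt_div_iff₀ hX0]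
      exact ht.2
    have h2 := h0 _ h1
    rw [inner_smul_left, conj_trivial, mul_eq_zero, or_iff_right ht.1.ne'] at h2
    rw [(hder t ht.1).deriv, real_inner_comm, h2]
  have hRX : 0 < R / ‖X‖ := by positivity
  set τ : ℝ := R / ‖X‖ / 2 with hτ
  have hτ' : τ ∈ Ioo 0 (R / ‖X‖) := ⟨by positivity, by linarith⟩
  have hconst : ∀ t ∈ Ioo 0 (R / ‖X‖), f t = f τ := fun t ht =>
    isOpen_Ioo.is_const_of_deriv_eq_zero isPreconnected_Ioo
      (fun t ht => (hder t ht.1).differentiableAt.differentiableWithinAt) hsmall ht hτ'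
  have hana : AnalyticOnNhd ℝ f (Ioi 0) := fun t ht =>
    analyticAt_csExtension_ray hs hg hb hX ht
  have hall : EqOn f (fun _ => f τ) (Ioi 0) :=
    hana.eqOn_of_preconnected_of_eventuallyEq analyticOnNhd_const isPreconnected_Ioi
      (show τ ∈ Ioi 0 from hτ'.1)
      (by filter_upwards [isOpen_Ioo.mem_nhds hτ'] with t ht using hconst t ht)
  intro t ht
  have h1 : f t = f 1 := (hall ht).trans (hall (show (1 : ℝ) ∈ Ioi 0 from zero_lt_one' ℝ)).symm
  simpa [hf] using h1

lemma radial_derivative_of_isHomogeneousZero (hs : 0 < s) (hg : Measurable g)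
    (hb : ∀ y, |g y| ≤ b) (h : IsHomogeneousZero (csExtension (n := n) s g)) {X : ExtSpace n}
    (hX : X ∈ upperHalf n) : inner ℝ X (extGrad s g X) = 0 := by
  have h1 : HasDerivAt (fun t : ℝ => csExtension s g (t • X)) (inner ℝ (extGrad s g X) X) 1 :=
    hasDerivAt_ray (by rw [one_smul]; exact hasGradientAt_csExtension hs hg hb hX)
  have h2 : HasDerivAt (fun t : ℝ => csExtension s g (t • X)) 0 1 := by
    refine (hasDerivAt_const 1 (csExtension s g X)).congr_of_eventuallyEq ?_
    filter_upwards [lt_mem_nhds (zero_lt_one' ℝ)] with t ht using h X hX t ht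
  rw [real_inner_comm, h1.unique h2]

end

section monotone

variable {R : ℝ} {E : Set (EuclideanSpace ℝ (Fin n))}

/-- Equal values at two radii make the integral of a nonnegative density zero. The density then
vanishes almost everywhere, hence everywhere on the open half-annulus by continuity, and its weights
are positive. -/
lemma radial_derivative_of_scaledEnergy_eq (hn : 1 ≤ n) (hs : 0 < s) (hs1 : s < 1)
    (hE : MeasurableSet E)
    (hmin : ∀ F : Set (EuclideanSpace ℝ (Fin n)), MeasurableSet F →
      F ∩ (Metric.ball 0 R)ᶜ = E ∩ (Metric.ball 0 R)ᶜ →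
      localEnergy s (Metric.ball 0 R) E ≤ localEnergy s (Metric.ball 0 R) F)
    (hint : IntegrableOn (fun X => X.snd ^ (1 - s) * ‖extGrad s (signChar E) X‖ ^ 2)
      (halfBall n R)) {r₁ r₂ : ℝ} (h₁ : 0 < r₁) (h₁₂ : r₁ < r₂) (h₂ : r₂ < R)
    (heq : scaledEnergy s E r₁ = scaledEnergy s E r₂) {X : ExtSpace n} (hX : X ∈ upperHalf n)
    (hX₁ : r₁ < ‖X‖) (hX₂ : ‖X‖ < r₂) : inner ℝ X (extGrad s (signChar E) X) = 0 := by
  obtain ⟨hQ, hsub⟩ := scaledEnergy_sub hn hs hs1 hE hmin hint h₁ h₁₂ h₂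
  rw [heq, sub_self] at hsub
  have hB : MeasurableSet (halfBall n r₂ \ halfBall n r₁) :=
    (measurableSet_halfBall r₂).diff (measurableSet_halfBall r₁)
  have hnn : 0 ≤ᵐ[volume.restrict (halfBall n r₂ \ halfBall n r₁)] fun X : ExtSpace n =>
      X.snd ^ (1 - s) * (‖X‖ ^ 2) ^ (-((n - s) / 2) - 1) *
        inner ℝ X (extGrad s (signChar E) X) ^ 2 :=
    (ae_restrict_iff' hB).mpr (Eventually.of_forall fun X hX => by
      have hX0 : 0 < X.snd := hX.1.2
      dsimp only [Pi.zero_apply]; positivity)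
  have hae := (integral_eq_zero_iff_of_nonneg_ae hnn hQ).mp (by linarith)
  set S : Set (ExtSpace n) := {X | r₁ < ‖X‖ ∧ ‖X‖ < r₂} ∩ upperHalf n with hS
  have hSo : IsOpen S :=
    ((isOpen_lt continuous_const continuous_norm).inter
      (isOpen_lt continuous_norm continuous_const)).inter isOpen_upperHalf
  have hSB : S ⊆ halfBall n r₂ \ halfBall n r₁ := fun Y hY =>
    ⟨⟨by simpa using hY.1.2, hY.2⟩, fun h => by
      have : ‖Y‖ < r₁ := by simpa using h.1
      linarith [hY.1.1]⟩
  have hSu : S ⊆ upperHalf n := inter_subset_right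
  have hcont : ContinuousOn (fun X : ExtSpace n => X.snd ^ (1 - s) *
      (‖X‖ ^ 2) ^ (-((n - s) / 2) - 1) * inner ℝ X (extGrad s (signChar E) X) ^ 2) S := by
    refine ContinuousOn.mul (((continuousOn_rpow_snd _).mono hSu).mul ?_) ?_
    · exact ContinuousOn.rpow_const (by fun_prop) fun Y hY =>
        Or.inl (norm_sq_pos (show 0 < Y.snd from hY.2)).ne'
    · exact (ContinuousOn.inner (𝕜 := ℝ) continuousOn_id ((continuousOn_extGrad hs (measurable_signChar hE)
        (abs_signChar_le E)).mono hSu)).pow 2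
  have hz := Measure.eqOn_open_of_ae_eq (ae_restrict_of_ae_restrict_of_subset hSB hae) hSo hcont
    continuousOn_const (show X ∈ S from ⟨⟨hX₁, hX₂⟩, hX⟩)
  have hX0 : 0 < X.snd := hX
  have hq := norm_sq_pos hX0
  have hpos : X.snd ^ (1 - s) * (‖X‖ ^ 2) ^ (-((n - s) / 2) - 1) ≠ 0 := by positivity
  simpa [hpos] using hz

theorem monotonicity_of_measurableSet (hn : 1 ≤ n) (hs : 0 < s) (hs1 : s < 1) (hR : 0 < R)
    (hE : MeasurableSet E)
    (hmin : ∀ F : Set (EuclideanSpace ℝ (Fin n)), MeasurableSet F →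
      F ∩ (Metric.ball 0 R)ᶜ = E ∩ (Metric.ball 0 R)ᶜ →
      localEnergy s (Metric.ball 0 R) E ≤ localEnergy s (Metric.ball 0 R) F) :
    (∀ r ∈ Ioo 0 R, IntegrableOn (energyDensity s (csExtension s (signChar E))) (halfBall n r)) ∧
    MonotoneOn (scaledEnergy s E) (Ioo 0 R) ∧
    ((∃ c : ℝ, ∀ r ∈ Ioo 0 R, scaledEnergy s E r = c) ↔
      IsHomogeneousZero (csExtension s (signChar E))) := by
  have hm := measurable_signChar hE
  have hb := abs_signChar_le E
  have hEf : localEnergy s (Metric.ball 0 R) E ≠ ⊤ := by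
    -- The competitor `E \ B_R` has finite energy.
    refine ne_top_of_le_ne_top (localEnergy_diff_ball_ne_top hn hs hs1 R (E := E))
      (hmin _ (hE.diff measurableSet_ball) ?_)
    ext x; simp
  have hint : IntegrableOn (fun X => X.snd ^ (1 - s) * ‖extGrad s (signChar E) X‖ ^ 2)
      (halfBall n R) :=
    (integrableOn_energy hs hm hb measurableSet_ball
      (ne_top_of_le_ne_top (ENNReal.mul_ne_top (by norm_num) hEf)
        (gagliardo_le_localEnergy hE measurableSet_ball))).mono_set (halfBall_subset_cyl R)
  refine ⟨fun r hr => ?_, ?_, ?_, ?_⟩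
  · refine IntegrableOn.congr_fun (hint.mono_set (halfBall_mono hr.2.le)) (fun X hX => ?_)
      (measurableSet_halfBall r)
    simp only [energyDensity]
    rw [gradient_csExtension hs hm hb hX.2]
  · intro r₁ h₁ r₂ h₂ h₁₂
    rcases h₁₂.eq_or_lt with rfl | h₁₂
    · exact le_rfl
    · have h := (scaledEnergy_sub hn hs hs1 hE hmin hint h₁.1 h₁₂ h₂.2).2
      have h0 : 0 ≤ ∫ X in halfBall n r₂ \ halfBall n r₁, X.snd ^ (1 - s) *
          (‖X‖ ^ 2) ^ (-((n - s) / 2) - 1) * inner ℝ X (extGrad s (signChar E) X) ^ 2 := by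
        refine setIntegral_nonneg
          ((measurableSet_halfBall r₂).diff (measurableSet_halfBall r₁)) fun X hX => ?_
        have hX0 : 0 < X.snd := hX.1.2
        positivity
      linarith
  · rintro ⟨c, hc⟩
    refine isHomogeneousZero_of_radial_derivative hs hm hb hR fun X hX => ?_
    have hX0 : 0 < ‖X‖ :=
      (show 0 < X.snd from hX.2).trans_le ((le_abs_self _).trans (abs_snd_le X))
    have hXR : ‖X‖ < R := by simpa using hX.1
    have h1 : (‖X‖ + R) / 2 < R := by linarith
    -- Any two radii below `R` that enclose `|X|` would do.
    refine radial_derivative_of_scaledEnergy_eq hn hs hs1 hE hmin hint (r₁ := ‖X‖ / 2)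
      (r₂ := (‖X‖ + R) / 2) (by linarith) (by linarith) h1 ?_ hX.2 (by linarith) (by linarith)
    rw [hc _ ⟨by linarith, by linarith⟩, hc _ ⟨by linarith, h1⟩]
  · intro hhom
    have hle : ∀ r₁ r₂, 0 < r₁ → r₁ < r₂ → r₂ < R →
        scaledEnergy s E r₁ = scaledEnergy s E r₂ := by
      intro r₁ r₂ h₁ h₁₂ h₂
      have h := (scaledEnergy_sub hn hs hs1 hE hmin hint h₁ h₁₂ h₂).2
      rw [setIntegral_eq_zero_of_forall_eq_zero fun X hX => by
        rw [radial_derivative_of_isHomogeneousZero hs hm hb hhom hX.1.2]; simp] at h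
      linarith
    refine ⟨scaledEnergy s E (R / 2), fun r hr => ?_⟩
    rcases lt_trichotomy r (R / 2) with h | h | h
    · exact hle _ _ hr.1 h (by linarith)
    · rw [h]
    · exact (hle _ _ (by linarith) h hr.2).symm

/-! ### Sets that agree almost everywhere -/

lemma interaction_congr {A A' B B' : Set (EuclideanSpace ℝ (Fin n))} (hA : A =ᵐ[volume] A')
    (hB : B =ᵐ[volume] B') : interaction s A B = interaction s A' B' := by
  rw [interaction, setLIntegral_congr hA]
  exact lintegral_congr fun x => setLIntegral_congr hB

lemma localEnergy_congr {Ω F : Set (EuclideanSpace ℝ (Fin n))} (h : E =ᵐ[volume] F) :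
    localEnergy s Ω E = localEnergy s Ω F := by
  have hΩ : Ω =ᵐ[volume] Ω := Filter.EventuallyEq.rfl
  rw [localEnergy, localEnergy, interaction_congr (h.inter hΩ) h.compl,
    interaction_congr (h.diff hΩ) (h.compl.inter hΩ)]

lemma csExtension_signChar_congr {F : Set (EuclideanSpace ℝ (Fin n))} (h : E =ᵐ[volume] F) :
    csExtension s (signChar E) = csExtension s (signChar F) := by
  ext X
  refine integral_congr_ae ?_
  filter_upwards [h.mem_iff] with y hy
  by_cases hyE : y ∈ E
  · rw [signChar_of_mem hyE, signChar_of_mem (hy.mp hyE)]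
  · rw [signChar_of_notMem hyE, signChar_of_notMem fun h' => hyE (hy.mpr h')]

/-- A null modification changes neither energies nor the extension, so a Borel representative
inherits minimality, here among Borel competitors. -/
lemma IsMinimizer.exists_measurableSet (h : IsMinimizer s (Metric.ball 0 R) E) :
    ∃ E' : Set (EuclideanSpace ℝ (Fin n)), MeasurableSet E' ∧ E' =ᵐ[volume] E ∧
      ∀ F : Set (EuclideanSpace ℝ (Fin n)), MeasurableSet F →
        F ∩ (Metric.ball 0 R)ᶜ = E' ∩ (Metric.ball 0 R)ᶜ →
        localEnergy s (Metric.ball 0 R) E' ≤ localEnergy s (Metric.ball 0 R) F := by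
  obtain ⟨E', -, hE'm, hE'⟩ := h.1.exists_measurable_superset_ae_eq
  refine ⟨E', hE'm, hE', fun F hF hFE => ?_⟩
  have hball : MeasurableSet (Metric.ball (0 : EuclideanSpace ℝ (Fin n)) R) := measurableSet_ball
  -- `F` agrees with `E'` outside the ball but with `E` only up to a null set; gluing in `E` there
  -- gives an admissible competitor almost everywhere equal to `F`.
  set F' := F ∩ Metric.ball 0 R ∪ E ∩ (Metric.ball 0 R)ᶜ with hF'
  have h1 : F' =ᵐ[volume] F := by
    have h2 : F' =ᵐ[volume] (F ∩ Metric.ball 0 R ∪ E' ∩ (Metric.ball 0 R)ᶜ :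
        Set (EuclideanSpace ℝ (Fin n))) :=
      Filter.EventuallyEq.rfl.union (hE'.symm.inter Filter.EventuallyEq.rfl)
    rwa [← hFE, inter_union_compl] at h2
  have h3 : F' ∩ (Metric.ball 0 R)ᶜ = E ∩ (Metric.ball 0 R)ᶜ := by
    ext x
    simp only [hF', mem_inter_iff, mem_union, mem_compl_iff]
    tauto
  rw [localEnergy_congr hE', ← localEnergy_congr h1]
  exact h.2 F' ((hF.inter hball).nullMeasurableSet.union
    (h.1.inter hball.compl.nullMeasurableSet)) h3

end monotone


end

end NonlocalMinimal

/-! ### The theorem for Lebesgue measurable minimizers. -/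

theorem mainTheorem3 (n : ℕ) (hn : 1 ≤ n) (s : ℝ) (hs0 : 0 < s) (hs1 : s < 1)
    (R : ℝ) (hR : 0 < R) (E : Set (EuclideanSpace ℝ (Fin n)))
    (hE : NonlocalMinimal.IsMinimizer s (Metric.ball 0 R) E) :
    (∀ r ∈ Set.Ioo 0 R, MeasureTheory.IntegrableOn
      (NonlocalMinimal.energyDensity s
        (NonlocalMinimal.csExtension s (NonlocalMinimal.signChar E)))
      (NonlocalMinimal.halfBall n r)) ∧
    MonotoneOn (NonlocalMinimal.scaledEnergy s E) (Set.Ioo 0 R) ∧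
    ((∃ c : ℝ, ∀ r ∈ Set.Ioo 0 R, NonlocalMinimal.scaledEnergy s E r = c) ↔
      NonlocalMinimal.IsHomogeneousZero
        (NonlocalMinimal.csExtension s (NonlocalMinimal.signChar E))) := by
  obtain ⟨E', hE'm, hE', hmin⟩ := hE.exists_measurableSet
  have h1 : NonlocalMinimal.csExtension s (NonlocalMinimal.signChar E') =
      NonlocalMinimal.csExtension s (NonlocalMinimal.signChar E) :=
    NonlocalMinimal.csExtension_signChar_congr hE'
  have h2 : NonlocalMinimal.scaledEnergy s E' = NonlocalMinimal.scaledEnergy s E := by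
    ext r
    rw [NonlocalMinimal.scaledEnergy, NonlocalMinimal.scaledEnergy, h1]
  have h3 := NonlocalMinimal.monotonicity_of_measurableSet hn hs0 hs1 hR hE'm hmin
  rwa [h1, h2] at h3
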